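/- \textbf{Setting.} Let $\tau,\nu>0$, $H\in(0,1)$, $\mathbb T^2=\mathbb R^2/\mathbb Z^2$, $K=2\pi\mathbb Z^2\setminus\{(0,0)\}$, $e_k(x)=e^{i\langle k,x\rangle}$, and let $V\subset L^2(\mathbb T^2)$ be the subspace of functions of mean zero. Let $A e_k=-\alpha_k e_k$ and $Q^{1/2}e_k=\sqrt{\lambda_k}\,e_k$, where $\alpha_k=\alpha_{-k}\ge c>0$, $\alpha_k\to\infty$ as $|k|\to\infty$, and $\lambda_k=\lambda_{-k}\ge 0$ is bounded; let $S(t)=e^{t\nu A}$. On a probability space let $B^H(t)=\sum_{k\in K}\beta_k^H(t)e_k$, where $\sqrt2\,\mathrm{Re}\,\beta^H_k$ and $\sqrt2\,\mathrm{Im}\,\beta^H_k$ are independent normalized real two-sided fractional Brownian motions with Hurst parameter $H$ (centered Gaussian, a.s. continuous and zero at time $0$, with covariance $\frac12(|t|^{2H}+|s|^{2H}-|t-s|^{2H})$), $\beta^H_{-k}=(\beta^H_k)^*$, and the $\beta_k^H$ are independent otherwise. A mild solution of $$d\psi_t=\nu A\psi_t\,dt+\nu^H Q^{1/2}\,dB^H_t$$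 is a $V$-valued process with, for all $t\ge0$, a.s. $$\psi(t)=S(t)\psi(0)+\sum_{k\in K}\sqrt{\lambda_k}\,\nu^H\int_0^te^{-(t-u)\nu\alpha_k}\,d\beta_k^H(u)\,e_k ,$$ the series converging in $L^2(\Omega,V)$. Assume that for some integer $m\ge 2$ and some $\gamma\in(0,1)$ $$\sum_{k\in K}\lambda_k\alpha_k^{2\gamma-2H}|k|^{2m}<\infty\quad\text{and}\quad\sum_{k\in K}\lambda_k\alpha_k^{-2H}|k|^{2m+2\gamma}<\infty .$$ \textbf{Base system.} There is exactly one probability measure $\mathbb P$ on $\Omega=C(\mathbb R,C^m(\mathbb T^2))$ (real-valued functions, compact-open topology, Borel $\sigma$-algebra $\mathcal F$) which is the distribution of a process indexed by $\mathbb R$ that is strictly stationary and a mild solution of the above equation. With the shifts $\theta(t)\psi(s)=\psi(t+s)$, $(\Omega,\mathcal F,\mathbb P,(\theta(t))_{t\in\mathbb R})$ is an ergodic metric dynamical system: $(\psi,t)\mapsto\theta(t)\psi$ is measurable, $\theta(0)=\mathrm{id}$, $\theta(t+s)=\theta(t)\circ\theta(s)$, every $\theta(t)$ preserves $\mathbb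 P$, and every $A\in\mathcal F$ with $\theta(t)^{-1}A=A$ for all $t$ has $\mathbb P(A)\in\{0,1\}$. There is a set $\Omega_0\in\mathcal F$ with $\theta(t)^{-1}\Omega_0=\Omega_0$ for all $t\in\mathbb R$ and $\mathbb P(\Omega_0)=1$ such that for all $\psi\in\Omega_0$ and $\delta>0$ there is $C>0$ with $|\psi(t)|_{C^m(\mathbb T^2)}\le\delta|t|+C$ for all $t\in\mathbb R$. \textbf{Conclusion.} Let $\Omega_0$ be any set with these properties, with the trace of $\mathcal F$ and the restrictions of $\mathbb P$ and $\theta$. For every $\psi\in\Omega_0$ and $(x,y)\in\mathbb T^2\times\mathbb R^2$ the system $$\frac{d}{dt}\binom{x(t)}{\dot x(t)}=\begin{pmatrix}\dot x(t)\\ \frac1\tau\big(\nabla^\perp\psi(x(t),t)-\dot x(t)\big)\end{pmatrix},\qquad \binom{x(0)}{\dot x(0)}=\binom xy,\qquad \nabla^\perp\psi=\Big(\frac{\partial\psi}{\partial x_2},-\frac{\partial\psi}{\partial x_1}\Big),$$ has a unique global solution on $\mathbb R$. Put $\phi(t,\psi)(x,y)=(x(t),\dot x(t))$. For each $\psi\in\Omega_0$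 the map $t\mapsto\phi(t,\psi)$ belongs to $C^1(\mathbb R,C^{m-1}(\mathbb T^2\times\mathbb R^2,\mathbb T^2\times\mathbb R^2))$. Moreover $\phi$ is a $C^{m-1}$ random dynamical system over the ergodic metric dynamical system $(\Omega_0,\mathcal F,\mathbb P,(\theta(t))_{t\in\mathbb R})$: the map $(t,\psi,z)\mapsto\phi(t,\psi)z$ is $\mathcal B(\mathbb R)\otimes\mathcal F\otimes\mathcal B(\mathbb T^2\times\mathbb R^2)$-measurable, $\phi(0,\psi)=\mathrm{id}$ and $\phi(t+s,\psi)=\phi(t,\theta(s)\psi)\circ\phi(s,\psi)$ for all $s,t\in\mathbb R$ and $\psi\in\Omega_0$, and each $z\mapsto\phi(t,\psi)z$ is $m-1$ times differentiable, with all derivatives up to order $m-1$ continuous in $(t,z)$ for each $\psi$. -/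

import Mathlib

open MeasureTheory ProbabilityTheory Filter Topology
open scoped ENNReal

namespace InertialParticle

noncomputable section

/-! ### The torus `𝕋² = ℝ²/ℤ²` and the Banach space `C^m(𝕋²)` -/

/-- The Euclidean plane. -/
abbrev Plane : Type := EuclideanSpace ℝ (Fin 2)

/-- The torus `𝕋² = ℝ²/ℤ²`. -/
abbrev Torus : Type := UnitAddTorus (Fin 2)

/-- The covering map `ℝ² → 𝕋²`. -/
def cover (x : Plane) : Torus := fun i => ((x i : ℝ) : UnitAddCircle)

/-- The `m` times continuously differentiable functions `𝕋² → ℝ`, i.e. those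
whose `ℤ²`-periodic pullback to the plane is of class `C^m`. -/
def cmSubmodule (m : ℕ) : Submodule ℝ C(Torus, ℝ) where
  carrier := {f | ContDiff ℝ m (fun x : Plane => f (cover x))}
  add_mem' {f g} hf hg := by
    have hf' : ContDiff ℝ m (fun x : Plane => f (cover x)) := hf
    have hg' : ContDiff ℝ m (fun x : Plane => g (cover x)) := hg
    exact hf'.add hg'
  zero_mem' := by
    simpa using (contDiff_const : ContDiff ℝ m (fun _ : Plane => (0 : ℝ)))
  smul_mem' c f hf := by
    have hf' : ContDiff ℝ m (fun x : Plane => f (cover x)) := hf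
    exact hf'.const_smul c

/-- The space `C^m(𝕋²)` of real-valued functions; its norm is defined below. -/
def CmTorus (m : ℕ) : Type := ↥(cmSubmodule m)

instance (m : ℕ) : AddCommGroup (CmTorus m) := inferInstanceAs (AddCommGroup ↥(cmSubmodule m))

instance (m : ℕ) : Module ℝ (CmTorus m) := inferInstanceAs (Module ℝ ↥(cmSubmodule m))

/-- The underlying continuous function on the torus. -/
def CmTorus.toCont {m : ℕ} (f : CmTorus m) : C(Torus, ℝ) := f.1

/-- The periodic pullback to the plane. -/
def CmTorus.pull {m : ℕ} (f : CmTorus m) (x : Plane) : ℝ := f.toCont (cover x)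

theorem CmTorus.contDiff_pull {m : ℕ} (f : CmTorus m) : ContDiff ℝ m f.pull := f.2

theorem exists_int_sub_mem_ball (x : Plane) :
    ∃ y ∈ Metric.closedBall (0 : Plane) 2, ∃ a : Plane, x = y + a ∧
      ∀ z : Plane, cover (z + a) = cover z := by
  refine ⟨WithLp.toLp 2 (fun i => Int.fract (x i)), ?_,
    WithLp.toLp 2 (fun i => ((⌊x i⌋ : ℤ) : ℝ)), ?_, ?_⟩
  · rw [mem_closedBall_zero_iff, EuclideanSpace.norm_eq]
    apply Real.sqrt_le_iff.2
    refine ⟨by norm_num, ?_⟩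
    simp only [Fin.sum_univ_two, Real.norm_eq_abs, sq_abs]
    have h0 := Int.fract_nonneg (x 0)
    have h1 := Int.fract_nonneg (x 1)
    have h2 := (Int.fract_lt_one (x 0)).le
    have h3 := (Int.fract_lt_one (x 1)).le
    nlinarith
  · ext i
    simp [Int.fract_add_floor]
  · intro z
    funext i
    simp [cover]

theorem CmTorus.exists_bound {m : ℕ} (f : CmTorus m) (j : ℕ) (hj : j ≤ m) :
    ∃ C, ∀ x, ‖iteratedFDeriv ℝ j f.pull x‖ ≤ C := by
  have hc : Continuous (iteratedFDeriv ℝ j f.pull) :=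
    f.contDiff_pull.continuous_iteratedFDeriv (by exact_mod_cast hj)
  obtain ⟨C, hC⟩ := (isCompact_closedBall (0 : Plane) 2).exists_bound_of_continuousOn
    hc.continuousOn
  refine ⟨C, fun x => ?_⟩
  obtain ⟨y, hy, a, rfl, ha⟩ := exists_int_sub_mem_ball x
  have : iteratedFDeriv ℝ j f.pull (y + a) = iteratedFDeriv ℝ j f.pull y := by
    rw [← iteratedFDeriv_comp_add_right j a y]
    congr 1
    funext z
    simp [CmTorus.pull, ha]
  rw [this]
  exact hC y hy

/-- Bounded continuous functions on the plane whose values are `j`-linear forms, with the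
supremum norm. -/
abbrev JetComp (j : ℕ) : Type := BoundedContinuousFunction Plane (Plane [×j]→L[ℝ] ℝ)

/-- Families `(u₀, …, u_m)` of such functions, with the maximum norm. -/
def JetSpace (m : ℕ) : Type := (j : Fin (m + 1)) → JetComp (j : ℕ)

instance (m : ℕ) : NormedAddCommGroup (JetSpace m) :=
  inferInstanceAs (NormedAddCommGroup ((j : Fin (m + 1)) → JetComp (j : ℕ)))

instance (m : ℕ) : NormedSpace ℝ (JetSpace m) :=
  inferInstanceAs (NormedSpace ℝ ((j : Fin (m + 1)) → JetComp (j : ℕ)))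

/-- The derivatives of orders `0, …, m` as bounded continuous functions. -/
def jets (m : ℕ) : CmTorus m →ₗ[ℝ] JetSpace m where
  toFun f j := BoundedContinuousFunction.ofNormedAddCommGroup
    (iteratedFDeriv ℝ (j : ℕ) f.pull)
    (f.contDiff_pull.continuous_iteratedFDeriv (by exact_mod_cast Nat.lt_succ_iff.1 j.2))
    (f.exists_bound j (Nat.lt_succ_iff.1 j.2)).choose
    (f.exists_bound j (Nat.lt_succ_iff.1 j.2)).choose_spec
  map_add' f g := by
    funext j
    ext1 x
    have hj : ((j : ℕ) : WithTop ℕ∞) ≤ m := by exact_mod_cast Nat.lt_succ_iff.1 j.2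
    exact iteratedFDeriv_add_apply (f.contDiff_pull.of_le hj).contDiffAt
      (g.contDiff_pull.of_le hj).contDiffAt
  map_smul' c f := by
    funext j
    ext1 x
    have hj : ((j : ℕ) : WithTop ℕ∞) ≤ m := by exact_mod_cast Nat.lt_succ_iff.1 j.2
    exact iteratedFDeriv_const_smul_apply (a := c) (f.contDiff_pull.of_le hj).contDiffAt

theorem cover_surjective : Function.Surjective cover := by
  intro z
  choose x hx using fun i => QuotientAddGroup.mk_surjective (z i)
  exact ⟨WithLp.toLp 2 x, funext hx⟩

theorem jets_injective (m : ℕ) : Function.Injective (jets m) := by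
  intro f g h
  apply Subtype.ext
  ext z
  obtain ⟨x, rfl⟩ := cover_surjective z
  have h1 := congrArg (fun F : JetSpace m => (F (0 : Fin (m + 1))) x) h
  have h2 : iteratedFDeriv ℝ 0 f.pull x = iteratedFDeriv ℝ 0 g.pull x := h1
  have h3 := congrArg (fun L => L (fun _ => (0 : Plane))) h2
  rw [iteratedFDeriv_zero_apply, iteratedFDeriv_zero_apply] at h3
  exact h3

/-- The norm `|f|_{C^m} = max_{j ≤ m} sup_x ‖D^j f(x)‖`. -/
instance (m : ℕ) : NormedAddCommGroup (CmTorus m) :=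
  NormedAddCommGroup.induced _ _ (jets m) (jets_injective m)

instance (m : ℕ) : NormedSpace ℝ (CmTorus m) := NormedSpace.induced ℝ (CmTorus m) (JetSpace m) (jets m)

instance (m : ℕ) : MeasurableSpace (CmTorus m) := borel _

instance (m : ℕ) : BorelSpace (CmTorus m) := ⟨rfl⟩

/-- The path space `C(ℝ, C^m(𝕋²))`, with the compact-open topology. -/
def PathSpace (m : ℕ) : Type := C(ℝ, CmTorus m)

instance (m : ℕ) : TopologicalSpace (PathSpace m) := inferInstanceAs (TopologicalSpace C(ℝ, _))

instance (m : ℕ) : MeasurableSpace (PathSpace m) := borel _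

instance (m : ℕ) : BorelSpace (PathSpace m) := ⟨rfl⟩

/-- The value `ψ(t) ∈ C^m(𝕋²)` of a path. -/
def PathSpace.at {m : ℕ} (ψ : PathSpace m) (t : ℝ) : CmTorus m := ContinuousMap.toFun ψ t

/-- The shift `(θ(t)ψ)(s) = ψ(t + s)`. -/
def shift {m : ℕ} (t : ℝ) (ψ : PathSpace m) : PathSpace m :=
  ContinuousMap.comp ψ ⟨fun s => t + s, by fun_prop⟩

/-! ### Fractional Brownian motion and the stochastic evolution equation -/

/-- A real-valued normalized fractional Brownian motion on `ℝ` with Hurst parameter `H`. -/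
structure IsFBm {W : Type*} [MeasurableSpace W] (μ : Measure W) (H : ℝ) (b : ℝ → W → ℝ) :
    Prop where
  measurable : ∀ t, Measurable (b t)
  gaussian : IsGaussianProcess b μ
  zero : ∀ᵐ ω ∂μ, b 0 ω = 0
  mean : ∀ t, ∫ ω, b t ω ∂μ = 0
  cov : ∀ s t, ∫ ω, b t ω * b s ω ∂μ =
    (1 / 2) * (|t| ^ (2 * H) + |s| ^ (2 * H) - |t - s| ^ (2 * H))
  cont : ∀ᵐ ω ∂μ, Continuous (fun t => b t ω)

/-- The indices of the Fourier modes: `n ∈ ℤ² \ {0}` stands for the wave vector `k = 2πn`. -/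
abbrev Mode : Type := {n : Fin 2 → ℤ // n ≠ 0}

instance : Neg Mode := ⟨fun n => ⟨-n.1, neg_ne_zero.2 n.2⟩⟩

/-- The length `|k|` of the wave vector `k = 2πn`. -/
def waveNorm (n : Mode) : ℝ := ‖(!₂[2 * Real.pi * n.1 0, 2 * Real.pi * n.1 1] : Plane)‖

/-- The coefficients of an infinite-dimensional fractional Brownian motion `∑ₖ βₖ eₖ`: complex
valued fractional Brownian motions, the real and imaginary parts of each of them being independent
and of the form `2^{-1/2}` times a normalized one, with `β₋ₖ` the conjugate of `βₖ`, and
independent otherwise. -/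
structure IsNoise {W : Type*} [MeasurableSpace W] (μ : Measure W) (H : ℝ)
    (β : Mode → ℝ → W → ℂ) : Prop where
  re_isFBm : ∀ k, IsFBm μ H (fun t ω => √2 * (β k t ω).re)
  im_isFBm : ∀ k, IsFBm μ H (fun t ω => √2 * (β k t ω).im)
  indep_re_im : ∀ k, IndepFun (fun ω (t : ℝ) => (β k t ω).re) (fun ω (t : ℝ) => (β k t ω).im) μ
  conj : ∀ k, ∀ᵐ ω ∂μ, ∀ t, β (-k) t ω = starRingEnd ℂ (β k t ω)
  indep : ∀ S : Set Mode, (∀ k ∈ S, -k ∉ S) →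
    iIndepFun (fun (k : S) ω (t : ℝ) => β k t ω) μ

/-- The standing conditions on the eigenvalues `-αₖ` of `A` and `√λₖ` of the bounded operator
`Q^{1/2}` with respect to the basis `eₖ`. -/
structure IsSpectralData (α lam : Mode → ℝ) : Prop where
  alpha_lower : ∃ c > 0, ∀ k, c ≤ α k
  alpha_neg : ∀ k, α (-k) = α k
  alpha_tendsto : Tendsto α cofinite atTop
  lam_nonneg : ∀ k, 0 ≤ lam k
  lam_neg : ∀ k, lam (-k) = lam k
  lam_bdd : ∃ C, ∀ k, lam k ≤ C

/-- The normalized Haar measure of the torus. -/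
def torusMeasure : Measure Torus := Measure.pi fun _ => AddCircle.haarAddCircle

instance : IsProbabilityMeasure torusMeasure := by
  unfold torusMeasure; infer_instance

/-- The complex Hilbert space `L²(𝕋²)`. -/
abbrev L2Torus : Type := Lp ℂ 2 torusMeasure

/-- The exponential `eₖ(x) = e^{i⟨k, x⟩}`, `k = 2πn`, as an element of `L²(𝕋²)`. -/
def expMode (n : Mode) : L2Torus :=
  ContinuousMap.toLp 2 torusMeasure ℂ (UnitAddTorus.mFourier n.1)

/-- A function of class `C^m` on the torus as an element of `L²(𝕋²)`. -/
def CmTorus.toL2 {m : ℕ} (f : CmTorus m) : L2Torus :=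
  ContinuousMap.toLp 2 torusMeasure ℂ (ContinuousMap.comp ⟨_, Complex.continuous_ofReal⟩ f.toCont)

/-- The semigroup `S(t) f = ∑ₖ e^{-tναₖ} ⟨f, eₖ⟩ eₖ` generated by `νA` on the functions of mean
zero, `t ≥ 0`. -/
def semigroup (ν : ℝ) (α : Mode → ℝ) (t : ℝ) (f : L2Torus) : L2Torus :=
  ∑' k : Mode, ((Real.exp (-(t * ν * α k)) : ℂ) * inner ℂ (expMode k) f) • expMode k

/-- The pathwise (Riemann-Stieltjes) integral `∫_a^b f dg` of a continuously differentiable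
function `f` with respect to a continuous path `g`. -/
def pathIntegral (f : ℝ → ℝ) (g : ℝ → ℂ) (a b : ℝ) : ℂ :=
  f b • g b - f a • g a - ∫ u in a..b, deriv f u • g u

/-- The Fourier coefficient `√λₖ ν^H ∫₀ᵗ e^{-(t-u)ναₖ} dβₖ(u)` of the stochastic convolution. -/
def convCoeff {W : Type*} (H ν : ℝ) (α lam : Mode → ℝ) (β : Mode → ℝ → W → ℂ)
    (k : Mode) (t : ℝ) (ω : W) : ℂ :=
  ((√(lam k) * ν ^ H : ℝ) : ℂ) *
    pathIntegral (fun u => Real.exp (-((t - u) * ν * α k))) (fun u => β k u ω) 0 t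

/-- `Ψ` is a process with paths in `C(ℝ, C^m(𝕋²))` and values in the mean zero functions which is
a strictly stationary mild solution of `dψ = νAψ dt + ν^H Q^{1/2} dB^H`: for every `t ≥ 0`,
`ψ(t) = S(t)ψ(0) + ∫₀ᵗ S(t-s)Q^{1/2} dB^H(s)` almost surely, the series that
defines the stochastic convolution being convergent in `L²(Ω; L²(𝕋²))`. -/
structure IsStationaryMildSolution {W : Type*} [MeasurableSpace W] (μ : Measure W) (H ν : ℝ)
    (α lam : Mode → ℝ) (β : Mode → ℝ → W → ℂ) {m : ℕ} (Ψ : W → PathSpace m) : Prop where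
  measurable : AEMeasurable Ψ μ
  mean_zero : ∀ t, ∀ᵐ ω ∂μ, ∫ x, ((Ψ ω).at t).toCont x ∂torusMeasure = 0
  mild : ∀ t, 0 ≤ t → Tendsto
    (fun s : Finset Mode => ∫⁻ ω, ‖((Ψ ω).at t).toL2 - semigroup ν α t ((Ψ ω).at 0).toL2
      - ∑ k ∈ s, convCoeff H ν α lam β k t ω • expMode k‖ₑ ^ 2 ∂μ) atTop (𝓝 0)
  stationary : ∀ (n : ℕ) (t : Fin n → ℝ) (r : ℝ),
    μ.map (fun ω i => (Ψ ω).at (t i + r)) = μ.map (fun ω i => (Ψ ω).at (t i))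

/-- `P` is the distribution on `C(ℝ, C^m(𝕋²))` of a strictly stationary mild solution. -/
def IsStationaryLaw {W : Type*} [MeasurableSpace W] (μ : Measure W) (H ν : ℝ)
    (α lam : Mode → ℝ) (β : Mode → ℝ → W → ℂ) {m : ℕ} (P : Measure (PathSpace m)) : Prop :=
  ∃ Ψ : W → PathSpace m, IsStationaryMildSolution μ H ν α lam β Ψ ∧ P = μ.map Ψ

/-! ### Random dynamical systems -/

/-- `(Ω, 𝓕, P, θ)` is an ergodic metric dynamical system with time `ℝ`. -/
structure IsErgodicMDS {Ω : Type*} [MeasurableSpace Ω] (P : Measure Ω) (θ : ℝ → Ω → Ω) :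
    Prop where
  prob : IsProbabilityMeasure P
  measurable : Measurable (fun p : Ω × ℝ => θ p.2 p.1)
  zero : θ 0 = id
  flow : ∀ s t, θ (t + s) = θ t ∘ θ s
  preserves : ∀ t A, MeasurableSet A → P (θ t ⁻¹' A) = P A
  ergodic : ∀ A, MeasurableSet A → (∀ t, θ t ⁻¹' A = A) → P A = 0 ∨ P A = 1

/-- The measurability and cocycle properties of a random dynamical system on `X` over `θ`. -/
structure IsMeasurableCocycle {Ω X : Type*} [MeasurableSpace Ω] [MeasurableSpace X]
    (θ : ℝ → Ω → Ω) (φ : ℝ → Ω → X → X) : Prop where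
  measurable : Measurable (fun p : ℝ × Ω × X => φ p.1 p.2.1 p.2.2)
  zero : ∀ ω, φ 0 ω = id
  cocycle : ∀ s t ω, φ (t + s) ω = φ t (θ s ω) ∘ φ s ω

/-- The phase space `𝕋² × ℝ²` of positions and velocities. -/
abbrev Phase : Type := Torus × Plane

/-- The universal covering `ℝ² × ℝ² → 𝕋² × ℝ²`. -/
def phaseCover (p : Plane × Plane) : Phase := (cover p.1, p.2)

/-- `F` lifts the time-dependent self-map `Φ` of the phase space to its universal covering. -/
def IsLift (F : ℝ → Plane × Plane → Plane × Plane) (Φ : ℝ → Phase → Phase) : Prop :=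
  ∀ t p, phaseCover (F t p) = Φ t (phaseCover p)

/-- Every `F t` is `k` times differentiable, and all derivatives up to order `k` are jointly
continuous in time and space. -/
def HasContDerivs (k : ℕ) (F : ℝ → Plane × Plane → Plane × Plane) : Prop :=
  (∀ t, ContDiff ℝ k (F t)) ∧
  ∀ j ≤ k, Continuous (fun q : ℝ × (Plane × Plane) => iteratedFDeriv ℝ j (F q.1) q.2)

/-- A random dynamical system `φ` on the phase space over the ergodic metric dynamical system `θ`
which is of class `C^k`. -/
structure IsCkRDS {Ω : Type*} [MeasurableSpace Ω] (k : ℕ) (P : Measure Ω) (θ : ℝ → Ω → Ω)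
    (φ : ℝ → Ω → Phase → Phase) : Prop where
  base : IsErgodicMDS P θ
  isMeasurableCocycle : IsMeasurableCocycle θ φ
  smooth : ∀ ω, ∃ F, IsLift F (fun t => φ t ω) ∧ HasContDerivs k F

/-- `Φ` belongs to `C¹(ℝ, C^k(𝕋² × ℝ², 𝕋² × ℝ²))`: it has a lift `F` with a time derivative `G`,
where all space derivatives of `F` up to order `k` are differentiable in time, with
the corresponding derivative of `G` as time derivative, and everything is jointly continuous. -/
def IsC1Ck (k : ℕ) (Φ : ℝ → Phase → Phase) : Prop :=
  ∃ F G : ℝ → Plane × Plane → Plane × Plane, IsLift F Φ ∧ HasContDerivs k F ∧ HasContDerivs k G ∧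
    ∀ j ≤ k, ∀ t p, HasDerivAt (fun s => iteratedFDeriv ℝ j (F s) p) (iteratedFDeriv ℝ j (G t) p) t

/-! ### The particle equation -/

/-- `∇^⊥ f = (∂f/∂x₂, -∂f/∂x₁)` at the point of the torus below `x`. -/
def gradPerp {m : ℕ} (f : CmTorus m) (x : Plane) : Plane :=
  !₂[fderiv ℝ f.pull x (EuclideanSpace.single 1 1), -fderiv ℝ f.pull x (EuclideanSpace.single 0 1)]

/-- `c(t) = (x(t), ẋ(t))`, `t ∈ ℝ`, solves `τ ẍ(t) = ∇^⊥ψ(x(t), t) - ẋ(t)` with `c(0) = z`,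
as a first order system on `𝕋² × ℝ²`. The derivative of the torus-valued curve is taken
through a lift `X` to the plane. -/
def IsTrajectory {m : ℕ} (τ : ℝ) (ψ : PathSpace m) (z : Phase) (c : ℝ → Phase) : Prop :=
  c 0 = z ∧ ∃ X : ℝ → Plane, ∀ t, cover (X t) = (c t).1 ∧ HasDerivAt X (c t).2 t ∧
    HasDerivAt (fun s => (c s).2) (τ⁻¹ • (gradPerp (ψ.at t) (X t) - (c t).2)) t

/-- A measurable shift invariant set of full measure on which all paths grow sublinearly. -/
structure IsGrowthSet {m : ℕ} (P : Measure (PathSpace m)) (Ω₀ : Set (PathSpace m)) : Prop where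
  measurableSet : MeasurableSet Ω₀
  invariant : ∀ t, shift t ⁻¹' Ω₀ = Ω₀
  full : P Ω₀ = 1
  growth : ∀ ψ ∈ Ω₀, ∀ δ > 0, ∃ C > 0, ∀ t, ‖ψ.at t‖ ≤ δ * |t| + C

/-- The shift on an invariant set of paths. -/
def shiftOn {m : ℕ} (Ω₀ : Set (PathSpace m)) (h : ∀ t, shift t ⁻¹' Ω₀ = Ω₀) (t : ℝ) (ψ : Ω₀) :
    Ω₀ :=
  ⟨shift t ψ.1, by
    have h1 : ψ.1 ∈ shift t ⁻¹' Ω₀ := by rw [h t]; exact ψ.2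
    exact h1⟩

end

end InertialParticle

open InertialParticle

namespace InertialParticle

noncomputable section

set_option linter.unusedSectionVars false

/-! ### The Banach space `C^m(𝕋²)` -/

section CmSpace

variable {m : ℕ}

/-! The equation is diagonal in the Fourier basis. With `a = ν α k`, the stationary solution in mode
`k` is a multiple of the fractional Ornstein-Uhlenbeck process `Y(t) = ∫_{-∞}^t e^{-a(t-u)} dB(u) =
∫₀^∞ a e^{-av} (B(t) - B(t-v)) dv`. The second form is a Bochner integral in `L²` of the probability
space, so the size and the covariance of `Y` follow from the covariance of `B` alone.

Regularity. One has `‖Y(t)‖ ≤ C a^{-H}` and `‖Y(s) - Y(t)‖ ≤ C |s-t|^H`, hence by interpolation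
`‖Y(s) - Y(t)‖ ≤ C a^{γ-H} |s-t|^γ` for `γ ≤ H`. The two summability hypotheses say exactly that the
derivatives of order at most `m` of the Fourier series satisfy summable Hölder bounds in `L²`,
jointly in time and space. Chaining along dyadic grids (`IsNoise.exists_sup_bound`) turns such
bounds into bounds for expected suprema. Grouped into blocks, the series converges absolutely in
`C^m`, locally uniformly in time, outside a null set (`IsModeSeries.exists_path`).

Law. All variables in question lie in one closed subspace of `L²` on which the characteristic
function is `exp(-‖X‖²/2)` (`IsNoise.gaussChar_of_mem_space`), and a law on the path space is
determined by the characteristic functions of finitely many Fourier coefficients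
(`path_measure_ext`). Shift invariance of covariances therefore gives stationarity. Covariances also
tend to zero because `H < 1`, and a mean-square averaging argument then gives ergodicity
(`IsFouField.ergodic`). For uniqueness, two mild solutions driven by the same noise differ in each
mode by a multiple of `e^{-ta}`, which dies out, while stationarity keeps their laws fixed
(`IsStationaryMildSolution.map_eq`). Sublinear growth is Borel-Cantelli applied to the integrable
supremum over a unit time window.

Dynamics. For a fixed path the particle equation is a nonautonomous ODE whose field is of class
`C^{m-1}` in space and globally Lipschitz, uniformly on compact time intervals. Solutions on `[-T,
T]` are the zeros of `X ↦ X - ∫₀ f(u, X) du - y`. This map of `C([-T, T], E)` is bijective by Picard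
iteration and `C^{m-1}` with invertible derivative, so the solution is `C^{m-1}` in `y`
(`exists_contDiff_solution`). Constant `y` gives smoothness in the initial value, and general `y`
gives stability under perturbation of the field, hence measurability in the path. Uniqueness of
solutions gives both the cocycle property and the descent from `ℝ² × ℝ²` to the phase space
(`exists_particle_rds`). -/

theorem CmTorus.norm_le_iff (f : CmTorus m) {C : ℝ} (hC : 0 ≤ C) :
    ‖f‖ ≤ C ↔ ∀ j ≤ m, ∀ x, ‖iteratedFDeriv ℝ j f.pull x‖ ≤ C := by
  have h1 : ‖f‖ = ‖(jets m f : (j : Fin (m + 1)) → JetComp (j : ℕ))‖ := rfl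
  refine (iff_of_eq (congrArg (· ≤ C) h1)).trans ((pi_norm_le_iff_of_nonneg hC).trans ?_)
  constructor
  · intro h j hj x
    exact (BoundedContinuousFunction.norm_le hC).1 (h ⟨j, Nat.lt_succ_of_le hj⟩) x
  · intro h j
    exact (BoundedContinuousFunction.norm_le hC).2 fun x => h j (Nat.lt_succ_iff.1 j.2) x

theorem CmTorus.norm_iteratedFDeriv_le (f : CmTorus m) {j : ℕ} (hj : j ≤ m) (x : Plane) :
    ‖iteratedFDeriv ℝ j f.pull x‖ ≤ ‖f‖ :=
  (f.norm_le_iff (norm_nonneg _)).1 le_rfl j hj x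

theorem CmTorus.norm_toCont_le (f : CmTorus m) : ‖f.toCont‖ ≤ ‖f‖ := by
  rw [ContinuousMap.norm_le _ (norm_nonneg _)]
  intro z
  obtain ⟨x, rfl⟩ := cover_surjective z
  simpa using! f.norm_iteratedFDeriv_le (Nat.zero_le m) x

/-- The inclusion of `C^m(𝕋²)` into the continuous functions. -/
def toContL (m : ℕ) : CmTorus m →L[ℝ] C(Torus, ℝ) :=
  LinearMap.mkContinuous (cmSubmodule m).subtype 1
    (fun f => by simpa using! CmTorus.norm_toCont_le f)

@[simp] theorem toContL_apply (f : CmTorus m) : toContL m f = f.toCont := rfl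

theorem CmTorus.toCont_injective : Function.Injective (CmTorus.toCont (m := m)) :=
  Subtype.val_injective

theorem continuous_cover : Continuous cover := by
  unfold cover
  refine continuous_pi fun i => ?_
  exact (AddCircle.continuous_mk' 1).comp (by fun_prop)

/-- The sup bounds of every derivative are dominated by `‖u i‖`, so the series may be differentiated
term by term. The norm bound is what controls the tails in the proof of completeness. -/
theorem exists_toCont_eq_tsum (u : ℕ → CmTorus m) (hu : Summable fun i => ‖u i‖) :
    ∃ g : CmTorus m, g.toCont = ∑' i, (u i).toCont ∧ ‖g‖ ≤ ∑' i, ‖u i‖ := by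
  have hs : Summable fun i => (u i).toCont :=
    Summable.of_norm_bounded hu fun i => (u i).norm_toCont_le
  have hp : (fun x : Plane => (∑' i, (u i).toCont) (cover x)) = fun x => ∑' i, (u i).pull x := by
    funext x
    exact ((ContinuousMap.evalCLM ℝ (cover x)).map_tsum hs)
  have hv : ∀ k : ℕ, (k : ℕ∞) ≤ (m : ℕ∞) → Summable fun i => ‖u i‖ := fun _ _ => hu
  have hb : ∀ (k : ℕ) (i : ℕ) (x : Plane), (k : ℕ∞) ≤ (m : ℕ∞) →
      ‖iteratedFDeriv ℝ k (u i).pull x‖ ≤ ‖u i‖ :=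
    fun k i x hk => (u i).norm_iteratedFDeriv_le (by exact_mod_cast hk) x
  have hc : ContDiff ℝ m (fun x : Plane => (∑' i, (u i).toCont) (cover x)) := by
    rw [hp]
    exact contDiff_tsum (N := (m : ℕ∞)) (fun i => (u i).contDiff_pull) hv hb
  obtain ⟨g, hg⟩ : ∃ g : CmTorus m, g.toCont = ∑' i, (u i).toCont := ⟨⟨_, hc⟩, rfl⟩
  refine ⟨g, hg, ?_⟩
  rw [CmTorus.norm_le_iff _ (tsum_nonneg fun i => norm_nonneg _)]
  intro j hj x
  have : iteratedFDeriv ℝ j g.pull x = ∑' i, iteratedFDeriv ℝ j (u i).pull x := by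
    have h1 : g.pull = fun x => ∑' i, (u i).pull x := by
      rw [← hp, ← hg]; rfl
    rw [h1]
    exact iteratedFDeriv_tsum_apply (N := (m : ℕ∞)) (fun i => (u i).contDiff_pull) hv hb
      (by exact_mod_cast hj) x
  rw [this]
  exact tsum_of_norm_bounded hu.hasSum fun i => (u i).norm_iteratedFDeriv_le hj x

/-- It suffices that absolutely convergent series converge. The error of a partial sum is minus the
sum of the shifted series, whose norm is at most the tail of `∑ ‖u i‖`. -/
instance : CompleteSpace (CmTorus m) := by
  refine NormedAddCommGroup.completeSpace_of_summable_imp_tendsto fun u hu => ?_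
  obtain ⟨g, hg, -⟩ := exists_toCont_eq_tsum u hu
  refine ⟨g, ?_⟩
  rw [tendsto_iff_norm_sub_tendsto_zero]
  refine squeeze_zero (fun _ => norm_nonneg _) (fun n => ?_) (tendsto_sum_nat_add fun i => ‖u i‖)
  obtain ⟨g', hg', hn⟩ := exists_toCont_eq_tsum (fun i => u (i + n))
    ((summable_nat_add_iff n).2 hu)
  have hs : Summable fun i => (u i).toCont :=
    Summable.of_norm_bounded hu fun i => (u i).norm_toCont_le
  have : ∑ i ∈ Finset.range n, u i - g = -g' := by
    apply CmTorus.toCont_injective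
    rw [← toContL_apply, ← toContL_apply, map_sub, map_sum, map_neg]
    simp only [toContL_apply]
    rw [hg, hg', ← hs.sum_add_tsum_nat_add n]
    abel
  rw [this, norm_neg]
  exact hn

instance (j : ℕ) : FiniteDimensional ℝ (Plane [×j]→L[ℝ] ℝ) :=
  FiniteDimensional.of_injective
    (ContinuousMultilinearMap.toMultilinearMapLinear  :
      (Plane [×j]→L[ℝ] ℝ) →ₗ[ℝ] MultilinearMap ℝ (fun _ : Fin j => Plane) ℝ)
    ContinuousMultilinearMap.toMultilinearMap_injective

/-- A closed ball of radius 2 contains a fundamental domain, so restricting the derivatives to it is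
an isometry into a finite product of spaces `C(B, V)` with `B` compact and `V` finite-dimensional,
and these are second countable. Together with completeness this makes the path space Polish. -/
instance : SecondCountableTopology (CmTorus m) := by
  have hP : ∀ j : ℕ, SecondCountableTopology (Plane [×j]→L[ℝ] ℝ) := fun j =>
    haveI := FiniteDimensional.proper ℝ (Plane [×j]→L[ℝ] ℝ)
    inferInstance
  let B := Metric.closedBall (0 : Plane) 2
  have : CompactSpace B := isCompact_iff_compactSpace.1 (isCompact_closedBall (0 : Plane) 2)
  let r : CmTorus m → ((j : Fin (m + 1)) → C(B, Plane [×(j : ℕ)]→L[ℝ] ℝ)) := fun f j =>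
    ⟨fun x => iteratedFDeriv ℝ (j : ℕ) f.pull x, (f.contDiff_pull.continuous_iteratedFDeriv
      (by exact_mod_cast Nat.lt_succ_iff.1 j.2)).comp continuous_subtype_val⟩
  have hr : ∀ f g, dist (r f) (r g) = dist f g := by
    intro f g
    have key : ∀ (j : Fin (m + 1)) (x : Plane), iteratedFDeriv ℝ (j : ℕ) (f - g).pull x =
        iteratedFDeriv ℝ (j : ℕ) f.pull x - iteratedFDeriv ℝ (j : ℕ) g.pull x := by
      intro j x
      have := congrArg (fun F : JetSpace m => F j x) ((jets m).map_sub f g)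
      exact this
    apply le_antisymm
    · rw [dist_pi_le_iff dist_nonneg]
      intro j
      rw [ContinuousMap.dist_le dist_nonneg]
      intro x
      rw [dist_eq_norm, dist_eq_norm]
      show ‖iteratedFDeriv ℝ (j : ℕ) f.pull x - iteratedFDeriv ℝ (j : ℕ) g.pull x‖ ≤ _
      rw [← key]
      exact (f - g).norm_iteratedFDeriv_le (Nat.lt_succ_iff.1 j.2) x
    · rw [dist_eq_norm, CmTorus.norm_le_iff _ dist_nonneg]
      intro j hj x
      obtain ⟨y, hy, a, rfl, ha⟩ := exists_int_sub_mem_ball x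
      have : iteratedFDeriv ℝ j (f - g).pull (y + a) = iteratedFDeriv ℝ j (f - g).pull y := by
        rw [← iteratedFDeriv_comp_add_right j a y]
        congr 1
        funext z
        simp [CmTorus.pull, ha]
      rw [this, key ⟨j, Nat.lt_succ_of_le hj⟩ y, ← dist_eq_norm]
      refine le_trans ?_ (dist_le_pi_dist (r f) (r g) ⟨j, Nat.lt_succ_of_le hj⟩)
      exact ContinuousMap.dist_apply_le_dist (f := r f ⟨j, Nat.lt_succ_of_le hj⟩)
        (g := r g ⟨j, Nat.lt_succ_of_le hj⟩) (⟨y, hy⟩ : B)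
  exact (Isometry.of_dist_eq hr).isEmbedding.secondCountableTopology

end CmSpace

/-! ### The path space -/

section Paths

variable {m : ℕ}

instance : PolishSpace (PathSpace m) := by
  change PolishSpace C(ℝ, CmTorus m)
  infer_instance

instance : SecondCountableTopology (PathSpace m) := by
  change SecondCountableTopology C(ℝ, CmTorus m)
  infer_instance

theorem continuous_at_uncurry : Continuous fun p : PathSpace m × ℝ => p.1.at p.2 :=
  (continuous_eval : Continuous fun p : C(ℝ, CmTorus m) × ℝ => p.1 p.2)

theorem continuous_at_left (t : ℝ) : Continuous fun ψ : PathSpace m => ψ.at t :=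
  continuous_at_uncurry.comp (Continuous.prodMk_left t)

theorem continuous_at_right (ψ : PathSpace m) : Continuous fun t => ψ.at t :=
  (ψ : C(ℝ, CmTorus m)).continuous

@[simp] theorem shift_at (t s : ℝ) (ψ : PathSpace m) : (shift t ψ).at s = ψ.at (t + s) := rfl

theorem PathSpace.ext {ψ ψ' : PathSpace m} (h : ∀ t, ψ.at t = ψ'.at t) : ψ = ψ' :=
  ContinuousMap.ext (f := (ψ : C(ℝ, CmTorus m))) (g := ψ') h

theorem continuous_shift : Continuous fun p : PathSpace m × ℝ => shift p.2 p.1 := by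
  have : Continuous (Function.uncurry fun (p : PathSpace m × ℝ) (s : ℝ) => p.1.at (p.2 + s)) :=
    continuous_at_uncurry.comp (g := fun p : PathSpace m × ℝ => p.1.at p.2)
      (f := fun q : (PathSpace m × ℝ) × ℝ => (q.1.1, q.1.2 + q.2)) (by fun_prop)
  exact ContinuousMap.continuous_of_continuous_uncurry
    (fun p : PathSpace m × ℝ => (shift p.2 p.1 : C(ℝ, CmTorus m))) this

theorem measurable_shift : Measurable fun p : PathSpace m × ℝ => shift p.2 p.1 :=
  continuous_shift.measurable

theorem measurable_shift_right (t : ℝ) : Measurable (shift t : PathSpace m → PathSpace m) :=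
  measurable_shift.comp (measurable_id.prodMk measurable_const)

theorem shift_zero : (shift 0 : PathSpace m → PathSpace m) = id := by
  funext ψ; exact PathSpace.ext fun s => by simp

theorem shift_add (s t : ℝ) : (shift (t + s) : PathSpace m → PathSpace m) = shift t ∘ shift s := by
  funext ψ; refine PathSpace.ext fun r => ?_
  simp only [Function.comp_apply, shift_at]; congr 1; ring

end Paths

/-! ### Fourier coefficients -/

section Fourier

variable {m : ℕ}

/-- The Hilbert basis of exponentials in `L²(𝕋²)`. -/
def expBasis : HilbertBasis (Fin 2 → ℤ) ℂ L2Torus := UnitAddTorus.mFourierBasis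

theorem expBasis_apply (n : Fin 2 → ℤ) :
    expBasis n = ContinuousMap.toLp 2 torusMeasure ℂ (UnitAddTorus.mFourier n) :=
  congrFun (UnitAddTorus.coe_mFourierBasis (d := Fin 2)) n

theorem expMode_eq (n : Mode) : expMode n = expBasis n.1 := (expBasis_apply _).symm

instance : torusMeasure.IsOpenPosMeasure := by unfold torusMeasure; infer_instance

/-- The inclusion of `C^m(𝕋²)` into `L²(𝕋²)`. -/
def toL2L (m : ℕ) : CmTorus m →L[ℝ] L2Torus :=
  ((ContinuousMap.toLp 2 torusMeasure ℂ : C(Torus, ℂ) →L[ℂ] L2Torus).restrictScalars ℝ).comp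
    ((Complex.ofRealCLM.compLeftContinuous ℝ Torus).comp (toContL m))

/-- The Fourier coefficients of a function of class `C^m`. -/
def coeff (n : Fin 2 → ℤ) : CmTorus m →L[ℝ] ℂ :=
  ((innerSL ℂ (expBasis n)).restrictScalars ℝ).comp (toL2L m)

theorem coeff_apply (n : Fin 2 → ℤ) (f : CmTorus m) :
    coeff n f = inner ℂ (expBasis n) f.toL2 := rfl

theorem hasSum_coeff (f : CmTorus m) : HasSum (fun n => coeff n f • expBasis n) f.toL2 := by
  simpa only [coeff_apply, HilbertBasis.repr_apply_apply] using expBasis.hasSum_repr f.toL2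

/-- Haar measure charges every nonempty open set, so continuous functions that agree almost
everywhere agree. -/
theorem CmTorus.toL2_injective : Function.Injective (CmTorus.toL2 (m := m)) := by
  intro f g h
  have h1 := ContinuousMap.toLp_injective (E := ℂ) (p := 2) (𝕜 := ℂ) torusMeasure h
  apply CmTorus.toCont_injective
  ext z
  have := congrArg (fun F : C(Torus, ℂ) => F z) h1
  exact Complex.ofReal_injective this

theorem CmTorus.ext_coeff {f g : CmTorus m} (h : ∀ n, coeff n f = coeff n g) : f = g := by
  apply CmTorus.toL2_injective
  rw [← (hasSum_coeff f).tsum_eq, ← (hasSum_coeff g).tsum_eq]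
  simp only [h]

theorem coeff_zero_eq (f : CmTorus m) :
    coeff 0 f = ((∫ x, f.toCont x ∂torusMeasure : ℝ) : ℂ) := by
  rw [coeff_apply, expBasis_apply, CmTorus.toL2, ContinuousMap.inner_toLp]
  refine Eq.trans ?_ integral_ofReal
  simp [UnitAddTorus.mFourier_zero]

/-- All Fourier coefficients at rational times. -/
def ratCoeffs (ψ : PathSpace m) (p : ℚ × (Fin 2 → ℤ)) : ℂ := coeff p.2 (ψ.at (p.1 : ℝ))

theorem continuous_ratCoeffs : Continuous (ratCoeffs (m := m)) :=
  continuous_pi fun p => (coeff p.2).continuous.comp (continuous_at_left _)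

theorem ratCoeffs_injective : Function.Injective (ratCoeffs (m := m)) := by
  intro ψ ψ' h
  have h1 : (fun t => ψ.at t) = fun t => ψ'.at t := by
    refine Rat.denseRange_cast.equalizer (continuous_at_right ψ) (continuous_at_right ψ') ?_
    funext q
    exact CmTorus.ext_coeff fun n => congrFun h (q, n)
  exact PathSpace.ext fun t => congrFun h1 t

/-- By the Lusin-Souslin theorem an injective continuous map from a Polish space to a second
countable Hausdorff space is a Borel isomorphism onto its image. Hence the Borel σ-algebra of the
path space is generated by countably many complex coordinates, and laws of paths may be compared in
a countable product of copies of `ℂ`. -/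
theorem measurableEmbedding_ratCoeffs : MeasurableEmbedding (ratCoeffs (m := m)) :=
  continuous_ratCoeffs.measurableEmbedding ratCoeffs_injective

theorem measurable_path_iff {W : Type*} [MeasurableSpace W] {Ψ : W → PathSpace m} :
    Measurable Ψ ↔ ∀ (q : ℚ) (n : Fin 2 → ℤ), Measurable fun ω => coeff n ((Ψ ω).at q) := by
  rw [← measurableEmbedding_ratCoeffs.measurable_comp_iff, measurable_pi_iff]
  exact ⟨fun h q n => h (q, n), fun h p => h p.1 p.2⟩

theorem measurable_coeff_at (t : ℝ) (n : Fin 2 → ℤ) :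
    Measurable fun ψ : PathSpace m => coeff n (ψ.at t) :=
  ((coeff n).continuous.comp (continuous_at_left t)).measurable

/-- The real functionals `ψ ↦ ∑ᵢ Re (cᵢ ψ̂(tᵢ, nᵢ))`. -/
def modeFun (I : Finset (ℝ × (Fin 2 → ℤ))) (c : ℝ × (Fin 2 → ℤ) → ℂ) (ψ : PathSpace m) : ℝ :=
  ∑ p ∈ I, (c p * coeff p.2 (ψ.at p.1)).re

theorem measurable_modeFun (I : Finset (ℝ × (Fin 2 → ℤ))) (c : ℝ × (Fin 2 → ℤ) → ℂ) :
    Measurable (modeFun (m := m) I c) := by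
  refine Finset.measurable_sum _ fun p _ => ?_
  exact Complex.measurable_re.comp ((measurable_coeff_at p.1 p.2).const_mul _)

/-- A measure on a product is determined by its finite-dimensional projections, and these by their
characteristic functions. The point is that every real linear functional on `ℂ^I` has the form `x ↦
∑ Re (cᵢ xᵢ)`. -/
theorem pi_measure_ext {ι : Type*} {P Q : Measure (ι → ℂ)} [IsFiniteMeasure P] [IsFiniteMeasure Q]
    (h : ∀ (I : Finset ι) (c : ι → ℂ),
      ∫ x, Complex.exp (((∑ i ∈ I, (c i * x i).re : ℝ) : ℂ) * Complex.I) ∂P =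
      ∫ x, Complex.exp (((∑ i ∈ I, (c i * x i).re : ℝ) : ℂ) * Complex.I) ∂Q) : P = Q := by
  refine IsProjectiveLimit.unique (P := fun I => P.map I.restrict) (fun I => rfl) (fun I => ?_)
  symm
  refine Measure.ext_of_charFunDual ?_
  funext L
  classical
  rw [charFunDual_apply, charFunDual_apply,
    integral_map (Finset.measurable_restrict I).aemeasurable (by fun_prop),
    integral_map (Finset.measurable_restrict I).aemeasurable (by fun_prop)]
  -- With `p = L(eᵢ)` and `q = L(i eᵢ)` one has `Re ((p - iq) x) = p Re x + q Im x`.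
  let c : ι → ℂ := fun i => if hi : i ∈ I then
    ((L (Pi.single ⟨i, hi⟩ 1) : ℝ) : ℂ) - (L (Pi.single ⟨i, hi⟩ Complex.I) : ℝ) * Complex.I else 0
  have hL : ∀ x : ι → ℂ, L (I.restrict x) = ∑ i ∈ I, (c i * x i).re := by
    intro x
    have h1 : I.restrict x = ∑ i : I, ((x i).re • (Pi.single i 1 : I → ℂ)
        + (x i).im • (Pi.single i Complex.I : I → ℂ)) := by
      funext j
      simp only [Finset.restrict, Finset.sum_apply, Pi.add_apply, Pi.smul_apply]
      rw [Finset.sum_eq_single j]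
      · simp [Complex.re_add_im]
      · intro b _ hb
        simp [Pi.single_eq_of_ne hb.symm]
      · simp
    rw [h1, map_sum, ← Finset.sum_coe_sort I]
    refine Finset.sum_congr rfl fun i _ => ?_
    simp [c, mul_comm]
  simp only [hL]
  exact h I c

/-- A law on the path space is determined by the characteristic functions of the Fourier
coefficients at finitely many times. -/
theorem path_measure_ext {P Q : Measure (PathSpace m)} [IsFiniteMeasure P] [IsFiniteMeasure Q]
    (h : ∀ I c, ∫ ψ, Complex.exp ((modeFun I c ψ : ℂ) * Complex.I) ∂P =
      ∫ ψ, Complex.exp ((modeFun I c ψ : ℂ) * Complex.I) ∂Q) : P = Q := by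
  have hm := measurableEmbedding_ratCoeffs (m := m)
  suffices hs : P.map ratCoeffs = Q.map ratCoeffs by
    rw [← hm.comap_map P, ← hm.comap_map Q, hs]
  have := Measure.isFiniteMeasure_map P (ratCoeffs (m := m))
  have := Measure.isFiniteMeasure_map Q (ratCoeffs (m := m))
  refine pi_measure_ext fun I c => ?_
  rw [hm.integral_map, hm.integral_map]
  classical
  let e : ℚ × (Fin 2 → ℤ) ↪ ℝ × (Fin 2 → ℤ) :=
    ⟨fun p => ((p.1 : ℝ), p.2), fun p q hpq => by
      simp only [Prod.mk.injEq, Rat.cast_inj] at hpq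
      exact Prod.ext hpq.1 hpq.2⟩
  have := h (I.map e) (Function.extend e c 0)
  simpa only [modeFun, Finset.sum_map, e.injective.extend_apply] using! this

end Fourier

/-! ### Families of `C^k` maps with jointly continuous derivatives -/

section JointCk

variable {A A' E F G : Type} [TopologicalSpace A] [TopologicalSpace A']
  [NormedAddCommGroup E] [NormedSpace ℝ E] [NormedAddCommGroup F] [NormedSpace ℝ F]
  [NormedAddCommGroup G] [NormedSpace ℝ G]

/-- Every `f a` is of class `C^k`, and its derivatives up to order `k` are jointly continuous. -/
def JointCk (k : ℕ) (f : A → E → F) : Prop :=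
  (∀ a, ContDiff ℝ k (f a)) ∧
  ∀ j ≤ k, Continuous (fun q : A × E => iteratedFDeriv ℝ j (f q.1) q.2)

theorem JointCk.continuous {k : ℕ} {f : A → E → F} (hf : JointCk k f) :
    Continuous fun q : A × E => f q.1 q.2 := by
  have h := hf.2 0 (Nat.zero_le _)
  have h1 := (continuousMultilinearCurryFin0 ℝ E F).continuous.comp h
  simpa [Function.comp_def] using! h1

theorem JointCk.of_le {k l : ℕ} {f : A → E → F} (hf : JointCk k f) (h : l ≤ k) : JointCk l f :=
  ⟨fun a => (hf.1 a).of_le (by exact_mod_cast h), fun j hj => hf.2 j (hj.trans h)⟩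

theorem JointCk.comp_param {k : ℕ} {f : A → E → F} (hf : JointCk k f) {g : A' → A}
    (hg : Continuous g) : JointCk k fun a => f (g a) :=
  ⟨fun a => hf.1 _, fun j hj => (hf.2 j hj).comp
    (f := fun q : A' × E => (g q.1, q.2)) (by fun_prop)⟩

theorem JointCk.clm_comp {k : ℕ} {f : A → E → F} (hf : JointCk k f) (L : F →L[ℝ] G) :
    JointCk k fun a x => L (f a x) := by
  refine ⟨fun a => L.contDiff.comp (hf.1 a), fun j hj => ?_⟩
  have : (fun q : A × E => iteratedFDeriv ℝ j (fun x => L (f q.1 x)) q.2) =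
      fun q => (ContinuousLinearMap.compContinuousMultilinearMapL ℝ (fun _ : Fin j => E) F G L)
        (iteratedFDeriv ℝ j (f q.1) q.2) := by
    funext q
    exact L.iteratedFDeriv_comp_left (hf.1 q.1).contDiffAt (by exact_mod_cast hj)
  rw [this]
  exact (ContinuousLinearMap.continuous _).comp (hf.2 j hj)

theorem JointCk.comp_clm {k : ℕ} {f : A → E → F} (hf : JointCk k f) (L : G →L[ℝ] E) :
    JointCk k fun a x => f a (L x) := by
  refine ⟨fun a => (hf.1 a).comp L.contDiff, fun j hj => ?_⟩
  have : (fun q : A × G => iteratedFDeriv ℝ j (fun x => f q.1 (L x)) q.2) =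
      fun q => (ContinuousMultilinearMap.compContinuousLinearMapL (fun _ : Fin j => L))
        (iteratedFDeriv ℝ j (f q.1) (L q.2)) := by
    funext q
    exact L.iteratedFDeriv_comp_right (hf.1 q.1) _ (by exact_mod_cast hj)
  rw [this]
  exact (ContinuousLinearMap.continuous _).comp ((hf.2 j hj).comp
    (f := fun q : A × G => (q.1, L q.2)) (by fun_prop))

theorem JointCk.add {k : ℕ} {f g : A → E → F} (hf : JointCk k f) (hg : JointCk k g) :
    JointCk k fun a x => f a x + g a x := by
  refine ⟨fun a => (hf.1 a).add (hg.1 a), fun j hj => ?_⟩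
  have : (fun q : A × E => iteratedFDeriv ℝ j (fun x => f q.1 x + g q.1 x) q.2) =
      fun q => iteratedFDeriv ℝ j (f q.1) q.2 + iteratedFDeriv ℝ j (g q.1) q.2 := by
    funext q
    have hj' : ((j : ℕ) : WithTop ℕ∞) ≤ k := by exact_mod_cast hj
    exact iteratedFDeriv_add_apply ((hf.1 q.1).of_le hj').contDiffAt
      ((hg.1 q.1).of_le hj').contDiffAt
  rw [this]
  exact (hf.2 j hj).add (hg.2 j hj)

theorem JointCk.of_contDiff {k : ℕ} {f : E → F} (hf : ContDiff ℝ k f) :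
    JointCk k fun (_ : A) => f :=
  ⟨fun _ => hf, fun j hj => (hf.continuous_iteratedFDeriv (by exact_mod_cast hj)).comp
    continuous_snd⟩

theorem JointCk.fderiv {k : ℕ} {f : A → E → F} (hf : JointCk (k + 1) f) :
    JointCk k fun a => fderiv ℝ (f a) := by
  refine ⟨fun a => (hf.1 a).fderiv_right (by norm_cast), fun j hj => ?_⟩
  have : (fun q : A × E => iteratedFDeriv ℝ j (_root_.fderiv ℝ (f q.1)) q.2) =
      fun q => continuousMultilinearCurryRightEquiv' ℝ j E F
        (iteratedFDeriv ℝ (j + 1) (f q.1) q.2) := by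
    funext q
    rw [iteratedFDeriv_succ_eq_comp_right]
    simp
  rw [this]
  exact (LinearIsometryEquiv.continuous _).comp (hf.2 (j + 1) (by omega))

end JointCk

/-! ### Superposition operators -/

section Nemytskii

variable {A E F : Type} [TopologicalSpace A] [CompactSpace A] [LocallyCompactSpace A]
  [NormedAddCommGroup E] [NormedSpace ℝ E] [NormedAddCommGroup F] [NormedSpace ℝ F]

/-- The superposition operator `X ↦ (a ↦ f a (X a))`. -/
def superpos (f : A → E → F) (hf : Continuous fun q : A × E => f q.1 q.2) (X : C(A, E)) : C(A, F) :=
  ⟨fun a => f a (X a), hf.comp (f := fun a => (a, X a)) (by fun_prop)⟩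

@[simp] theorem superpos_apply (f : A → E → F) (hf : Continuous fun q : A × E => f q.1 q.2)
    (X : C(A, E)) (a : A) : superpos f hf X a = f a (X a) := rfl

theorem continuous_superpos (f : A → E → F) (hf : Continuous fun q : A × E => f q.1 q.2) :
    Continuous (superpos f hf) := by
  refine ContinuousMap.continuous_of_continuous_uncurry _ ?_
  exact hf.comp (f := fun p : C(A, E) × A => (p.2, p.1 p.2)) (by fun_prop)

/-- Pointwise application of a continuous family of operators. -/
def pointwiseApply (A E F : Type) [TopologicalSpace A] [CompactSpace A]
    [NormedAddCommGroup E] [NormedSpace ℝ E] [NormedAddCommGroup F] [NormedSpace ℝ F] :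
    C(A, E →L[ℝ] F) →L[ℝ] C(A, E) →L[ℝ] C(A, F) :=
  LinearMap.mkContinuous₂
    (LinearMap.mk₂ ℝ (fun (L : C(A, E →L[ℝ] F)) (h : C(A, E)) =>
      (⟨fun a => L a (h a), by fun_prop⟩ : C(A, F)))
      (fun _ _ _ => by ext; simp) (fun _ _ _ => by ext; simp) (fun _ _ _ => by ext; simp)
      (fun _ _ _ => by ext; simp)) 1
    (fun L h => by
      rw [ContinuousMap.norm_le _ (by positivity)]
      intro a
      rw [one_mul]
      exact (L a).le_of_opNorm_le_of_le (L.norm_coe_le_norm a) (h.norm_coe_le_norm a))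

theorem contDiff_pointwiseApply {n : WithTop ℕ∞} : ContDiff ℝ n (pointwiseApply A E F) :=
  IsBoundedLinearMap.contDiff (ContinuousLinearMap.isBoundedLinearMap _)

/-- The superposition operator of the space derivative is continuous at `X` in the sup norm, so the
derivatives of all `f a` vary by at most `ε` on a tube of uniform radius around the graph of `X`.
The mean value inequality at each `a` then gives a remainder that is uniformly `o(‖h‖)`. -/
theorem hasFDerivAt_superpos (f : A → E → F) (hf : JointCk 1 f) (X : C(A, E)) :
    HasFDerivAt (superpos f hf.continuous)
      (pointwiseApply A E F (superpos (fun a => fderiv ℝ (f a)) hf.fderiv.continuous X)) X := by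
  rw [hasFDerivAt_iff_isLittleO_nhds_zero, Asymptotics.isLittleO_iff]
  intro ε hε
  have hc := (continuous_superpos (fun a => fderiv ℝ (f a)) hf.fderiv.continuous).continuousAt (x := X)
  obtain ⟨δ, hδ, H⟩ := Metric.continuousAt_iff.1 hc ε hε
  filter_upwards [Metric.ball_mem_nhds (0 : C(A, E)) hδ] with h hh
  rw [mem_ball_zero_iff] at hh
  rw [ContinuousMap.norm_le _ (by positivity)]
  intro a
  have key : ∀ y ∈ Metric.ball (X a) δ, ‖fderiv ℝ (f a) y - fderiv ℝ (f a) (X a)‖ ≤ ε := by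
    intro y hy
    -- A constant perturbation of `X` passes through `y` at the parameter `a` and stays `δ`-close
    -- everywhere.
    have h1 : dist (X + ContinuousMap.const A (y - X a)) X < δ := by
      rw [dist_eq_norm, add_sub_cancel_left]
      refine lt_of_le_of_lt ((ContinuousMap.norm_le _ (norm_nonneg _)).2 fun b => le_rfl) ?_
      exact (dist_eq_norm y (X a)).symm.trans_lt hy
    have h2 := (ContinuousMap.dist_apply_le_dist (x := a)).trans_lt (H h1)
    simp only [superpos_apply, ContinuousMap.add_apply, ContinuousMap.const_apply,
      add_sub_cancel] at h2
    rw [← dist_eq_norm]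
    exact h2.le
  have hxa : X a + h a ∈ Metric.ball (X a) δ := by
    rw [Metric.mem_ball, dist_eq_norm, add_sub_cancel_left]
    exact (h.norm_coe_le_norm a).trans_lt hh
  have := (convex_ball (X a) δ).norm_image_sub_le_of_norm_fderiv_le' (𝕜 := ℝ)
    (fun x _ => (hf.1 a).differentiable (by simp) x) key (Metric.mem_ball_self hδ) hxa
  rw [add_sub_cancel_left] at this
  refine this.trans ?_
  gcongr
  exact h.norm_coe_le_norm a

/-- Induction on `k`: the derivative is the superposition operator of `∂f` followed by a continuous
linear map. The target space has to vary in the induction because `∂f` takes values in `E →L[ℝ] F`.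
-/
theorem contDiff_superpos (k : ℕ) : ∀ {F : Type} [NormedAddCommGroup F] [NormedSpace ℝ F]
    (f : A → E → F) (hf : JointCk k f), ContDiff ℝ k (superpos f hf.continuous) := by
  induction k with
  | zero =>
    intro F _ _ f hf
    exact contDiff_zero.2 (continuous_superpos f _)
  | succ k ih =>
    intro F _ _ f hf
    rw [Nat.cast_add, Nat.cast_one, contDiff_succ_iff_hasFDerivAt]
    exact ⟨fun X => pointwiseApply A E F (superpos (fun a => fderiv ℝ (f a)) hf.fderiv.continuous X),
      contDiff_pointwiseApply.comp (ih (fun a => fderiv ℝ (f a)) hf.fderiv),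
      fun X => hasFDerivAt_superpos f (hf.of_le (by omega)) X⟩

end Nemytskii

/-! ### Integral equations -/

section Volterra

open Set

variable {E : Type} [NormedAddCommGroup E] [NormedSpace ℝ E]

/-- The time interval `[-T, T]`. -/
abbrev TimeIv (T : ℕ) : Type := Icc (-(T : ℝ)) (T : ℝ)

theorem neg_natCast_le (T : ℕ) : -(T : ℝ) ≤ (T : ℝ) := by
  have : (0 : ℝ) ≤ T := T.cast_nonneg
  linarith

/-- The nearest point retraction of the line onto `[-T, T]`. -/
def clampIv (T : ℕ) : ℝ → TimeIv T := projIcc _ _ (neg_natCast_le T)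

theorem continuous_clampIv (T : ℕ) : Continuous (clampIv T) := continuous_projIcc

theorem clampIv_of_mem {T : ℕ} {t : ℝ} (h : |t| ≤ T) : clampIv T t = ⟨t, abs_le.1 h⟩ :=
  projIcc_of_mem _ _

theorem TimeIv.abs_le {T : ℕ} (t : TimeIv T) : |(t : ℝ)| ≤ T := _root_.abs_le.2 t.2

theorem abs_le_of_mem_uIoc_zero {t u : ℝ} (h : u ∈ uIoc 0 t) : |u| ≤ |t| := by
  rcases le_total 0 t with ht | ht
  · rw [uIoc_of_le ht] at h
    rw [abs_of_pos h.1, abs_of_nonneg ht]; exact h.2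
  · rw [uIoc_of_ge ht] at h
    rw [abs_of_nonpos h.2, abs_of_nonpos ht]; linarith [h.1]

/-- The primitive `t ↦ ∫₀ᵗ g`. -/
def primIv (T : ℕ) (E : Type) [NormedAddCommGroup E] [NormedSpace ℝ E] :
    C(TimeIv T, E) →L[ℝ] C(TimeIv T, E) :=
  LinearMap.mkContinuous
    { toFun := fun g => ⟨fun t => ∫ u in (0 : ℝ)..t, g (clampIv T u),
        (intervalIntegral.continuous_primitive (fun a b =>
          (g.continuous.comp (continuous_clampIv T)).intervalIntegrable a b) 0).comp
          continuous_subtype_val⟩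
      map_add' := fun g h => by
        ext t
        exact intervalIntegral.integral_add
          ((g.continuous.comp (continuous_clampIv T)).intervalIntegrable _ _)
          ((h.continuous.comp (continuous_clampIv T)).intervalIntegrable _ _)
      map_smul' := fun c g => by
        ext t
        exact intervalIntegral.integral_smul _ _ } T
    (fun g => by
      rw [ContinuousMap.norm_le _ (by positivity)]
      intro t
      refine (intervalIntegral.norm_integral_le_of_norm_le_const (C := ‖g‖)
        fun u _ => g.norm_coe_le_norm _).trans ?_
      rw [mul_comm, sub_zero]
      gcongr
      exact t.abs_le)

theorem primIv_apply {T : ℕ} (g : C(TimeIv T, E)) (t : TimeIv T) :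
    primIv T E g t = ∫ u in (0 : ℝ)..t, g (clampIv T u) := rfl

variable {T : ℕ} {f : TimeIv T → E → E} (hf : Continuous fun q : TimeIv T × E => f q.1 q.2)

/-- The Picard operator `X ↦ y + ∫₀ f(u, X(u)) du`. -/
def picardIv (y X : C(TimeIv T, E)) : C(TimeIv T, E) := y + primIv T E (superpos f hf X)

/-- Integrating `|u|^n / n!` produces the factorial. It makes some iterate a contraction for every
`T`, with no smallness of the time interval. -/
theorem norm_iterate_picardIv_le {K : ℝ} (hK : 0 ≤ K)
    (hL : ∀ t x x', ‖f t x - f t x'‖ ≤ K * ‖x - x'‖) (y X Y : C(TimeIv T, E)) (n : ℕ) :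
    ∀ t : TimeIv T, ‖(picardIv hf y)^[n] X t - (picardIv hf y)^[n] Y t‖ ≤
      (K * |(t : ℝ)|) ^ n / n.factorial * ‖X - Y‖ := by
  induction n with
  | zero =>
    intro t
    simpa using! (X - Y).norm_coe_le_norm t
  | succ n ih =>
    intro t
    rw [Function.iterate_succ_apply', Function.iterate_succ_apply']
    set X' := (picardIv hf y)^[n] X
    set Y' := (picardIv hf y)^[n] Y
    have h1 : picardIv hf y X' t - picardIv hf y Y' t =
        ∫ u in (0 : ℝ)..t, (f (clampIv T u) (X' (clampIv T u)) - f (clampIv T u) (Y' (clampIv T u))) := by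
      simp only [picardIv, ContinuousMap.add_apply, add_sub_add_left_eq_sub, primIv_apply]
      rw [← intervalIntegral.integral_sub]
      · rfl
      · exact ((superpos f hf X').continuous.comp (continuous_clampIv T)).intervalIntegrable _ _
      · exact ((superpos f hf Y').continuous.comp (continuous_clampIv T)).intervalIntegrable _ _
    rw [h1, intervalIntegral.norm_intervalIntegral_eq]
    calc _ ≤ ∫ u in uIoc 0 (t : ℝ), K ^ (n + 1) / n.factorial * ‖X - Y‖ * |u - 0| ^ n := by
          refine norm_integral_le_of_norm_le (Continuous.integrableOn_uIoc (by fun_prop)) ?_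
          refine (ae_restrict_mem measurableSet_uIoc).mono fun u hu => ?_
          refine (hL _ _ _).trans ?_
          have hu' : |u| ≤ T := (abs_le_of_mem_uIoc_zero hu).trans t.abs_le
          have := ih (clampIv T u)
          rw [clampIv_of_mem hu'] at this ⊢
          refine (mul_le_mul_of_nonneg_left this hK).trans (le_of_eq ?_)
          simp only [sub_zero]
          rw [mul_pow, pow_succ]
          ring
      _ = _ := by
          rw [integral_const_mul, integral_pow_abs_sub_uIoc, sub_zero, mul_pow, Nat.factorial_succ]
          push_cast
          field_simp

/-- Since `(KT)^n / n!` tends to zero, an iterate of the Picard operator is a contraction of the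
whole space; its fixed point is fixed by the operator itself, and every fixed point of the operator
is one of the iterate. -/
theorem existsUnique_picardIv [CompleteSpace E] {K : ℝ} (hK : 0 ≤ K)
    (hL : ∀ t x x', ‖f t x - f t x'‖ ≤ K * ‖x - x'‖) (y : C(TimeIv T, E)) :
    ∃! X, X = picardIv hf y X := by
  obtain ⟨n, hn⟩ := (FloorSemiring.tendsto_pow_div_factorial_atTop (K * T)).eventually
    (gt_mem_nhds zero_lt_one) |>.exists
  have h0 : (0 : ℝ) ≤ (K * T) ^ n / n.factorial := by positivity
  have hc : ContractingWith ⟨_, h0⟩ (picardIv hf y)^[n] := by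
    refine ⟨hn, LipschitzWith.of_dist_le_mul fun X Y => ?_⟩
    rw [ContinuousMap.dist_le (by positivity)]
    intro t
    rw [dist_eq_norm, dist_eq_norm]
    refine (norm_iterate_picardIv_le hf hK hL y X Y n t).trans ?_
    show (K * |(t : ℝ)|) ^ n / n.factorial * ‖X - Y‖ ≤ (K * T) ^ n / n.factorial * ‖X - Y‖
    gcongr
    exact t.abs_le
  refine ⟨_, (hc.isFixedPt_fixedPoint_iterate).symm, fun X hX => ?_⟩
  exact hc.fixedPoint_unique (Function.IsFixedPt.iterate (f := picardIv hf y) hX.symm n)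

/-- The inverse of the Picard operator, `X ↦ X - ∫₀ f(u, X(u)) du`. -/
def defectIv (X : C(TimeIv T, E)) : C(TimeIv T, E) := X - primIv T E (superpos f hf X)

theorem defectIv_eq_iff {X y : C(TimeIv T, E)} : defectIv hf X = y ↔ X = picardIv hf y X := by
  unfold defectIv picardIv
  exact sub_eq_iff_eq_add

theorem defectIv_bijective [CompleteSpace E] {K : ℝ} (hK : 0 ≤ K)
    (hL : ∀ t x x', ‖f t x - f t x'‖ ≤ K * ‖x - x'‖) : Function.Bijective (defectIv hf) := by
  rw [Function.bijective_iff_existsUnique]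
  intro y
  simpa only [defectIv_eq_iff] using existsUnique_picardIv hf hK hL y

end Volterra

/-! ### Smooth dependence of solutions on the inhomogeneity -/

section SmoothSolution

open Set

variable {E : Type} [NormedAddCommGroup E] [NormedSpace ℝ E] [CompleteSpace E]
  {T : ℕ} {f : TimeIv T → E → E}

/-- The linearized map is again of the form `h ↦ h - ∫₀ a(u) h(u) du`, for the linear field `a(t) =
∂f(t, X(t))`, which is Lipschitz with constant `‖a‖`. It is therefore bijective by the same fixed
point argument, and its inverse is continuous by the open mapping theorem. -/
theorem hasFDerivAt_defectIv (hf : JointCk 1 f) (X : C(TimeIv T, E)) :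
    ∃ L : C(TimeIv T, E) ≃L[ℝ] C(TimeIv T, E),
      HasFDerivAt (defectIv hf.continuous) (L : C(TimeIv T, E) →L[ℝ] C(TimeIv T, E)) X := by
  let a : C(TimeIv T, E →L[ℝ] E) := superpos (fun a => fderiv ℝ (f a)) hf.fderiv.continuous X
  let D : C(TimeIv T, E) →L[ℝ] C(TimeIv T, E) :=
    ContinuousLinearMap.id ℝ _ - (primIv T E).comp (pointwiseApply (TimeIv T) E E a)
  have hD : HasFDerivAt (defectIv hf.continuous) D X :=
    (hasFDerivAt_id X).sub ((primIv T E).hasFDerivAt.comp X (hasFDerivAt_superpos f hf X))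
  have hc : Continuous fun q : TimeIv T × E => a q.1 q.2 := by fun_prop
  have hb : Function.Bijective D :=
    defectIv_bijective hc (norm_nonneg a) fun t x x' => by
      rw [← map_sub]
      exact (a t).le_of_opNorm_le (a.norm_coe_le_norm t) _
  refine ⟨ContinuousLinearEquiv.ofBijective D (LinearMap.ker_eq_bot.2 hb.1)
    (LinearMap.range_eq_top.2 hb.2), ?_⟩
  convert hD
  exact ContinuousLinearMap.ext fun _ => rfl

/-- The solution of an integral equation with a Lipschitz nonlinearity of class `C^k` depends on
the inhomogeneity in a `C^k` way. -/
theorem exists_contDiff_solution {k : ℕ} (hk : 1 ≤ k) (hf : JointCk k f) {K : ℝ} (hK : 0 ≤ K)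
    (hL : ∀ t x x', ‖f t x - f t x'‖ ≤ K * ‖x - x'‖) :
    ∃ S : C(TimeIv T, E) → C(TimeIv T, E), ContDiff ℝ k S ∧
      ∀ y X, X = picardIv hf.continuous y X ↔ X = S y := by
  have hb := defectIv_bijective hf.continuous hK hL
  have hcd : ContDiff ℝ k (defectIv hf.continuous) :=
    contDiff_id.sub ((primIv T E).contDiff.comp (contDiff_superpos k f hf))
  have h1 : (1 : WithTop ℕ∞) ≤ k := by exact_mod_cast hk
  choose L hL' using hasFDerivAt_defectIv (hf.of_le hk)
  -- The inverse function theorem at every point makes the map open. Being bijective as well, it is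
  -- a homeomorphism, and its global inverse is as smooth as the map.
  have hopen : IsOpenMap (defectIv hf.continuous) := by
    rw [isOpenMap_iff_nhds_le]
    intro X
    exact ((hcd.contDiffAt.hasStrictFDerivAt' (hL' X) (by positivity)).map_nhds_eq_of_equiv).ge
  let e : C(TimeIv T, E) ≃ₜ C(TimeIv T, E) :=
    (Equiv.ofBijective _ hb).toHomeomorphOfContinuousOpen hcd.continuous hopen
  refine ⟨e.symm, e.contDiff_symm hL' hcd, fun y X => ?_⟩
  rw [← defectIv_eq_iff]
  exact (e.toEquiv.eq_symm_apply).symm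

end SmoothSolution

/-! ### Smooth global flows -/

section EvalJets

variable {E F : Type} [NormedAddCommGroup E] [NormedSpace ℝ E] [FiniteDimensional ℝ E]
  [NormedAddCommGroup F] [NormedSpace ℝ F] [FiniteDimensional ℝ F] {T : ℕ}

/-- In finite dimensions a multilinear map depends linearly, hence continuously, on its values at
tuples of basis vectors, and for those values continuity in `t` is clear. -/
theorem continuous_evalCLM_compContinuousMultilinearMap {j : ℕ}
    (M : E [×j]→L[ℝ] C(TimeIv T, F)) :
    Continuous fun t => (ContinuousMap.evalCLM ℝ t).compContinuousMultilinearMap M := by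
  let b := Module.finBasis ℝ E
  let ev : (E [×j]→L[ℝ] F) →ₗ[ℝ] ((Fin j → Fin (Module.finrank ℝ E)) → F) :=
    { toFun := fun N σ => N fun i => b (σ i)
      map_add' := fun _ _ => rfl
      map_smul' := fun _ _ => rfl }
  have hinj : Function.Injective ev := by
    intro N N' h
    apply ContinuousMultilinearMap.toMultilinearMap_injective
    exact Module.Basis.ext_multilinear (fun _ => b) fun σ => congrFun h σ
  obtain ⟨g, hg⟩ := ev.exists_leftInverse_of_injective (LinearMap.ker_eq_bot.2 hinj)
  have hcont : Continuous g := g.continuous_of_finiteDimensional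
  have : (fun t : TimeIv T => (ContinuousMap.evalCLM ℝ t).compContinuousMultilinearMap M) =
      fun t => g fun σ => M (fun i => b (σ i)) t := by
    funext t
    exact (LinearMap.congr_fun hg _).symm
  rw [this]
  exact hcont.comp (continuous_pi fun σ => (M _).continuous)

/-- A multilinear map with values in a space of paths, as a path of multilinear maps. -/
def multilinearPathₗ (T j : ℕ) (E F : Type) [NormedAddCommGroup E] [NormedSpace ℝ E]
    [FiniteDimensional ℝ E] [NormedAddCommGroup F] [NormedSpace ℝ F] [FiniteDimensional ℝ F] :
    (E [×j]→L[ℝ] C(TimeIv T, F)) →ₗ[ℝ] C(TimeIv T, E [×j]→L[ℝ] F) where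
  toFun := fun M => ⟨_, continuous_evalCLM_compContinuousMultilinearMap M⟩
  map_add' := fun M N => by ext; rfl
  map_smul' := fun c M => by ext; rfl

theorem norm_multilinearPathₗ_le {j : ℕ} (M : E [×j]→L[ℝ] C(TimeIv T, F)) :
    ‖multilinearPathₗ T j E F M‖ ≤ 1 * ‖M‖ := by
  rw [one_mul, ContinuousMap.norm_le _ (norm_nonneg M)]
  intro t
  refine ContinuousMultilinearMap.opNorm_le_bound (norm_nonneg M) fun v => ?_
  exact ((M v).norm_coe_le_norm t).trans (M.le_opNorm v)

/-- The continuous linear version of `multilinearPathₗ`. -/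
def multilinearPath (T j : ℕ) (E F : Type) [NormedAddCommGroup E] [NormedSpace ℝ E]
    [FiniteDimensional ℝ E] [NormedAddCommGroup F] [NormedSpace ℝ F] [FiniteDimensional ℝ F] :
    (E [×j]→L[ℝ] C(TimeIv T, F)) →L[ℝ] C(TimeIv T, E [×j]→L[ℝ] F) :=
  ⟨multilinearPathₗ T j E F,
    AddMonoidHomClass.continuous_of_bound (multilinearPathₗ T j E F) 1 norm_multilinearPathₗ_le⟩

theorem iteratedFDeriv_eval {k : ℕ} {N : E → C(TimeIv T, F)} (hN : ContDiff ℝ k N) {j : ℕ}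
    (hj : j ≤ k) (t : TimeIv T) (p : E) :
    iteratedFDeriv ℝ j (fun p => N p t) p =
      multilinearPath T j E F (iteratedFDeriv ℝ j N p) t :=
  (ContinuousMap.evalCLM ℝ t : C(TimeIv T, F) →L[ℝ] F).iteratedFDeriv_comp_left hN.contDiffAt
    (by exact_mod_cast hj)

/-- Evaluation at `t` is continuous and linear, so it commutes with derivatives in `p`. Joint
continuity follows because the derivative is a path depending continuously on `p` in the sup norm.
-/
theorem jointCk_eval {k : ℕ} {N : E → C(TimeIv T, F)} (hN : ContDiff ℝ k N) :
    JointCk k fun t p => N p t := by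
  refine ⟨fun t => (ContinuousMap.evalCLM ℝ t : C(TimeIv T, F) →L[ℝ] F).contDiff.comp hN,
    fun j hj => ?_⟩
  have : (fun q : TimeIv T × E => iteratedFDeriv ℝ j (fun p => N p q.1) q.2) = fun q =>
      multilinearPath T j E F (iteratedFDeriv ℝ j N q.2) q.1 :=
    funext fun q => iteratedFDeriv_eval hN hj q.1 q.2
  rw [this]
  have h1 : Continuous fun q : TimeIv T × E => multilinearPath T j E F (iteratedFDeriv ℝ j N q.2) :=
    (ContinuousLinearMap.continuous _).comp
      ((hN.continuous_iteratedFDeriv (by exact_mod_cast hj)).comp continuous_snd)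
  exact h1.eval continuous_fst

/-- Differentiation under the integral sign needs no domination here, since taking the primitive is
a continuous linear operator on paths. -/
theorem iteratedFDeriv_primIv {k : ℕ} {N : E → C(TimeIv T, F)} (hN : ContDiff ℝ k N) {j : ℕ}
    (hj : j ≤ k) (t : TimeIv T) (p : E) :
    iteratedFDeriv ℝ j (fun p => primIv T F (N p) t) p =
      ∫ u in (0 : ℝ)..t, iteratedFDeriv ℝ j (fun p => N p (clampIv T u)) p := by
  have h1 : ContDiff ℝ k fun p => primIv T F (N p) := (primIv T F).contDiff.comp hN
  have h2 : iteratedFDeriv ℝ j (fun p => primIv T F (N p)) p =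
      (primIv T F).compContinuousMultilinearMap (iteratedFDeriv ℝ j N p) :=
    (primIv T F).iteratedFDeriv_comp_left hN.contDiffAt (by exact_mod_cast hj)
  rw [iteratedFDeriv_eval h1 hj, h2]
  simp only [iteratedFDeriv_eval hN hj]
  ext v
  have hc : Continuous fun u : ℝ => multilinearPath T j E F (iteratedFDeriv ℝ j N p) (clampIv T u) :=
    (ContinuousMap.continuous _).comp (continuous_clampIv T)
  refine Eq.trans ?_ (ContinuousLinearMap.intervalIntegral_comp_comm
    (ContinuousMultilinearMap.apply ℝ (fun _ : Fin j => E) F v) (hc.intervalIntegrable (μ := volume) 0 t))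
  rfl

end EvalJets

/-! ### Global flows of Lipschitz fields and their stability -/

section Flow

variable {E : Type} [NormedAddCommGroup E] [NormedSpace ℝ E]

/-- `F` is the flow of the nonautonomous equation `ẋ = f(t, x)` started at time zero; it is of
class `C^k` in space and depends continuously on the right hand side. -/
structure IsSmoothFlow (k : ℕ) (f F : ℝ → E → E) : Prop where
  jointCk : JointCk k F
  jointCk_field : JointCk k fun t p => f t (F t p)
  zero : ∀ p, F 0 p = p
  hasDerivAt : ∀ t p, HasDerivAt (fun s => F s p) (f t (F t p)) t
  hasDerivAt_iteratedFDeriv : ∀ j ≤ k, ∀ t p, HasDerivAt (fun s => iteratedFDeriv ℝ j (F s) p)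
    (iteratedFDeriv ℝ j (fun p => f t (F t p)) p) t
  unique : ∀ c : ℝ → E, (∀ t, HasDerivAt c (f t (c t)) t) → ∀ t, c t = F t (c 0)
  stable : ∀ (T : ℕ) (p : E), ∀ ε > 0, ∃ δ > 0, ∀ c c' : ℝ → E, Continuous c' →
    (∀ t, HasDerivAt c (c' t) t) → ‖c 0 - p‖ < δ → (∀ t : ℝ, |t| ≤ T → ‖c' t - f t (c t)‖ ≤ δ) →
    ∀ t : ℝ, |t| ≤ T → ‖c t - F t p‖ < ε

variable [FiniteDimensional ℝ E]

/-- A field that is Lipschitz in space, uniformly on compact time intervals. -/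
def IsLipschitzField (f : ℝ → E → E) : Prop :=
  ∀ T : ℕ, ∃ K : ℝ, 0 ≤ K ∧ ∀ t : ℝ, |t| ≤ T → ∀ x x', ‖f t x - f t x'‖ ≤ K * ‖x - x'‖

/-- The inhomogeneity `y` is allowed to be any path: constants give solutions with prescribed
initial value, while a nonconstant `y` absorbs the defect of an approximate solution. -/
theorem exists_local_flow {k : ℕ} (hk : 1 ≤ k) {f : ℝ → E → E} (hf : JointCk k f)
    (hL : IsLipschitzField f) (T : ℕ) :
    ∃ S : C(TimeIv T, E) → C(TimeIv T, E), ContDiff ℝ k S ∧ ∀ y X : C(TimeIv T, E),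
      (∀ t : TimeIv T, X t = y t + ∫ u in (0 : ℝ)..t, f u (X (clampIv T u))) ↔ X = S y := by
  have : CompleteSpace E := FiniteDimensional.complete ℝ E
  obtain ⟨K, hK, hKL⟩ := hL T
  have hf' : JointCk k fun t : TimeIv T => f t := hf.comp_param continuous_subtype_val
  obtain ⟨S, hS, h⟩ := exists_contDiff_solution hk hf' hK fun t => hKL t t.abs_le
  refine ⟨S, hS, fun y X => ?_⟩
  rw [← h, ContinuousMap.ext_iff]
  refine forall_congr' fun t => ?_
  have h1 : primIv T E (superpos (fun t : TimeIv T => f t) hf'.continuous X) t =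
      ∫ u in (0 : ℝ)..t, f u (X (clampIv T u)) := by
    rw [primIv_apply]
    refine intervalIntegral.integral_congr_ae (Eventually.of_forall fun u hu => ?_)
    rw [superpos_apply, clampIv_of_mem ((abs_le_of_mem_uIoc_zero hu).trans t.abs_le)]
  rw [picardIv, ContinuousMap.add_apply, h1]

/-- Solutions on the intervals `[-T, T]` exist for every `T` and agree on overlaps by uniqueness, so
they glue to a global flow. All regularity statements are local in time and are inherited from `[-T,
T]`. -/
theorem exists_isSmoothFlow {k : ℕ} (hk : 1 ≤ k) {f : ℝ → E → E} (hf : JointCk k f)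
    (hL : IsLipschitzField f) : ∃ F, IsSmoothFlow k f F := by
  have : CompleteSpace E := FiniteDimensional.complete ℝ E
  choose S hS hSol using exists_local_flow hk hf hL
  -- the solution on `[-T, T]`
  let cst : ∀ T : ℕ, E →L[ℝ] C(TimeIv T, E) := fun T =>
    ContinuousLinearMap.const ℝ (TimeIv T)
  let sol : ∀ T : ℕ, E → C(TimeIv T, E) := fun T p => S T (cst T p)
  have hsol : ∀ T, ContDiff ℝ k (sol T) := fun T => (hS T).comp (cst T).contDiff
  have hsolEq : ∀ T p (t : TimeIv T), sol T p t = p + ∫ u in (0 : ℝ)..t, f u (sol T p (clampIv T u)) :=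
    fun T p => (hSol T (cst T p) _).2 rfl
  have hcurve : ∀ (T : ℕ) (c c' : ℝ → E), Continuous c' → (∀ t, HasDerivAt c (c' t) t) →
      ∀ t, c t = c 0 + ∫ u in (0 : ℝ)..t, c' u := by
    intro T c c' hc' hc t
    rw [intervalIntegral.integral_eq_sub_of_hasDerivAt (fun u _ => hc u)
      (hc'.intervalIntegrable _ _)]
    abel
  have hcompat : ∀ T T' : ℕ, T ≤ T' → ∀ (p : E) (t : ℝ), |t| ≤ T →
      sol T' p (clampIv T' t) = sol T p (clampIv T t) := by
    intro T T' hTT p t ht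
    have hTT' : (T : ℝ) ≤ T' := by exact_mod_cast hTT
    let X : C(TimeIv T, E) := ⟨fun t => sol T' p (clampIv T' t),
      (sol T' p).continuous.comp ((continuous_clampIv T').comp continuous_subtype_val)⟩
    have hX : X = sol T p := by
      refine (hSol T (cst T p) X).1 fun t => ?_
      have ht' : |(t : ℝ)| ≤ T' := t.abs_le.trans hTT'
      have h1 : X t = sol T' p ⟨t, abs_le.1 ht'⟩ := by
        show sol T' p (clampIv T' t) = _
        rw [clampIv_of_mem ht']
      rw [h1, hsolEq]
      congr 1
      refine intervalIntegral.integral_congr_ae (Eventually.of_forall fun u hu => ?_)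
      have hu := (abs_le_of_mem_uIoc_zero hu).trans t.abs_le
      show _ = f u (sol T' p (clampIv T' (clampIv T u)))
      rw [clampIv_of_mem hu]
    rw [← hX, clampIv_of_mem ht]
    rfl
  let F : ℝ → E → E := fun t p => sol (⌈|t|⌉₊ + 1) p (clampIv _ t)
  have hF : ∀ (T : ℕ) (t : ℝ), |t| ≤ T → F t = fun p => sol T p (clampIv T t) := by
    intro T t ht
    funext p
    have h0 : |t| ≤ (⌈|t|⌉₊ + 1 : ℕ) := by
      push_cast
      linarith [Nat.le_ceil |t|]
    rcases le_total T (⌈|t|⌉₊ + 1) with h | h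
    · exact hcompat _ _ h p t ht
    · exact (hcompat _ _ h p t h0).symm
  have hnhds : ∀ t : ℝ, ∃ T : ℕ, |t| ≤ T ∧ ∀ᶠ s : ℝ in 𝓝 t, |s| ≤ T := by
    intro t
    -- The added 1 makes `|t| < T` strict, so that the same `T` serves a neighbourhood of `t`.
    refine ⟨⌈|t|⌉₊ + 1, ?_, ?_⟩
    · push_cast
      linarith [Nat.le_ceil |t|]
    · have : |t| < (⌈|t|⌉₊ + 1 : ℕ) := by
        push_cast
        linarith [Nat.le_ceil |t|]
      exact (continuous_abs.continuousAt.eventually_lt continuousAt_const this).mono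
        fun s hs => hs.le
  -- transfer from `[-T, T]` to the line
  have htransfer : ∀ (G : ℝ → E → E), (∀ T : ℕ, ∃ N : E → C(TimeIv T, E), ContDiff ℝ k N ∧
      ∀ t : ℝ, |t| ≤ T → G t = fun p => N p (clampIv T t)) → JointCk k G := by
    intro G hG
    constructor
    · intro t
      obtain ⟨T, ht, -⟩ := hnhds t
      obtain ⟨N, hN, hGN⟩ := hG T
      rw [hGN t ht]
      exact (jointCk_eval hN).1 _
    · intro j hj
      rw [continuous_iff_continuousAt]
      intro q
      obtain ⟨T, ht, hT⟩ := hnhds q.1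
      obtain ⟨N, hN, hGN⟩ := hG T
      have h1 : Continuous fun q : ℝ × E =>
          iteratedFDeriv ℝ j (fun p => N p (clampIv T q.1)) q.2 :=
        ((jointCk_eval hN).comp_param (continuous_clampIv T)).2 j hj
      refine h1.continuousAt.congr ?_
      have h2 : ∀ᶠ q' : ℝ × E in 𝓝 q, |q'.1| ≤ T := continuous_fst.continuousAt.eventually hT
      filter_upwards [h2] with q' hq'
      rw [hGN q'.1 hq']
  have hck : JointCk k F := htransfer F fun T => ⟨sol T, hsol T, hF T⟩
  -- The velocity along solutions is itself a `C^k` map into the space of paths, and the flow is its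
  -- primitive. Space derivatives of the flow are thus primitives of space derivatives of the
  -- velocity, which is how they become differentiable in time.
  have hN : ∀ T : ℕ, ∃ N : E → C(TimeIv T, E), ContDiff ℝ k N ∧
      (∀ (p : E) (t : ℝ), |t| ≤ T → N p (clampIv T t) = f t (F t p)) ∧
      ∀ p (t : TimeIv T), sol T p t = p + primIv T E (N p) t := by
    intro T
    have hf' : JointCk k fun t : TimeIv T => f t := hf.comp_param continuous_subtype_val
    refine ⟨fun p => superpos _ hf'.continuous (sol T p),
      (contDiff_superpos k _ hf').comp (hsol T), fun p t ht => ?_, fun p t => ?_⟩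
    · rw [superpos_apply, hF T t ht, clampIv_of_mem ht]
    · rw [hsolEq, primIv_apply]
      congr 1
      refine intervalIntegral.integral_congr_ae (Eventually.of_forall fun u hu => ?_)
      rw [superpos_apply, clampIv_of_mem ((abs_le_of_mem_uIoc_zero hu).trans t.abs_le)]
  have hckf : JointCk k fun t p => f t (F t p) := htransfer _ fun T => by
    obtain ⟨N, hN, hN', -⟩ := hN T
    exact ⟨N, hN, fun t ht => funext fun p => (hN' p t ht).symm⟩
  have hderiv : ∀ j ≤ k, ∀ t p, HasDerivAt (fun s => iteratedFDeriv ℝ j (F s) p)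
      (iteratedFDeriv ℝ j (fun p => f t (F t p)) p) t := by
    intro j hj t p
    obtain ⟨T, ht, hT⟩ := hnhds t
    obtain ⟨N, hNc, hN', hN''⟩ := hN T
    have hc : Continuous fun u : ℝ => iteratedFDeriv ℝ j (fun p => N p (clampIv T u)) p :=
      (((jointCk_eval hNc).comp_param (continuous_clampIv T)).2 j hj).comp
        (Continuous.prodMk_left p)
    have h1 := (intervalIntegral.integral_hasDerivAt_right (hc.intervalIntegrable 0 t)
      hc.aestronglyMeasurable.stronglyMeasurableAtFilter hc.continuousAt).const_add
        (iteratedFDeriv ℝ j (fun p : E => p) p)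
    have h2 : (fun p => N p (clampIv T t)) = fun p => f t (F t p) :=
      funext fun p => hN' p t ht
    rw [h2] at h1
    refine h1.congr_of_eventuallyEq ?_
    filter_upwards [hT] with s hs
    have hprim : ContDiff ℝ k fun p => primIv T E (N p) (clampIv T s) :=
      (jointCk_eval ((primIv T E).contDiff.comp hNc)).1 (clampIv T s)
    have hj' : ((j : ℕ) : WithTop ℕ∞) ≤ k := by exact_mod_cast hj
    have h3 : F s = fun p => p + primIv T E (N p) (clampIv T s) := by
      rw [hF T s hs]
      exact funext fun p => hN'' p _
    rw [h3]
    have h4 := iteratedFDeriv_add_apply (x := p) ((contDiff_id (𝕜 := ℝ) (E := E)).of_le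
      (le_top (a := ((j : ℕ) : WithTop ℕ∞)))).contDiffAt (hprim.of_le hj').contDiffAt
    rw [iteratedFDeriv_primIv hNc hj, clampIv_of_mem hs] at h4
    rw [clampIv_of_mem hs]
    exact h4
  have hzero : ∀ p, F 0 p = p := by
    intro p
    have h0 : |(0 : ℝ)| ≤ (0 : ℕ) := by simp
    have : F 0 p = sol 0 p (clampIv 0 0) := congrFun (hF 0 0 h0) p
    rw [this, hsolEq, clampIv_of_mem h0]
    simp
  have hstable : ∀ (T : ℕ) (p : E), ∀ ε > 0, ∃ δ > 0, ∀ c c' : ℝ → E, Continuous c' →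
      (∀ t, HasDerivAt c (c' t) t) → ‖c 0 - p‖ < δ → (∀ t : ℝ, |t| ≤ T → ‖c' t - f t (c t)‖ ≤ δ) →
      ∀ t : ℝ, |t| ≤ T → ‖c t - F t p‖ < ε := by
    intro T p ε hε
    obtain ⟨η, hη, hS'⟩ := Metric.continuousAt_iff.1 ((hS T).continuous.continuousAt
      (x := cst T p)) ε hε
    -- An initial error `δ` and a defect `δ` integrated over a time at most `T` add up to `δ (T + 1)
    -- = η / 2`.
    refine ⟨η / (2 * (T + 1)), by positivity, fun c c' hc' hc hp hcf t ht => ?_⟩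
    set δ := η / (2 * (T + 1)) with hδ
    have hδ0 : 0 < δ := by positivity
    have hcc : Continuous c := continuous_iff_continuousAt.2 fun t => (hc t).continuousAt
    have hfc : Continuous fun t => f t (c t) :=
      hf.continuous.comp (f := fun t => (t, c t)) (by fun_prop)
    let X : C(TimeIv T, E) := ⟨fun t => c t, hcc.comp continuous_subtype_val⟩
    -- With the accumulated defect moved into the inhomogeneity, the approximate solution `c`
    -- becomes an exact solution, and continuity of the solution map applies.
    let y : C(TimeIv T, E) := ⟨fun t => c 0 + ∫ u in (0 : ℝ)..t, (c' u - f u (c u)),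
      continuous_const.add ((intervalIntegral.continuous_primitive (fun a b =>
        (hc'.sub hfc).intervalIntegrable a b) 0).comp continuous_subtype_val)⟩
    have hX : X = S T y := by
      refine (hSol T y X).1 fun t => ?_
      show c t = c 0 + (∫ u in (0 : ℝ)..t, (c' u - f u (c u))) +
        ∫ u in (0 : ℝ)..t, f u (c (clampIv T u))
      have h1 : ∫ u in (0 : ℝ)..t, f u (c (clampIv T u)) = ∫ u in (0 : ℝ)..t, f u (c u) := by
        refine intervalIntegral.integral_congr_ae (Eventually.of_forall fun u hu => ?_)
        rw [clampIv_of_mem ((abs_le_of_mem_uIoc_zero hu).trans t.abs_le)]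
      rw [h1, intervalIntegral.integral_sub (hc'.intervalIntegrable _ _)
        (hfc.intervalIntegrable _ _), hcurve T c c' hc' hc t]
      abel
    have hy : dist y (cst T p) < η := by
      have hle : dist y (cst T p) ≤ δ * (T + 1) := by
        rw [ContinuousMap.dist_le (by positivity)]
        intro t
        rw [dist_eq_norm]
        show ‖c 0 + (∫ u in (0 : ℝ)..t, (c' u - f u (c u))) - p‖ ≤ _
        have h1 : ‖∫ u in (0 : ℝ)..t, (c' u - f u (c u))‖ ≤ δ * |(t : ℝ) - 0| :=
          intervalIntegral.norm_integral_le_of_norm_le_const fun u hu =>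
            hcf u ((abs_le_of_mem_uIoc_zero hu).trans t.abs_le)
        have h2 : δ * |(t : ℝ) - 0| ≤ δ * T := by
          rw [sub_zero]; gcongr; exact t.abs_le
        calc _ = ‖(c 0 - p) + ∫ u in (0 : ℝ)..t, (c' u - f u (c u))‖ := by congr 1; abel
          _ ≤ ‖c 0 - p‖ + ‖∫ u in (0 : ℝ)..t, (c' u - f u (c u))‖ := norm_add_le _ _
          _ ≤ δ + δ * T := add_le_add hp.le (h1.trans h2)
          _ = _ := by ring
      refine hle.trans_lt ?_
      have : δ * (T + 1) = η / 2 := by rw [hδ]; field_simp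
      rw [this]; linarith
    have h1 := hS' hy
    rw [← hX] at h1
    have h2 := (ContinuousMap.dist_apply_le_dist (x := clampIv T t)).trans_lt h1
    rw [dist_eq_norm, clampIv_of_mem ht] at h2
    rw [hF T t ht, clampIv_of_mem ht]
    exact h2
  refine ⟨F, hck, hckf, hzero, fun t p => ?_, hderiv, fun c hc t => ?_, hstable⟩
  · have := hderiv 0 (Nat.zero_le _) t p
    have h2 := (continuousMultilinearCurryFin0 ℝ E E).toContinuousLinearEquiv.toContinuousLinearMap.hasFDerivAt.comp_hasDerivAt t this
    simpa [Function.comp_def] using! h2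
  · have hcc : Continuous c := continuous_iff_continuousAt.2 fun t => (hc t).continuousAt
    have hfc : Continuous fun t => f t (c t) :=
      hf.continuous.comp (f := fun t => (t, c t)) (by fun_prop)
    obtain ⟨T, ht, -⟩ := hnhds t
    refine sub_eq_zero.1 (norm_le_zero_iff.1 (le_of_forall_pos_lt_add fun ε hε => ?_))
    -- Uniqueness is stability with zero defect and zero initial error, for every `ε`.
    obtain ⟨δ, hδ, h⟩ := hstable T (c 0) ε hε
    rw [zero_add]
    exact h c _ hfc hc (by simpa using hδ) (fun t _ => by simpa using hδ.le) t ht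

end Flow

/-! ### The particle flow -/

section Field

variable {m : ℕ}

/-- The `C^m` norm is a maximum of sup norms of derivatives, so continuity of the path in time is
uniform in space. -/
theorem jointCk_pull (ψ : PathSpace m) : JointCk m fun t x => (ψ.at t).pull x := by
  refine ⟨fun t => (ψ.at t).contDiff_pull, fun j hj => ?_⟩
  have hiso : Isometry (jets m) :=
    AddMonoidHomClass.isometry_of_norm (jets m) fun f => rfl
  have h1 : Continuous fun t : ℝ => (jets m (ψ.at t) ⟨j, Nat.lt_succ_of_le hj⟩ : JetComp j) :=
    (continuous_apply (A := fun j : Fin (m + 1) => JetComp (j : ℕ))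
      (⟨j, Nat.lt_succ_of_le hj⟩ : Fin (m + 1))).comp
      (hiso.continuous.comp (continuous_at_right ψ))
  have h2 : Continuous fun q : ℝ × Plane =>
      (jets m (ψ.at q.1) ⟨j, Nat.lt_succ_of_le hj⟩ : JetComp j) q.2 :=
    (h1.comp continuous_fst).eval continuous_snd
  exact h2

/-- The rotated gradient as a linear function of the derivative. -/
def rotGrad : (Plane →L[ℝ] ℝ) →L[ℝ] Plane :=
  LinearMap.toContinuousLinearMap
    { toFun := fun φ => !₂[φ (EuclideanSpace.single 1 1), -φ (EuclideanSpace.single 0 1)]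
      map_add' := fun φ φ' => by
        ext i; fin_cases i <;> simp [add_comm]
      map_smul' := fun c φ => by
        ext i; fin_cases i <;> simp }

theorem gradPerp_eq (f : CmTorus m) (x : Plane) : gradPerp f x = rotGrad (fderiv ℝ f.pull x) := rfl

/-- The right hand side of the particle equation, on the universal covering of the phase space. -/
def particleField (τ : ℝ) (ψ : PathSpace m) (t : ℝ) (p : Plane × Plane) : Plane × Plane :=
  (p.2, τ⁻¹ • (gradPerp (ψ.at t) p.1 - p.2))

/-- The field is a fixed linear map plus a linear image of the gradient of `ψ`. The gradient costs
one derivative, which is the origin of the class `C^{m-1}`. -/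
theorem jointCk_particleField (τ : ℝ) (ψ : PathSpace m) (hm : 2 ≤ m) :
    JointCk (m - 1) (particleField τ ψ) := by
  let A : Plane × Plane →L[ℝ] Plane × Plane :=
    (ContinuousLinearMap.snd ℝ Plane Plane).prod (-(τ⁻¹ • ContinuousLinearMap.snd ℝ Plane Plane))
  let B : Plane →L[ℝ] Plane × Plane :=
    (0 : Plane →L[ℝ] Plane).prod (τ⁻¹ • ContinuousLinearMap.id ℝ Plane)
  have h1 : JointCk (m - 1 + 1) fun t x => (ψ.at t).pull x := by
    rw [Nat.sub_add_cancel (by omega)]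
    exact jointCk_pull ψ
  have h2 := ((h1.fderiv.clm_comp rotGrad).comp_clm
    (ContinuousLinearMap.fst ℝ Plane Plane)).clm_comp B
  have h3 : JointCk (m - 1) fun (_ : ℝ) (p : Plane × Plane) => A p :=
    JointCk.of_contDiff A.contDiff
  have h4 : particleField τ ψ = fun t p =>
      A p + B (rotGrad (fderiv ℝ (fun x => (ψ.at t).pull x)
        (ContinuousLinearMap.fst ℝ Plane Plane p))) := by
    funext t p
    refine Prod.ext ?_ ?_
    · simp [particleField, A, B]
    · simp only [particleField, A, B, Prod.snd_add, gradPerp_eq]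
      simp [smul_sub]
      abel
  rw [h4]
  exact h3.add h2

/-- Since `2 ≤ m`, the norm of `C^m` bounds the second derivative, and the mean value inequality
applies. This is what makes the particle field globally Lipschitz in space. -/
theorem norm_fderiv_pull_sub_le (hm : 2 ≤ m) (f : CmTorus m) (x x' : Plane) :
    ‖fderiv ℝ f.pull x - fderiv ℝ f.pull x'‖ ≤ ‖f‖ * ‖x - x'‖ := by
  have hd : Differentiable ℝ (fderiv ℝ f.pull) :=
    (f.contDiff_pull.fderiv_right (m := 1) (by exact_mod_cast hm)).differentiable (by simp)
  refine convex_univ.norm_image_sub_le_of_norm_fderiv_le (𝕜 := ℝ) (fun y _ => hd y)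
    (fun y _ => ?_) (Set.mem_univ x') (Set.mem_univ x)
  rw [← norm_iteratedFDeriv_one, norm_iteratedFDeriv_fderiv]
  exact f.norm_iteratedFDeriv_le hm y

theorem isLipschitzField_particleField (τ : ℝ) (ψ : PathSpace m) (hm : 2 ≤ m) :
    IsLipschitzField (particleField τ ψ) := by
  intro T
  obtain ⟨C, hC⟩ := (isCompact_Icc (a := -(T : ℝ)) (b := T)).exists_bound_of_continuousOn
    (continuous_at_right ψ).continuousOn
  have hC0 : 0 ≤ C := (norm_nonneg _).trans (hC 0 (by simp))
  refine ⟨1 + |τ⁻¹| * (‖rotGrad‖ * C + 1), by positivity, fun t ht p p' => ?_⟩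
  have h1 : ‖p.1 - p'.1‖ ≤ ‖p - p'‖ := norm_fst_le (p - p')
  have h2 : ‖p.2 - p'.2‖ ≤ ‖p - p'‖ := norm_snd_le (p - p')
  have h3 : ‖gradPerp (ψ.at t) p.1 - gradPerp (ψ.at t) p'.1‖ ≤ ‖rotGrad‖ * C * ‖p - p'‖ := by
    rw [gradPerp_eq, gradPerp_eq, ← map_sub, mul_assoc]
    refine rotGrad.le_of_opNorm_le_of_le le_rfl ((norm_fderiv_pull_sub_le hm _ _ _).trans ?_)
    exact mul_le_mul (hC t (abs_le.1 ht)) h1 (norm_nonneg _) hC0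
  have h0 : 0 ≤ |τ⁻¹| * (‖rotGrad‖ * C + 1) := by positivity
  refine norm_prod_le_iff.2 ⟨?_, ?_⟩
  · show ‖p.2 - p'.2‖ ≤ _
    nlinarith [norm_nonneg (p - p')]
  · show ‖τ⁻¹ • (gradPerp (ψ.at t) p.1 - p.2) - τ⁻¹ • (gradPerp (ψ.at t) p'.1 - p'.2)‖ ≤ _
    rw [← smul_sub, norm_smul, Real.norm_eq_abs]
    have h4 : ‖gradPerp (ψ.at t) p.1 - p.2 - (gradPerp (ψ.at t) p'.1 - p'.2)‖ ≤
        (‖rotGrad‖ * C + 1) * ‖p - p'‖ := by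
      rw [sub_sub_sub_comm]
      refine (norm_sub_le _ _).trans ?_
      linarith
    calc _ ≤ |τ⁻¹| * ((‖rotGrad‖ * C + 1) * ‖p - p'‖) := by gcongr
      _ ≤ _ := by nlinarith [norm_nonneg (p - p')]

theorem cover_add (x y : Plane) : cover (x + y) = cover x + cover y := by
  funext i; simp [cover]

theorem gradPerp_congr (f : CmTorus m) {x x' : Plane} (h : cover x = cover x') :
    gradPerp f x = gradPerp f x' := by
  have h1 : (fun z => f.pull (z + (x' - x))) = f.pull := by
    funext z
    have h2 : cover (x' - x) = 0 := by
      have h3 := cover_add x (x' - x)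
      rw [add_sub_cancel, ← h] at h3
      simpa using h3
    rw [CmTorus.pull, CmTorus.pull, cover_add, h2, add_zero]
  rw [gradPerp_eq, gradPerp_eq]
  congr 1
  have h4 := fderiv_comp_add_right (𝕜 := ℝ) (f := f.pull) (x := x) (x' - x)
  rw [h1, add_sub_cancel] at h4
  exact h4

/-- The flow of the particle equation on the universal covering of the phase space. -/
theorem exists_particleFlow (τ : ℝ) (hm : 2 ≤ m) :
    ∃ F : PathSpace m → ℝ → Plane × Plane → Plane × Plane,
      ∀ ψ, IsSmoothFlow (m - 1) (particleField τ ψ) (F ψ) :=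
  ⟨_, fun ψ => (exists_isSmoothFlow (by omega) (jointCk_particleField τ ψ hm)
    (isLipschitzField_particleField τ ψ hm)).choose_spec⟩

variable {τ : ℝ} {F : PathSpace m → ℝ → Plane × Plane → Plane × Plane}
  (hF : ∀ ψ, IsSmoothFlow (m - 1) (particleField τ ψ) (F ψ))
include hF

/-- The field is periodic in the position, so a solution translated by a lattice vector is a
solution, and uniqueness identifies it. -/
theorem particleFlow_translate (ψ : PathSpace m) (t : ℝ) {x x' : Plane} (h : cover x = cover x')
    (y : Plane) : F ψ t (x', y) = F ψ t (x, y) + (x' - x, 0) := by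
  have h1 := (hF ψ).unique (fun t => F ψ t (x, y) + (x' - x, 0)) (fun t => ?_) t
  · rw [(hF ψ).zero] at h1
    simpa using h1.symm
  · refine (((hF ψ).hasDerivAt t (x, y)).add_const (x' - x, (0 : Plane))).congr_deriv ?_
    have h2 : cover (F ψ t (x, y)).1 = cover ((F ψ t (x, y)).1 + (x' - x)) := by
      have h3 := cover_add x (x' - x)
      rw [add_sub_cancel, ← h] at h3
      rw [cover_add]
      simpa using h3
    simp only [particleField, Prod.fst_add, Prod.snd_add, add_zero]
    rw [gradPerp_congr _ h2]

theorem phaseCover_particleFlow (ψ : PathSpace m) (t : ℝ) {p p' : Plane × Plane}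
    (h : phaseCover p = phaseCover p') : phaseCover (F ψ t p) = phaseCover (F ψ t p') := by
  obtain ⟨x, y⟩ := p
  obtain ⟨x', y'⟩ := p'
  simp only [phaseCover, Prod.mk.injEq] at h
  obtain ⟨h1, rfl⟩ := h
  have h3 := cover_add x (x' - x)
  rw [add_sub_cancel, ← h1, left_eq_add] at h3
  rw [particleFlow_translate hF ψ t h1 y]
  simp [phaseCover, cover_add, h3]

/-- As functions of `t` both sides solve the equation of the shifted path, with the same value at `t
= 0`. -/
theorem particleFlow_cocycle (ψ : PathSpace m) (s t : ℝ) (p : Plane × Plane) :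
    F ψ (t + s) p = F (shift s ψ) t (F ψ s p) := by
  have h := (hF (shift s ψ)).unique (fun t => F ψ (t + s) p) (fun t => ?_) t
  · simpa using h
  · have h1 := ((hF ψ).hasDerivAt (t + s) p).comp_add_const t s
    refine h1.congr_deriv ?_
    simp only [particleField, shift_at, add_comm s t]

/-- A solution for a path `ψ` near `ψ₀` solves the equation of `ψ₀` up to a defect of order `sup
‖ψ(t) - ψ₀(t)‖` over `[-T, T]`, which is small in the compact-open topology; stability of the flow
does the rest. Joint continuity is the source of the measurability of the random dynamical system.
-/
theorem continuous_particleFlow (hm : 2 ≤ m) :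
    Continuous fun q : ℝ × PathSpace m × (Plane × Plane) => F q.2.1 q.1 q.2.2 := by
  rw [continuous_iff_continuousAt]
  rintro ⟨t₀, ψ₀, p₀⟩
  rw [Metric.continuousAt_iff']
  intro ε hε
  obtain ⟨T, hT⟩ : ∃ T : ℕ, |t₀| < T := exists_nat_gt _
  obtain ⟨δ, hδ, h⟩ := (hF ψ₀).stable T p₀ (ε / 2) (by positivity)
  have h1 : ∀ᶠ q : ℝ × PathSpace m × (Plane × Plane) in 𝓝 (t₀, ψ₀, p₀), |q.1| ≤ T :=
    (ContinuousAt.eventually_lt (f := fun q : ℝ × PathSpace m × (Plane × Plane) => |q.1|)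
      (g := fun _ => (T : ℝ)) (by fun_prop) continuousAt_const hT).mono fun q hq => hq.le
  have h2 : ∀ᶠ q : ℝ × PathSpace m × (Plane × Plane) in 𝓝 (t₀, ψ₀, p₀), ‖q.2.2 - p₀‖ < δ :=
    ContinuousAt.eventually_lt
      (f := fun q : ℝ × PathSpace m × (Plane × Plane) => ‖q.2.2 - p₀‖)
      (g := fun _ => δ) (by fun_prop) continuousAt_const (by simpa using hδ)
  have h3 : ∀ᶠ q : ℝ × PathSpace m × (Plane × Plane) in 𝓝 (t₀, ψ₀, p₀),
      dist (F ψ₀ q.1 p₀) (F ψ₀ t₀ p₀) < ε / 2 := by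
    have hc : ContinuousAt (fun q : ℝ × PathSpace m × (Plane × Plane) => F ψ₀ q.1 p₀)
        (t₀, ψ₀, p₀) :=
      ContinuousAt.comp (f := fun q : ℝ × PathSpace m × (Plane × Plane) => q.1)
        (g := fun t => F ψ₀ t p₀) ((hF ψ₀).hasDerivAt t₀ p₀).continuousAt continuousAt_fst
    exact (Metric.continuousAt_iff'.1 hc) (ε / 2) (by positivity)
  -- The factor by which the difference of the fields is bounded in terms of the `C^m` distance;
  -- dividing by `κ + 1` below avoids a separate case `κ = 0`.
  set κ := |τ⁻¹| * ‖rotGrad‖ with hκ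
  have hκ0 : 0 ≤ κ := by positivity
  have h4 : ∀ᶠ q : ℝ × PathSpace m × (Plane × Plane) in 𝓝 (t₀, ψ₀, p₀),
      ∀ t ∈ Set.Icc (-(T : ℝ)) T, ‖q.2.1.at t - ψ₀.at t‖ < δ / (κ + 1) := by
    have h5 : Tendsto (fun q : ℝ × PathSpace m × (Plane × Plane) => q.2.1) (𝓝 (t₀, ψ₀, p₀)) (𝓝 ψ₀) :=
      (continuous_fst.comp continuous_snd).tendsto _
    have h6 := (ContinuousMap.tendsto_iff_forall_isCompact_tendstoUniformlyOn
      (F := fun q : ℝ × PathSpace m × (Plane × Plane) => (q.2.1 : C(ℝ, CmTorus m)))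
      (f := (ψ₀ : C(ℝ, CmTorus m)))).1 h5 (Set.Icc (-(T : ℝ)) T) isCompact_Icc
    filter_upwards [Metric.tendstoUniformlyOn_iff.1 h6 (δ / (κ + 1)) (by positivity)] with q hq t ht
    have := hq t ht
    rw [dist_comm, dist_eq_norm] at this
    exact this
  filter_upwards [h1, h2, h3, h4] with q hq1 hq2 hq3 hq4
  obtain ⟨t, ψ, p⟩ := q
  have h7 := h (fun t => F ψ t p) (fun t => particleField τ ψ t (F ψ t p))
    (by
      have := (hF ψ).jointCk_field.continuous
      exact this.comp (f := fun t : ℝ => (t, p)) (by fun_prop))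
    (fun t => (hF ψ).hasDerivAt t p) (by simpa [(hF ψ).zero] using hq2) (fun s hs => ?_) t hq1
  · calc dist (F ψ t p) (F ψ₀ t₀ p₀) ≤ dist (F ψ t p) (F ψ₀ t p₀) + dist (F ψ₀ t p₀) (F ψ₀ t₀ p₀) :=
          dist_triangle _ _ _
      _ < ε / 2 + ε / 2 := add_lt_add (by rw [dist_eq_norm]; exact h7) hq3
      _ = ε := by ring
  · set x := (F ψ s p).1
    have h8 : particleField τ ψ s (F ψ s p) - particleField τ ψ₀ s (F ψ s p) =
        ((0 : Plane), τ⁻¹ • rotGrad (fderiv ℝ (ψ.at s - ψ₀.at s).pull x)) := by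
      have h9 : fderiv ℝ (ψ.at s - ψ₀.at s).pull x =
          fderiv ℝ (ψ.at s).pull x - fderiv ℝ (ψ₀.at s).pull x := by
        have hd : ∀ f : CmTorus m, DifferentiableAt ℝ f.pull x := fun f =>
          f.contDiff_pull.differentiable (by
            have : m ≠ 0 := by omega
            exact_mod_cast this) x
        exact fderiv_sub (hd _) (hd _)
      simp only [particleField, Prod.mk_sub_mk, sub_self, ← smul_sub, h9, map_sub, gradPerp_eq]
      congr 2
      abel
    rw [h8, Prod.norm_mk, norm_zero, max_eq_right (norm_nonneg _), norm_smul, Real.norm_eq_abs]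
    have h10 : ‖fderiv ℝ (ψ.at s - ψ₀.at s).pull x‖ ≤ δ / (κ + 1) := by
      rw [← norm_iteratedFDeriv_one]
      exact ((ψ.at s - ψ₀.at s).norm_iteratedFDeriv_le (by omega) x).trans
        (hq4 s (abs_le.1 hs)).le
    calc |τ⁻¹| * ‖rotGrad (fderiv ℝ (ψ.at s - ψ₀.at s).pull x)‖
        ≤ |τ⁻¹| * (‖rotGrad‖ * (δ / (κ + 1))) := by
          gcongr; exact rotGrad.le_of_opNorm_le_of_le le_rfl h10
      _ = κ / (κ + 1) * δ := by rw [hκ]; ring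
      _ ≤ 1 * δ := by
          gcongr
          rw [div_le_one (by positivity)]; linarith
      _ = δ := one_mul δ

end Field

/-! ### The random dynamical system -/

/-- A measurable section of the covering map. -/
def coverSection (z : Torus) : Plane :=
  WithLp.toLp 2 (UnitAddTorus.measurableEquivPiIoc (0 : Fin 2 → ℝ) z).1

theorem cover_coverSection (z : Torus) : cover (coverSection z) = z :=
  (UnitAddTorus.measurableEquivPiIoc (0 : Fin 2 → ℝ)).symm_apply_apply z

theorem measurable_coverSection : Measurable coverSection :=
  (PiLp.continuous_toLp 2 _).measurable.comp
    (measurable_subtype_coe.comp (UnitAddTorus.measurableEquivPiIoc (0 : Fin 2 → ℝ)).measurable)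

theorem continuous_phaseCover : Continuous phaseCover :=
  (continuous_cover.comp continuous_fst).prodMk continuous_snd

/-- A lift of a point of the phase space to the universal covering. -/
def phaseSection (z : Phase) : Plane × Plane := (coverSection z.1, z.2)

theorem phaseCover_phaseSection (z : Phase) : phaseCover (phaseSection z) = z :=
  Prod.ext (cover_coverSection z.1) rfl

theorem measurable_phaseSection : Measurable phaseSection :=
  (measurable_coverSection.comp measurable_fst).prodMk measurable_snd

section RDS

variable {m : ℕ} {P : Measure (PathSpace m)} {Ω₀ : Set (PathSpace m)}

theorem image_preimage_shiftOn (h : ∀ t, shift t ⁻¹' Ω₀ = Ω₀) (t : ℝ) (A : Set Ω₀) :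
    Subtype.val '' (shiftOn Ω₀ h t ⁻¹' A) = shift t ⁻¹' (Subtype.val '' A) := by
  ext ψ
  constructor
  · rintro ⟨ψ', hψ', rfl⟩
    exact ⟨shiftOn Ω₀ h t ψ', hψ', rfl⟩
  · rintro ⟨ψ', hψ', he⟩
    have h1 : ψ ∈ Ω₀ := by
      rw [← h t]
      show shift t ψ ∈ Ω₀
      rw [← he]; exact ψ'.2
    refine ⟨⟨ψ, h1⟩, ?_, rfl⟩
    show shiftOn Ω₀ h t ⟨ψ, h1⟩ ∈ A
    convert hψ'
    exact Subtype.ext he.symm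

theorem isErgodicMDS_shiftOn (hP : IsErgodicMDS P shift) (hΩ : IsGrowthSet P Ω₀) :
    IsErgodicMDS (P.comap Subtype.val) (shiftOn Ω₀ hΩ.invariant) := by
  have hcomap : ∀ A : Set Ω₀, P.comap Subtype.val A = P (Subtype.val '' A) := fun A =>
    comap_subtype_coe_apply hΩ.measurableSet P A
  refine ⟨⟨?_⟩, ?_, ?_, ?_, ?_, ?_⟩
  · rw [hcomap, Set.image_univ, Subtype.range_coe, hΩ.full]
  · exact Measurable.subtype_mk (measurable_shift.comp
      ((measurable_subtype_coe.comp measurable_fst).prodMk measurable_snd))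
  · funext ψ
    exact Subtype.ext (congrFun shift_zero ψ.1)
  · intro s t
    funext ψ
    exact Subtype.ext (congrFun (shift_add s t) ψ.1)
  · intro t A hA
    rw [hcomap, hcomap, image_preimage_shiftOn,
      hP.preserves t _ (hΩ.measurableSet.subtype_image hA)]
  · intro A hA hinv
    rw [hcomap]
    refine hP.ergodic _ (hΩ.measurableSet.subtype_image hA) fun t => ?_
    rw [← image_preimage_shiftOn hΩ.invariant, hinv]

/-- The system is the flow on the universal cover applied to an arbitrary measurable choice of lift.
Lattice equivariance makes the result independent of the choice, so continuity of the section is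
never needed. -/
theorem exists_particle_rds {τ : ℝ} (hm : 2 ≤ m) (hP : IsErgodicMDS P shift)
    (hΩ : IsGrowthSet P Ω₀) :
    ∃ φ : ℝ → Ω₀ → Phase → Phase,
      (∀ (ψ : Ω₀) (z : Phase) (c : ℝ → Phase),
        IsTrajectory τ ψ.1 z c ↔ c = fun t => φ t ψ z) ∧
      (∀ ψ : Ω₀, IsC1Ck (m - 1) (fun t => φ t ψ)) ∧
      IsCkRDS (m - 1) (P.comap Subtype.val) (shiftOn Ω₀ hΩ.invariant) φ := by
  obtain ⟨F, hF⟩ := exists_particleFlow (m := m) τ hm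
  let φ : ℝ → Ω₀ → Phase → Phase := fun t ψ z => phaseCover (F ψ.1 t (phaseSection z))
  have hφ : ∀ (ψ : Ω₀) t p, φ t ψ (phaseCover p) = phaseCover (F ψ.1 t p) := fun ψ t p =>
    phaseCover_particleFlow hF ψ.1 t (phaseCover_phaseSection _)
  have hlift : ∀ ψ : Ω₀, IsLift (F ψ.1) (fun t => φ t ψ) := fun ψ t p => (hφ ψ t p).symm
  refine ⟨φ, ?_, ?_, isErgodicMDS_shiftOn hP hΩ, ⟨?_, ?_, ?_⟩, ?_⟩
  · intro ψ z c
    constructor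
    · rintro ⟨h0, X, hX⟩
      funext t
      have h1 := (hF ψ.1).unique (fun t => (X t, (c t).2)) (fun t =>
        (hX t).2.1.prodMk (hX t).2.2) t
      have h2 : phaseCover (X 0, (c 0).2) = z := by
        rw [← h0]
        exact Prod.ext (hX 0).1 rfl
      calc c t = phaseCover (X t, (c t).2) := Prod.ext (hX t).1.symm rfl
        _ = phaseCover (F ψ.1 t (X 0, (c 0).2)) := by rw [h1]
        _ = φ t ψ z := by rw [← hφ, h2]
    · rintro rfl
      refine ⟨?_, fun t => (F ψ.1 t (phaseSection z)).1, fun t => ⟨rfl, ?_, ?_⟩⟩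
      · show phaseCover (F ψ.1 0 (phaseSection z)) = z
        rw [(hF ψ.1).zero, phaseCover_phaseSection]
      · exact ((hF ψ.1).hasDerivAt t (phaseSection z)).fst
      · exact ((hF ψ.1).hasDerivAt t (phaseSection z)).snd
  · intro ψ
    exact ⟨F ψ.1, fun t p => particleField τ ψ.1 t (F ψ.1 t p), hlift ψ, (hF ψ.1).jointCk,
      (hF ψ.1).jointCk_field, (hF ψ.1).hasDerivAt_iteratedFDeriv⟩
  · have h1 : Measurable fun q : ℝ × Ω₀ × Phase => (q.1, q.2.1.1, phaseSection q.2.2) :=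
      measurable_fst.prodMk ((measurable_subtype_coe.comp (measurable_fst.comp measurable_snd)).prodMk
        (measurable_phaseSection.comp (measurable_snd.comp measurable_snd)))
    exact (continuous_phaseCover.comp (continuous_particleFlow hF hm)).measurable.comp h1
  · intro ψ
    funext z
    show phaseCover (F ψ.1 0 (phaseSection z)) = z
    rw [(hF ψ.1).zero, phaseCover_phaseSection]
  · intro s t ψ
    funext z
    show phaseCover (F ψ.1 (t + s) (phaseSection z)) = φ t (shiftOn Ω₀ hΩ.invariant s ψ) (phaseCover (F ψ.1 s (phaseSection z)))
    rw [hφ, particleFlow_cocycle hF]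
    rfl
  · intro ψ
    exact ⟨F ψ.1, hlift ψ, (hF ψ.1).jointCk⟩

end RDS

/-! ### Fractional Ornstein-Uhlenbeck curves in a Hilbert space -/

section FOU

variable {E : Type*} [NormedAddCommGroup E] [InnerProductSpace ℝ E]

/-- A curve in a Hilbert space with the covariance of `√(2κ)` times a fractional Brownian motion. -/
structure IsFBmCurve (κ H : ℝ) (B : ℝ → E) : Prop where
  kappa_nonneg : 0 ≤ κ
  hurst_pos : 0 < H
  hurst_lt_one : H < 1
  inner_eq : ∀ s t, inner ℝ (B s) (B t) =
    κ * (|s| ^ (2 * H) + |t| ^ (2 * H) - |s - t| ^ (2 * H))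

variable {κ H : ℝ} {B : ℝ → E}

theorem IsFBmCurve.inner_sub (hB : IsFBmCurve κ H B) (s t s' t' : ℝ) :
    inner ℝ (B s - B t) (B s' - B t') =
      κ * (|s - t'| ^ (2 * H) + |t - s'| ^ (2 * H) - |s - s'| ^ (2 * H) - |t - t'| ^ (2 * H)) := by
  simp only [inner_sub_left, inner_sub_right, hB.inner_eq]
  ring

theorem IsFBmCurve.norm_sub (hB : IsFBmCurve κ H B) (s t : ℝ) :
    ‖B s - B t‖ = √(2 * κ) * |s - t| ^ H := by
  have h0 := hB.kappa_nonneg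
  have h1 : ‖B s - B t‖ ^ 2 = 2 * κ * |s - t| ^ (2 * H) := by
    rw [← real_inner_self_eq_norm_sq, hB.inner_sub, sub_self, sub_self, abs_zero, abs_sub_comm t s,
      Real.zero_rpow (by have := hB.hurst_pos; positivity)]
    ring
  rw [← Real.sqrt_sq (norm_nonneg (B s - B t)), h1, Real.sqrt_mul (by positivity), mul_comm 2 H,
    Real.rpow_mul (abs_nonneg _), Real.rpow_two, Real.sqrt_sq (by positivity)]

theorem IsFBmCurve.zero (hB : IsFBmCurve κ H B) : B 0 = 0 := by
  have h1 := hB.inner_eq 0 0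
  rw [sub_self, abs_zero, Real.zero_rpow (by have := hB.hurst_pos; positivity)] at h1
  simpa using h1

theorem IsFBmCurve.continuous (hB : IsFBmCurve κ H B) : Continuous B := by
  rw [continuous_iff_continuousAt]
  intro t
  rw [ContinuousAt, tendsto_iff_norm_sub_tendsto_zero]
  simp only [hB.norm_sub]
  have h : Continuous fun s : ℝ => √(2 * κ) * |s - t| ^ H := by
    refine continuous_const.mul (Continuous.rpow_const (by fun_prop) fun _ => Or.inr hB.hurst_pos.le)
  simpa [Real.zero_rpow hB.hurst_pos.ne'] using h.tendsto t

theorem integrableOn_exp_rpow {a H : ℝ} (ha : 0 < a) (hH : 0 < H) :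
    IntegrableOn (fun v : ℝ => a * Real.exp (-(a * v)) * v ^ H) (Set.Ioi 0) := by
  have h := integrableOn_rpow_mul_exp_neg_mul_rpow (p := 1) (s := H) (b := a) (by linarith)
    one_pos ha
  refine IntegrableOn.congr_fun (h.const_mul a) (fun v _ => ?_) measurableSet_Ioi
  simp only [Real.rpow_one]
  rw [neg_mul]
  ring

theorem integral_exp_rpow {a H : ℝ} (ha : 0 < a) (hH : 0 < H) :
    ∫ v in Set.Ioi (0 : ℝ), a * Real.exp (-(a * v)) * v ^ H = Real.Gamma (H + 1) * a ^ (-H) := by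
  have h := Real.integral_rpow_mul_exp_neg_mul_Ioi (a := H + 1) (r := a) (by linarith) ha
  have h2 : ∫ v in Set.Ioi (0 : ℝ), a * Real.exp (-(a * v)) * v ^ H =
      a * ∫ v in Set.Ioi (0 : ℝ), v ^ (H + 1 - 1) * Real.exp (-(a * v)) := by
    rw [← integral_const_mul]
    refine setIntegral_congr_fun measurableSet_Ioi fun v _ => ?_
    simp only [add_sub_cancel_right]
    ring
  rw [h2, h, one_div, Real.inv_rpow ha.le, Real.rpow_add ha, Real.rpow_one, Real.rpow_neg ha.le]
  field_simp

theorem integrableOn_exp_mul {a : ℝ} (ha : 0 < a) :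
    IntegrableOn (fun v : ℝ => a * Real.exp (-(a * v))) (Set.Ioi 0) := by
  have h := (integrableOn_exp_mul_Ioi (neg_lt_zero.2 ha) 0).const_mul a
  simpa [neg_mul, IntegrableOn] using h

theorem integral_exp_mul {a : ℝ} (ha : 0 < a) :
    ∫ v in Set.Ioi (0 : ℝ), a * Real.exp (-(a * v)) = 1 := by
  have h := integral_exp_mul_Ioi (neg_lt_zero.2 ha) 0
  rw [integral_const_mul]
  simp only [neg_mul] at h
  rw [h]
  simp [ha.ne']

/-- The stationary fractional Ornstein-Uhlenbeck curve
`Y(t) = ∫_{-∞}^t e^{-a(t-u)} dB(u) = ∫₀^∞ a e^{-av} (B(t) - B(t - v)) dv`. -/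
def fouCurve (a : ℝ) (B : ℝ → E) (t : ℝ) : E :=
  ∫ v in Set.Ioi (0 : ℝ), (a * Real.exp (-(a * v))) • (B t - B (t - v))

variable {a : ℝ}

theorem IsFBmCurve.norm_kernel_le (hB : IsFBmCurve κ H B) (ha : 0 < a) (t : ℝ) {v : ℝ} (hv : 0 < v) :
    ‖(a * Real.exp (-(a * v))) • (B t - B (t - v))‖ ≤
      √(2 * κ) * (a * Real.exp (-(a * v)) * v ^ H) := by
  rw [norm_smul, hB.norm_sub, sub_sub_cancel, abs_of_pos hv, Real.norm_of_nonneg (by positivity)]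
  apply le_of_eq; ring

theorem IsFBmCurve.integrableOn_kernel (hB : IsFBmCurve κ H B) (ha : 0 < a) (t : ℝ) :
    IntegrableOn (fun v : ℝ => (a * Real.exp (-(a * v))) • (B t - B (t - v))) (Set.Ioi 0) := by
  refine Integrable.mono' ((integrableOn_exp_rpow ha hB.hurst_pos).const_mul √(2 * κ)) ?_ ?_
  · have := hB.continuous
    exact Continuous.aestronglyMeasurable (by fun_prop)
  · exact (ae_restrict_mem measurableSet_Ioi).mono fun v hv => hB.norm_kernel_le ha t hv

theorem IsFBmCurve.norm_fouCurve_le (hB : IsFBmCurve κ H B) (ha : 0 < a) (t : ℝ) :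
    ‖fouCurve a B t‖ ≤ √(2 * κ) * Real.Gamma (H + 1) * a ^ (-H) := by
  rw [mul_assoc, ← integral_exp_rpow ha hB.hurst_pos, ← integral_const_mul]
  exact norm_integral_le_of_norm_le ((integrableOn_exp_rpow ha hB.hurst_pos).const_mul _)
    ((ae_restrict_mem measurableSet_Ioi).mono fun v hv => hB.norm_kernel_le ha t hv)

/-- The weight `a e^{-av}` is a probability density, and the difference of the integrands consists
of two increments of `B` over time `|s - t|`. -/
theorem IsFBmCurve.norm_fouCurve_sub_le (hB : IsFBmCurve κ H B) (ha : 0 < a) (s t : ℝ) :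
    ‖fouCurve a B s - fouCurve a B t‖ ≤ 2 * √(2 * κ) * |s - t| ^ H := by
  rw [fouCurve, fouCurve, ← integral_sub (hB.integrableOn_kernel ha s) (hB.integrableOn_kernel ha t)]
  have h1 : 2 * √(2 * κ) * |s - t| ^ H = ∫ v in Set.Ioi (0 : ℝ),
      a * Real.exp (-(a * v)) * (2 * √(2 * κ) * |s - t| ^ H) := by
    rw [integral_mul_const, integral_exp_mul ha, one_mul]
  rw [h1]
  refine norm_integral_le_of_norm_le ((integrableOn_exp_mul ha).mul_const _)
    (Eventually.of_forall fun v => ?_)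
  rw [← smul_sub, norm_smul, Real.norm_of_nonneg (by positivity)]
  refine mul_le_mul_of_nonneg_left ?_ (by positivity)
  rw [sub_sub_sub_comm]
  refine (norm_sub_le _ _).trans (le_of_eq ?_)
  rw [hB.norm_sub, hB.norm_sub, sub_sub_sub_cancel_right]
  ring

/-- Interpolation of the two bounds on the increments. -/
theorem IsFBmCurve.norm_fouCurve_sub_le_rpow (hB : IsFBmCurve κ H B) (ha : 0 < a) {γ : ℝ}
    (hγ : 0 ≤ γ) (hγH : γ ≤ H) (s t : ℝ) :
    ‖fouCurve a B s - fouCurve a B t‖ ≤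
      2 * √(2 * κ) * (1 + Real.Gamma (H + 1)) * a ^ (γ - H) * |s - t| ^ γ := by
  have hG : 0 < Real.Gamma (H + 1) := Real.Gamma_pos_of_pos (by have := hB.hurst_pos; linarith)
  set r := |s - t| with hr
  have hr0 : 0 ≤ r := abs_nonneg _
  have ha' : a ^ (γ - H) = a ^ (-H) * a ^ γ := by rw [← Real.rpow_add ha]; congr 1; ring
  have hmain : ∀ c : ℝ, 0 ≤ c → c ≤ 1 + Real.Gamma (H + 1) → ∀ x : ℝ, x ≤ 2 * √(2 * κ) * c *
      (a ^ (-H) * (a * r) ^ γ) →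
      x ≤ 2 * √(2 * κ) * (1 + Real.Gamma (H + 1)) * a ^ (γ - H) * r ^ γ := by
    intro c hc hc' x hx
    refine hx.trans ?_
    rw [ha', Real.mul_rpow ha.le hr0, mul_assoc (2 * √(2 * κ) * (1 + Real.Gamma (H + 1))), mul_assoc (a ^ (-H))]
    gcongr
  -- At times short compared with `1/a` the Hölder bound is the better one, at long times the bound
  -- on the size. Either way the result is at most a constant times `a^{-H} (a r)^γ`.
  rcases le_total (a * r) 1 with h | h
  · refine hmain 1 zero_le_one (by linarith) _ ((hB.norm_fouCurve_sub_le ha s t).trans ?_)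
    rw [mul_one]
    refine mul_le_mul_of_nonneg_left ?_ (by positivity)
    have h2 : r ^ H = a ^ (-H) * (a * r) ^ H := by
      rw [Real.mul_rpow ha.le hr0, ← mul_assoc, ← Real.rpow_add ha]; simp
    rw [← hr, h2]
    refine mul_le_mul_of_nonneg_left ?_ (by positivity)
    rcases eq_or_lt_of_le (show 0 ≤ a * r by positivity) with h0 | h0
    · rw [← h0, Real.zero_rpow hB.hurst_pos.ne']
      positivity
    · exact Real.rpow_le_rpow_of_exponent_ge h0 h hγH
  · refine hmain (Real.Gamma (H + 1)) hG.le (by linarith) _ ((norm_sub_le _ _).trans ?_)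
    have h1 := hB.norm_fouCurve_le ha s
    have h2 := hB.norm_fouCurve_le ha t
    have h3 : (1 : ℝ) ≤ (a * r) ^ γ := Real.one_le_rpow h hγ
    have h4 : √(2 * κ) * Real.Gamma (H + 1) * a ^ (-H) ≤
        √(2 * κ) * Real.Gamma (H + 1) * (a ^ (-H) * (a * r) ^ γ) := by
      refine mul_le_mul_of_nonneg_left ?_ (by positivity)
      exact le_mul_of_one_le_right (by positivity) h3
    linarith

variable [CompleteSpace E]

theorem IsFBmCurve.inner_fouCurve (hB : IsFBmCurve κ H B) (ha : 0 < a) (x : E) (t : ℝ) :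
    inner ℝ x (fouCurve a B t) =
      ∫ v in Set.Ioi (0 : ℝ), a * Real.exp (-(a * v)) * inner ℝ x (B t - B (t - v)) := by
  rw [fouCurve, ← integral_inner (hB.integrableOn_kernel ha t)]
  simp only [inner_smul_right]

/-- A closed subspace is its own double orthogonal complement, so membership can be tested by inner
products, which pass under the integral. -/
theorem IsFBmCurve.fouCurve_mem (hB : IsFBmCurve κ H B) (ha : 0 < a) {V : Submodule ℝ E}
    (hV : IsClosed (V : Set E)) (h : ∀ t, B t ∈ V) (t : ℝ) : fouCurve a B t ∈ V := by
  have : CompleteSpace V := hV.completeSpace_coe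
  rw [← V.orthogonal_orthogonal, Submodule.mem_orthogonal]
  intro x hx
  rw [hB.inner_fouCurve ha]
  refine (integral_congr_ae (Eventually.of_forall fun v => ?_)).trans (integral_zero _ _)
  rw [(Submodule.mem_orthogonal' V x).1 hx _ (V.sub_mem (h _) (h _)), mul_zero]

theorem IsFBmCurve.inner_fouCurve_eq_zero (hB : IsFBmCurve κ H B) (ha : 0 < a) {x : E}
    (h : ∀ t, inner ℝ x (B t) = 0) (t : ℝ) : inner ℝ x (fouCurve a B t) = 0 := by
  rw [hB.inner_fouCurve ha]
  simp [inner_sub_right, h]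

/-- Inner products of increments of `B` depend only on time differences, and this passes through
both integrals. -/
theorem IsFBmCurve.inner_fouCurve_shift (hB : IsFBmCurve κ H B) (ha : 0 < a) (s t r : ℝ) :
    inner ℝ (fouCurve a B (s + r)) (fouCurve a B (t + r)) =
      inner ℝ (fouCurve a B s) (fouCurve a B t) := by
  have h1 : ∀ x y w r : ℝ, inner ℝ (B (x + r) - B (x + r - w)) (fouCurve a B (y + r)) =
      inner ℝ (B x - B (x - w)) (fouCurve a B y) := by
    intro x y w r
    rw [hB.inner_fouCurve ha, hB.inner_fouCurve ha]
    refine integral_congr_ae (Eventually.of_forall fun v => ?_)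
    simp only [hB.inner_sub]
    ring_nf
  rw [hB.inner_fouCurve ha, hB.inner_fouCurve ha]
  refine integral_congr_ae (Eventually.of_forall fun v => ?_)
  simp only
  rw [real_inner_comm, h1, real_inner_comm]

/-- Factor out `t^p` and expand `(1 + x)^p` to first order at `x = 0`. Constant and linear terms
cancel in the mixed second difference, and the remainder is `O(t^{p-2})`. -/
theorem tendsto_rpow_second_difference {p : ℝ} (hp : p < 2) (v w : ℝ) :
    Tendsto (fun t : ℝ => |t + w| ^ p + |t - v| ^ p - |t| ^ p - |t - v + w| ^ p) atTop (𝓝 0) := by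
  obtain ⟨q, hq⟩ : AnalyticAt ℝ (fun x : ℝ => (1 + x) ^ p) 0 :=
    ⟨_, Real.one_add_rpow_hasFPowerSeriesAt_zero⟩
  set h : ℝ → ℝ := fun y => (1 + y) ^ p - q.partialSum 2 y with hh
  have hO : h =O[𝓝 0] fun y => ‖y‖ ^ 2 := by simpa using hq.isBigO_sub_partialSum_pow 2
  have hlim : ∀ w : ℝ, Tendsto (fun t : ℝ => t ^ p * h (t⁻¹ * w)) atTop (𝓝 0) := by
    intro w
    have h1 : Tendsto (fun t : ℝ => t⁻¹ * w) atTop (𝓝 0) := by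
      simpa using tendsto_inv_atTop_zero.mul_const w
    have h2 := (Asymptotics.isBigO_refl (fun t : ℝ => t ^ p) atTop).mul (hO.comp_tendsto h1)
    refine h2.trans_tendsto ?_
    have h3 : Tendsto (fun t : ℝ => t ^ (-(2 - p)) * |w| ^ 2) atTop (𝓝 0) := by
      have h4 := (tendsto_rpow_neg_atTop (sub_pos.2 hp)).mul_const (|w| ^ 2)
      rwa [zero_mul] at h4
    refine h3.congr' ?_
    filter_upwards [eventually_gt_atTop 0] with t ht
    rw [show -(2 - p) = p + (-2 : ℝ) by ring, Real.rpow_add ht, Real.rpow_neg ht.le, Real.rpow_two]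
    simp only [Function.comp, norm_mul, norm_inv, Real.norm_eq_abs, abs_of_pos ht, mul_pow, inv_pow]
    ring
  -- The offsets satisfy `w + (-v) = 0 + (w - v)`, which is the cancellation of the linear terms.
  have hsum := ((hlim w).add (hlim (-v))).sub ((hlim 0).add (hlim (w - v)))
  simp only [add_zero, sub_zero] at hsum
  refine hsum.congr' ?_
  filter_upwards [eventually_gt_atTop 0, eventually_gt_atTop v, eventually_gt_atTop (-w),
    eventually_gt_atTop (v - w)] with t h0 h1 h2 h3
  have hx : ∀ x : ℝ, 0 < t + x → t ^ p * h (t⁻¹ * x) = |t + x| ^ p - t ^ p * q.coeff 0 -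
      t ^ p * (t⁻¹ * x * q.coeff 1) := by
    intro x hx
    have e : |t + x| ^ p = t ^ p * (1 + t⁻¹ * x) ^ p := by
      have e1 : t + x = t * (1 + t⁻¹ * x) := by field_simp
      have e2 : 0 < 1 + t⁻¹ * x := by
        rw [e1] at hx; exact pos_of_mul_pos_right hx h0.le
      rw [abs_of_pos hx, e1, Real.mul_rpow h0.le e2.le]
    rw [e, hh]
    simp [FormalMultilinearSeries.partialSum, Finset.sum_range_succ]
    ring
  rw [hx w (by linarith), hx (-v) (by linarith), hx 0 (by linarith), hx (w - v) (by linarith)]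
  rw [show t + -v = t - v by ring, show t + (w - v) = t - v + w by ring, add_zero]
  ring

/-- Distant increments of fractional Brownian motion decorrelate because `2H < 2`. Dominated
convergence, applied once for each of the two kernel integrals, carries this over to the
Ornstein-Uhlenbeck curve. -/
theorem IsFBmCurve.tendsto_inner_fouCurve (hB : IsFBmCurve κ H B) (ha : 0 < a) :
    Tendsto (fun t => inner ℝ (fouCurve a B t) (fouCurve a B 0)) atTop (𝓝 0) := by
  have h0 : ∀ v w : ℝ, Tendsto (fun t => inner ℝ (B 0 - B (0 - w)) (B t - B (t - v)))
      atTop (𝓝 0) := by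
    intro v w
    have h := (tendsto_rpow_second_difference (p := 2 * H)
      (by have := hB.hurst_lt_one; linarith) v w).const_mul κ
    rw [mul_zero] at h
    refine h.congr fun t => ?_
    rw [real_inner_comm, hB.inner_sub]
    rw [show t - (0 - w) = t + w by ring, show t - v - (0 - w) = t - v + w by ring, sub_zero,
      sub_zero]
  have h1 : ∀ w : ℝ, Tendsto (fun t => inner ℝ (B 0 - B (0 - w)) (fouCurve a B t))
      atTop (𝓝 0) := by
    intro w
    simp only [hB.inner_fouCurve ha]
    rw [show 𝓝 (0 : ℝ) = 𝓝 (∫ v in Set.Ioi (0 : ℝ), (0 : ℝ)) by simp]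
    refine tendsto_integral_filter_of_dominated_convergence
      (fun v => √(2 * κ) * (a * Real.exp (-(a * v)) * v ^ H) * ‖B 0 - B (0 - w)‖)
      (Eventually.of_forall fun t => ?_) (Eventually.of_forall fun t => ?_)
      (((integrableOn_exp_rpow ha hB.hurst_pos).const_mul √(2 * κ)).mul_const _)
      (Eventually.of_forall fun v => ?_)
    · have := hB.continuous
      exact Continuous.aestronglyMeasurable (by fun_prop)
    · refine (ae_restrict_mem measurableSet_Ioi).mono fun v hv => ?_
      rw [← inner_smul_right]
      refine (norm_inner_le_norm _ _).trans ?_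
      rw [mul_comm]
      gcongr
      exact hB.norm_kernel_le ha t hv
    · simpa using (h0 v w).const_mul (a * Real.exp (-(a * v)))
  simp only [hB.inner_fouCurve ha]
  rw [show 𝓝 (0 : ℝ) = 𝓝 (∫ v in Set.Ioi (0 : ℝ), (0 : ℝ)) by simp]
  refine tendsto_integral_filter_of_dominated_convergence
    (fun v => √(2 * κ) * (a * Real.exp (-(a * v)) * v ^ H) * (√(2 * κ) * Real.Gamma (H + 1) * a ^ (-H)))
    (Eventually.of_forall fun t => ?_) (Eventually.of_forall fun t => ?_)
    (((integrableOn_exp_rpow ha hB.hurst_pos).const_mul √(2 * κ)).mul_const _)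
    (Eventually.of_forall fun v => ?_)
  · have := hB.continuous
    exact Continuous.aestronglyMeasurable (by fun_prop)
  · refine (ae_restrict_mem measurableSet_Ioi).mono fun v hv => ?_
    rw [real_inner_comm, ← real_inner_smul_left]
    refine (norm_inner_le_norm _ _).trans ?_
    have hv : (0 : ℝ) < v := hv
    gcongr
    · exact hB.norm_kernel_le ha 0 hv
    · exact hB.norm_fouCurve_le ha t
  · have := (h1 v).const_mul (a * Real.exp (-(a * v)))
    rw [mul_zero] at this
    refine this.congr fun t => ?_
    rw [real_inner_comm]

theorem setIntegral_Ioi_sub_left (f : ℝ → E) (t : ℝ) :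
    ∫ v in Set.Ioi (0 : ℝ), f (t - v) = ∫ u in Set.Iic t, f u := by
  have h := (Measure.measurePreserving_sub_left volume t).setIntegral_preimage_emb
    (MeasurableEquiv.subLeft t).measurableEmbedding f (Set.Iio t)
  rw [integral_Iic_eq_integral_Iio, ← h]
  congr 2
  ext v
  simp

theorem integrableOn_Iic_of_sub_left {f : ℝ → E} {t : ℝ}
    (h : IntegrableOn (fun v => f (t - v)) (Set.Ioi 0)) : IntegrableOn f (Set.Iic t) := by
  rw [integrableOn_Iic_iff_integrableOn_Iio,
    ← (Measure.measurePreserving_sub_left volume t).integrableOn_comp_preimage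
    (MeasurableEquiv.subLeft t).measurableEmbedding]
  rw [show Set.Ioi (0 : ℝ) = (fun u => t - u) ⁻¹' Set.Iio t by ext; simp] at h
  exact h

/-- Variation of constants, with the stochastic integral over `[0, t]` integrated by parts: split
`∫_{-∞}^t` at 0 and use `B 0 = 0`. In this form the right hand side makes sense path by path. -/
theorem IsFBmCurve.fouCurve_eq (hB : IsFBmCurve κ H B) (ha : 0 < a) (t : ℝ) :
    fouCurve a B t = Real.exp (-(a * t)) • fouCurve a B 0 + B t -
      ∫ u in (0 : ℝ)..t, (a * Real.exp (-(a * (t - u)))) • B u := by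
  have hi : ∀ t, IntegrableOn (fun v : ℝ => (a * Real.exp (-(a * v))) • B (t - v))
      (Set.Ioi 0) := by
    intro t
    have h := ((integrableOn_exp_mul ha).smul_const (B t)).sub (hB.integrableOn_kernel ha t)
    refine IntegrableOn.congr_fun h (fun v _ => ?_) measurableSet_Ioi
    simp only [Pi.sub_apply, smul_sub, sub_sub_cancel]
  have hY : ∀ t, fouCurve a B t =
      B t - ∫ v in Set.Ioi (0 : ℝ), (a * Real.exp (-(a * v))) • B (t - v) := by
    intro t
    have h : ∫ v in Set.Ioi (0 : ℝ), (a * Real.exp (-(a * v))) • B t = B t := by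
      rw [integral_smul_const, integral_exp_mul ha, one_smul]
    conv_rhs => enter [1]; rw [← h]
    rw [← integral_sub ((integrableOn_exp_mul ha).smul_const (B t)) (hi t)]
    simp only [smul_sub, fouCurve]
  have hG : ∀ t, ∫ v in Set.Ioi (0 : ℝ), (a * Real.exp (-(a * v))) • B (t - v) =
      Real.exp (-(a * t)) • ∫ u in Set.Iic t, (a * Real.exp (a * u)) • B u := by
    intro t
    rw [← setIntegral_Ioi_sub_left, ← integral_smul]
    refine integral_congr_ae (Eventually.of_forall fun v => ?_)
    simp only [smul_smul]
    rw [mul_left_comm, ← Real.exp_add]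
    congr 3
    ring
  have hI : ∀ t, IntegrableOn (fun u : ℝ => (a * Real.exp (a * u)) • B u) (Set.Iic t) := by
    intro t
    refine integrableOn_Iic_of_sub_left (IntegrableOn.congr_fun ((hi t).smul (Real.exp (a * t)))
      (fun v _ => ?_) measurableSet_Ioi)
    simp only [Pi.smul_apply, smul_smul]
    rw [mul_left_comm, ← Real.exp_add]
    congr 3
    ring
  rw [hY t, hY 0, hG t, hG 0, hB.zero, mul_zero, neg_zero, Real.exp_zero, one_smul, zero_sub,
    ← sub_add_cancel (∫ u in Set.Iic t, (a * Real.exp (a * u)) • B u)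
      (∫ u in Set.Iic 0, (a * Real.exp (a * u)) • B u),
    intervalIntegral.integral_Iic_sub_Iic (hI 0) (hI t), smul_add, smul_neg,
    ← intervalIntegral.integral_smul]
  have : ∀ u, Real.exp (-(a * t)) • (a * Real.exp (a * u)) • B u =
      (a * Real.exp (-(a * (t - u)))) • B u := by
    intro u
    rw [smul_smul, mul_left_comm, ← Real.exp_add]
    congr 3
    ring
  simp only [this]
  abel

end FOU

/-! ### The Gaussian Hilbert space of the noise -/

section GaussianSpace

variable {W : Type*} [MeasurableSpace W] {μ : Measure W} [IsProbabilityMeasure μ]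

theorem norm_cexp_sub_le (x y : ℝ) :
    ‖Complex.exp (x * Complex.I) - Complex.exp (y * Complex.I)‖ ≤ |x - y| := by
  have h : Complex.exp (x * Complex.I) - Complex.exp (y * Complex.I) =
      Complex.exp (y * Complex.I) * (Complex.exp (Complex.I * (x - y : ℝ)) - 1) := by
    rw [mul_sub, ← Complex.exp_add, mul_one]
    congr 2
    push_cast
    ring
  rw [h, norm_mul, Complex.norm_exp_ofReal_mul_I, one_mul]
  exact Real.norm_exp_I_mul_ofReal_sub_one_le

theorem L2_integrable (X : Lp ℝ 2 μ) : Integrable X μ :=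
  (Lp.memLp X).integrable one_le_two

theorem L2_norm_sq (X : Lp ℝ 2 μ) : ‖X‖ ^ 2 = ∫ ω, X ω ^ 2 ∂μ := by
  rw [← real_inner_self_eq_norm_sq, L2.inner_def]
  refine integral_congr_ae (Eventually.of_forall fun ω => ?_)
  simp [sq]

theorem integral_abs_le_norm (X : Lp ℝ 2 μ) : ∫ ω, |X ω| ∂μ ≤ ‖X‖ := by
  refine abs_le_of_sq_le_sq' ?_ (norm_nonneg _) |>.2
  rw [L2_norm_sq]
  have h := variance_nonneg (fun ω => |X ω|) μ
  rw [variance_eq_sub (X := fun ω => |X ω|) (Lp.memLp X).abs] at h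
  simpa using h

/-- The characteristic function of a square integrable random variable at `1`. -/
def gaussChar (X : Lp ℝ 2 μ) : ℂ := ∫ ω, Complex.exp (X ω * Complex.I) ∂μ

theorem integrable_cexp {X : W → ℝ} (hX : AEStronglyMeasurable X μ) :
    Integrable (fun ω => Complex.exp (X ω * Complex.I)) μ := by
  refine Integrable.of_bound (C := 1) ?_ (Eventually.of_forall fun ω => ?_)
  · exact Complex.continuous_exp.comp_aestronglyMeasurable
      ((Complex.continuous_ofReal.comp_aestronglyMeasurable hX).mul_const _)
  · rw [Complex.norm_exp_ofReal_mul_I]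

theorem norm_gaussChar_sub_le (X Y : Lp ℝ 2 μ) : ‖gaussChar X - gaussChar Y‖ ≤ ‖X - Y‖ := by
  rw [gaussChar, gaussChar, ← integral_sub (integrable_cexp (Lp.aestronglyMeasurable X))
    (integrable_cexp (Lp.aestronglyMeasurable Y))]
  refine (norm_integral_le_of_norm_le (L2_integrable (X - Y)).abs ?_).trans
    (integral_abs_le_norm _)
  filter_upwards [Lp.coeFn_sub X Y] with ω h
  rw [h]
  exact norm_cexp_sub_le _ _

theorem continuous_gaussChar : Continuous (gaussChar (μ := μ)) :=
  LipschitzWith.continuous (K := 1) (LipschitzWith.of_dist_le_mul fun X Y => by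
    simpa [dist_eq_norm] using norm_gaussChar_sub_le X Y)

theorem gaussChar_eq_of_hasGaussianLaw {X : Lp ℝ 2 μ} (hX : HasGaussianLaw X μ)
    (h0 : ∫ ω, X ω ∂μ = 0) : gaussChar X = Complex.exp (-(‖X‖ ^ 2 / 2 : ℝ)) := by
  have h := hX.charFun_map_eq 1
  rw [charFun_apply, integral_map hX.aemeasurable (by fun_prop)] at h
  have h1 : (fun ω => inner ℝ (1 : ℝ) (X ω)) = X := by ext ω; simp
  rw [h1, h0, variance_of_integral_eq_zero hX.aemeasurable h0] at h
  rw [gaussChar]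
  simpa [← L2_norm_sq, neg_div] using h

/-- Both sides are continuous in `X`, the left one because `gaussChar` is Lipschitz for the `L²`
norm. -/
theorem gaussChar_of_mem_closure {V : Submodule ℝ (Lp ℝ 2 μ)}
    (h : ∀ X ∈ V, gaussChar X = Complex.exp (-(‖X‖ ^ 2 / 2 : ℝ))) {X : Lp ℝ 2 μ}
    (hX : X ∈ V.topologicalClosure) : gaussChar X = Complex.exp (-(‖X‖ ^ 2 / 2 : ℝ)) := by
  have hc : IsClosed {X : Lp ℝ 2 μ | gaussChar X = Complex.exp (-(‖X‖ ^ 2 / 2 : ℝ))} :=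
    isClosed_eq continuous_gaussChar (by fun_prop)
  exact closure_minimal h hc hX

variable {H : ℝ} {β : Mode → ℝ → W → ℂ}

/-- The real (`true`) and imaginary (`false`) parts of the coefficients of the noise. -/
def noisePart (β : Mode → ℝ → W → ℂ) (p : Mode × Bool) (t : ℝ) (ω : W) : ℝ :=
  if p.2 then (β p.1 t ω).re else (β p.1 t ω).im

theorem IsNoise.isFBm (hβ : IsNoise μ H β) (p : Mode × Bool) :
    IsFBm μ H (fun t ω => √2 * noisePart β p t ω) := by
  obtain ⟨k, _ | _⟩ := p
  · exact hβ.im_isFBm k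
  · exact hβ.re_isFBm k

theorem IsNoise.noisePart_eq (p : Mode × Bool) (t : ℝ) :
    noisePart β p t = fun ω => (√2)⁻¹ * (√2 * noisePart β p t ω) := by
  ext ω
  field_simp

theorem IsNoise.measurable_noisePart (hβ : IsNoise μ H β) (p : Mode × Bool) (t : ℝ) :
    Measurable (noisePart β p t) := by
  rw [IsNoise.noisePart_eq]
  exact ((hβ.isFBm p).measurable t).const_mul _

theorem IsNoise.gaussian_noisePart (hβ : IsNoise μ H β) (p : Mode × Bool) (c : ℝ → ℝ) :
    IsGaussianProcess (fun t ω => c t * noisePart β p t ω) μ := by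
  have h := (hβ.isFBm p).gaussian.smul (fun t => c t * (√2)⁻¹)
  refine h.congr fun t => Eventually.of_forall fun ω => ?_
  simp only [smul_eq_mul]
  field_simp

theorem IsNoise.memLp_noisePart (hβ : IsNoise μ H β) (p : Mode × Bool) (t : ℝ) :
    MemLp (noisePart β p t) 2 μ := by
  have h := ((hβ.gaussian_noisePart p fun _ => 1).hasGaussianLaw_eval t).memLp_two
  simpa using h

theorem IsNoise.integral_noisePart (hβ : IsNoise μ H β) (p : Mode × Bool) (t : ℝ) :
    ∫ ω, noisePart β p t ω ∂μ = 0 := by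
  rw [IsNoise.noisePart_eq, integral_const_mul, (hβ.isFBm p).mean, mul_zero]

/-- The real and imaginary parts of the noise coefficients as curves in `L²`. -/
def IsNoise.curve (hβ : IsNoise μ H β) (p : Mode × Bool) (t : ℝ) : Lp ℝ 2 μ :=
  (hβ.memLp_noisePart p t).toLp

theorem IsNoise.coeFn_curve (hβ : IsNoise μ H β) (p : Mode × Bool) (t : ℝ) :
    hβ.curve p t =ᵐ[μ] noisePart β p t := (hβ.memLp_noisePart p t).coeFn_toLp

theorem IsNoise.inner_curve (hβ : IsNoise μ H β) (p q : Mode × Bool) (s t : ℝ) :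
    inner ℝ (hβ.curve p s) (hβ.curve q t) = ∫ ω, noisePart β p s ω * noisePart β q t ω ∂μ := by
  rw [L2.inner_def]
  refine integral_congr_ae ?_
  filter_upwards [hβ.coeFn_curve p s, hβ.coeFn_curve q t] with ω h1 h2
  simp [h1, h2, mul_comm]

/-- The real and imaginary parts are `2^{-1/2}` times normalized motions, so the factor `1/2` in the
covariance is halved once more. -/
theorem IsNoise.isFBmCurve (hβ : IsNoise μ H β) (hH : 0 < H ∧ H < 1) (p : Mode × Bool) :
    IsFBmCurve (1 / 4) H (hβ.curve p) where
  kappa_nonneg := by norm_num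
  hurst_pos := hH.1
  hurst_lt_one := hH.2
  inner_eq s t := by
    have h := (hβ.isFBm p).cov t s
    have h2 : ∀ ω, √2 * noisePart β p s ω * (√2 * noisePart β p t ω) =
        2 * (noisePart β p s ω * noisePart β p t ω) := fun ω => by
      rw [mul_mul_mul_comm, Real.mul_self_sqrt zero_le_two]
    simp only [h2, integral_const_mul] at h
    rw [hβ.inner_curve]
    linarith

theorem IsNoise.inner_curve_eq_zero_of_indepFun (hβ : IsNoise μ H β) {p q : Mode × Bool} {s t : ℝ}
    (h : IndepFun (noisePart β p s) (noisePart β q t) μ) :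
    inner ℝ (hβ.curve p s) (hβ.curve q t) = 0 := by
  rw [hβ.inner_curve, h.integral_fun_mul_eq_mul_integral
    (hβ.measurable_noisePart p s).aestronglyMeasurable
    (hβ.measurable_noisePart q t).aestronglyMeasurable, hβ.integral_noisePart, zero_mul]

theorem IsNoise.inner_re_im (hβ : IsNoise μ H β) (k : Mode) (s t : ℝ) :
    inner ℝ (hβ.curve (k, true) s) (hβ.curve (k, false) t) = 0 := by
  apply hβ.inner_curve_eq_zero_of_indepFun
  exact (hβ.indep_re_im k).comp (measurable_pi_apply s) (measurable_pi_apply t)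

theorem measurable_noise_functional (b : Bool) (t : ℝ) :
    Measurable fun f : ℝ → ℂ => if b then (f t).re else (f t).im := by
  cases b
  · simpa using! Complex.measurable_im.comp (measurable_pi_apply t)
  · simpa using! Complex.measurable_re.comp (measurable_pi_apply t)

theorem Mode.neg_ne (k : Mode) : -k ≠ k := by
  intro h
  apply k.2
  have h1 : -k.1 = k.1 := congrArg Subtype.val h
  funext i
  have h2 := congrFun h1 i
  simp only [Pi.neg_apply, Pi.zero_apply] at h2 ⊢
  omega

@[simp] theorem Mode.neg_neg (k : Mode) : - -k = k := Subtype.ext (_root_.neg_neg k.1)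

theorem IsNoise.inner_curve_eq_zero (hβ : IsNoise μ H β) {k l : Mode} (h1 : k ≠ l) (h2 : k ≠ -l)
    (b c : Bool) (s t : ℝ) : inner ℝ (hβ.curve (k, b) s) (hβ.curve (l, c) t) = 0 := by
  apply hβ.inner_curve_eq_zero_of_indepFun
  have hS : ∀ j ∈ ({k, l} : Set Mode), -j ∉ ({k, l} : Set Mode) := by
    rintro j (rfl | rfl) (h | h)
    · exact Mode.neg_ne _ h
    · exact h2 (by rw [← h, Mode.neg_neg])
    · exact h2 h.symm
    · exact Mode.neg_ne _ h
  have h := (hβ.indep _ hS).indepFun (i := ⟨k, by simp⟩) (j := ⟨l, by simp⟩)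
    (by simpa using h1)
  exact h.comp (measurable_noise_functional b s) (measurable_noise_functional c t)

theorem IsNoise.curve_neg_re (hβ : IsNoise μ H β) (k : Mode) (t : ℝ) :
    hβ.curve (-k, true) t = hβ.curve (k, true) t := by
  apply Lp.ext
  filter_upwards [hβ.conj k, hβ.coeFn_curve (-k, true) t, hβ.coeFn_curve (k, true) t]
    with ω h h1 h2
  rw [h1, h2]
  simp [noisePart, h t]

theorem IsNoise.curve_neg_im (hβ : IsNoise μ H β) (k : Mode) (t : ℝ) :
    hβ.curve (-k, false) t = -hβ.curve (k, false) t := by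
  apply Lp.ext
  filter_upwards [hβ.conj k, hβ.coeFn_curve (-k, false) t, hβ.coeFn_curve (k, false) t,
    Lp.coeFn_neg (hβ.curve (k, false) t)] with ω h h1 h2 h3
  rw [h1, h3, Pi.neg_apply, h2]
  simp [noisePart, h t]

/-- A set of modes that contains exactly one of `k` and `-k`. -/
def halfLattice : Set Mode := {k | 0 < k.1 0 ∨ (k.1 0 = 0 ∧ 0 < k.1 1)}

theorem neg_notMem_halfLattice (k : Mode) (hk : k ∈ halfLattice) : -k ∉ halfLattice := by
  intro h
  have e : ∀ i, (-k).1 i = -k.1 i := fun i => rfl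
  simp only [halfLattice, Set.mem_ofPred_eq, e] at h hk
  omega

theorem mem_halfLattice_or (k : Mode) : k ∈ halfLattice ∨ -k ∈ halfLattice := by
  have e : ∀ i, (-k).1 i = -k.1 i := fun i => rfl
  simp only [halfLattice, Set.mem_ofPred_eq, e]
  by_contra! h
  apply k.2
  have h0 : k.1 0 = 0 := by omega
  have h1 : k.1 1 = 0 := by omega
  funext i
  fin_cases i
  · exact h0
  · exact h1

/-- The closed linear span of the noise in `L²`. -/
def IsNoise.space (hβ : IsNoise μ H β) : Submodule ℝ (Lp ℝ 2 μ) :=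
  (Submodule.span ℝ (Set.range fun q : (halfLattice × ℝ) × Bool =>
    hβ.curve (q.1.1, q.2) q.1.2)).topologicalClosure

theorem IsNoise.isClosed_space (hβ : IsNoise μ H β) : IsClosed (hβ.space : Set (Lp ℝ 2 μ)) :=
  Submodule.isClosed_topologicalClosure _

theorem IsNoise.curve_mem_space (hβ : IsNoise μ H β) (p : Mode × Bool) (t : ℝ) :
    hβ.curve p t ∈ hβ.space := by
  have h : ∀ k ∈ halfLattice, ∀ b, hβ.curve (k, b) t ∈ hβ.space := fun k hk b =>
    Submodule.le_topologicalClosure _ (Submodule.subset_span ⟨((⟨k, hk⟩, t), b), rfl⟩)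
  obtain ⟨k, b⟩ := p
  rcases mem_halfLattice_or k with hk | hk
  · exact h k hk b
  · cases b
    · rw [← Mode.neg_neg k, hβ.curve_neg_im]
      exact hβ.space.neg_mem (h _ hk _)
    · rw [← Mode.neg_neg k, hβ.curve_neg_re]
      exact h _ hk _

/-- The noise is assumed Gaussian only one real component at a time. Joint Gaussianity comes from
independence: of the real and imaginary parts within a mode, and of the modes in a half lattice. -/
theorem IsNoise.hasGaussianLaw_sum (hβ : IsNoise μ H β) (T : Finset halfLattice) (T' : Finset ℝ)
    (c : (halfLattice × ℝ) × Bool → ℝ) :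
    HasGaussianLaw (fun ω => ∑ k ∈ T, ∑ t ∈ T', ∑ b : Bool,
      c ((k, t), b) * noisePart β (k, b) t ω) μ := by
  have h1 : ∀ k : halfLattice, HasGaussianLaw (fun ω => ∑ t ∈ T', ∑ b : Bool,
      c ((k, t), b) * noisePart β (k, b) t ω) μ := by
    intro k
    have hi : IndepFun (fun ω => ∑ t ∈ T', c ((k, t), true) * noisePart β (k, true) t ω)
        (fun ω => ∑ t ∈ T', c ((k, t), false) * noisePart β (k, false) t ω) μ :=
      (hβ.indep_re_im k).comp
        (φ := fun f : ℝ → ℝ => ∑ t ∈ T', c ((k, t), true) * f t)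
        (ψ := fun f : ℝ → ℝ => ∑ t ∈ T', c ((k, t), false) * f t)
        (by fun_prop) (by fun_prop)
    have h := (hi.hasGaussianLaw
      ((hβ.gaussian_noisePart (k, true) fun t => c ((k, t), true)).hasGaussianLaw_fun_sum)
      ((hβ.gaussian_noisePart (k, false) fun t => c ((k, t), false)).hasGaussianLaw_fun_sum)).fun_add
    simpa [Finset.sum_add_distrib] using h
  have h2 : iIndepFun (fun (k : halfLattice) ω => ∑ t ∈ T', ∑ b : Bool,
      c ((k, t), b) * noisePart β (k, b) t ω) μ := by
    refine (hβ.indep halfLattice neg_notMem_halfLattice).comp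
      (fun k (f : ℝ → ℂ) => ∑ t ∈ T', ∑ b : Bool, c ((k, t), b) * (if b then (f t).re else (f t).im))
      fun k => ?_
    refine Finset.measurable_fun_sum _ fun t _ => Finset.measurable_fun_sum _ fun b _ => ?_
    exact (measurable_noise_functional b t).const_mul _
  have h3 := iIndepFun.hasGaussianLaw_fun_sum (fun k : T => h1 k)
    (h2.precomp (g := fun k : T => (k : halfLattice)) Subtype.val_injective)
  refine h3.congr (Eventually.of_forall fun ω => ?_)
  exact Finset.sum_coe_sort T fun k => ∑ t ∈ T', ∑ b : Bool, c ((k, t), b) * noisePart β (k, b) t ω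

/-- Finite linear combinations of the noise are centred Gaussian, and the formula survives limits in
`L²`. From here on laws are computed from norms alone. -/
theorem IsNoise.gaussChar_of_mem_space (hβ : IsNoise μ H β) {X : Lp ℝ 2 μ} (hX : X ∈ hβ.space) :
    gaussChar X = Complex.exp (-(‖X‖ ^ 2 / 2 : ℝ)) := by
  classical
  refine gaussChar_of_mem_closure (fun X hX => ?_) hX
  obtain ⟨c, rfl⟩ := Finsupp.mem_span_range_iff_exists_finsupp.1 hX
  -- The support of the combination is enlarged to a full product of modes, times and parts, so that
  -- the sum can be iterated.
  set T := (c.support.image Prod.fst).image Prod.fst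
  set T' := (c.support.image Prod.fst).image Prod.snd
  have e1 : (c.sum fun i a => a • hβ.curve (i.1.1, i.2) i.1.2) =
      ∑ i ∈ (T ×ˢ T') ×ˢ Finset.univ, c i • hβ.curve (i.1.1, i.2) i.1.2 := by
    refine Finsupp.sum_of_support_subset _ (fun i hi => ?_) _ (by simp)
    simp only [T, T', Finset.mem_product, Finset.mem_univ, and_true]
    exact ⟨Finset.mem_image_of_mem _ (Finset.mem_image_of_mem _ hi),
      Finset.mem_image_of_mem _ (Finset.mem_image_of_mem _ hi)⟩
  rw [e1]
  have e2 : (∑ i ∈ (T ×ˢ T') ×ˢ Finset.univ, c i • hβ.curve (i.1.1, i.2) i.1.2 : Lp ℝ 2 μ) =ᵐ[μ]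
      fun ω => ∑ k ∈ T, ∑ t ∈ T', ∑ b : Bool, c ((k, t), b) * noisePart β (k, b) t ω := by
    have h : ∀ᵐ ω ∂μ, ∀ i ∈ (T ×ˢ T') ×ˢ Finset.univ,
        (c i • hβ.curve (i.1.1, i.2) i.1.2 : Lp ℝ 2 μ) ω = c i * noisePart β (i.1.1, i.2) i.1.2 ω := by
      rw [Finset.eventually_all]
      intro i _
      filter_upwards [Lp.coeFn_smul (c i) (hβ.curve (i.1.1, i.2) i.1.2),
        hβ.coeFn_curve (i.1.1, i.2) i.1.2] with ω h1 h2
      simp [h1, h2]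
    filter_upwards [h, Lp.coeFn_fun_finsetSum ((T ×ˢ T') ×ˢ Finset.univ)
      fun i : (halfLattice × ℝ) × Bool => c i • hβ.curve (i.1.1, i.2) i.1.2] with ω h1 h2
    rw [h2, Finset.sum_congr rfl h1, Finset.sum_product, Finset.sum_product]
  refine gaussChar_eq_of_hasGaussianLaw ((hβ.hasGaussianLaw_sum T T' c).congr e2.symm) ?_
  have hi : ∀ p t, Integrable (noisePart β p t) μ := fun p t =>
    (hβ.memLp_noisePart p t).integrable one_le_two
  rw [integral_congr_ae e2, integral_finsetSum _ fun k _ => integrable_finsetSum _ fun t _ =>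
    integrable_finsetSum _ fun b _ => (hi _ _).const_mul _]
  refine Finset.sum_eq_zero fun k _ => ?_
  rw [integral_finsetSum _ fun t _ => integrable_finsetSum _ fun b _ => (hi _ _).const_mul _]
  refine Finset.sum_eq_zero fun t _ => ?_
  rw [integral_finsetSum _ fun b _ => (hi _ _).const_mul _]
  refine Finset.sum_eq_zero fun b _ => ?_
  rw [integral_const_mul, hβ.integral_noisePart, mul_zero]

theorem IsNoise.map_of_mem_space (hβ : IsNoise μ H β) {X : Lp ℝ 2 μ} (hX : X ∈ hβ.space) :
    μ.map X = gaussianReal 0 (‖X‖₊ ^ 2) := by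
  have := Measure.isProbabilityMeasure_map (μ := μ) (Lp.aestronglyMeasurable X).aemeasurable
  refine Measure.ext_of_charFun (funext fun t => ?_)
  rw [charFun_gaussianReal, charFun_apply, integral_map (Lp.aestronglyMeasurable X).aemeasurable
    (by fun_prop)]
  have h := hβ.gaussChar_of_mem_space (hβ.space.smul_mem t hX)
  rw [gaussChar, norm_smul] at h
  refine Eq.trans (integral_congr_ae ?_) (h.trans ?_)
  · filter_upwards [Lp.coeFn_smul t X] with ω h1
    rw [h1]
    simp [mul_comm]
  · congr 1
    push_cast
    simp only [mul_pow, Real.norm_eq_abs, mul_zero, zero_mul, zero_sub]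
    rw [← Complex.ofReal_pow |t|, sq_abs]
    push_cast
    ring

/-- Use `e^{|x|} ≤ e^x + e^{-x}` and the Gaussian moment generating function at `±1/s`, which is
`exp(‖X‖² / (2s²)) ≤ e^{1/2}`. -/
theorem IsNoise.lintegral_exp_abs_le (hβ : IsNoise μ H β) {X : Lp ℝ 2 μ} (hX : X ∈ hβ.space) {s : ℝ}
    (hs : 0 < s) (hXs : ‖X‖ ≤ s) :
    ∫⁻ ω, ENNReal.ofReal (Real.exp (|X ω| / s)) ∂μ ≤ ENNReal.ofReal (2 * Real.exp (1 / 2)) := by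
  have hm := (Lp.aestronglyMeasurable X).aemeasurable
  have h1 : ∀ t : ℝ, |t| ≤ 1 / s →
      ∫⁻ ω, ENNReal.ofReal (Real.exp (t * X ω)) ∂μ ≤ ENNReal.ofReal (Real.exp (1 / 2)) := by
    intro t ht
    have h := mgf_gaussianReal (hβ.map_of_mem_space hX) t
    have hi : Integrable (fun ω => Real.exp (t * X ω)) μ := by
      have := integrable_exp_mul_gaussianReal (μ := 0) (v := ‖X‖₊ ^ 2) t
      rw [← hβ.map_of_mem_space hX, integrable_map_measure (by fun_prop) hm] at this
      exact this
    rw [← ofReal_integral_eq_lintegral_ofReal hi (Eventually.of_forall fun ω => (Real.exp_pos _).le)]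
    rw [mgf] at h
    rw [h]
    refine ENNReal.ofReal_le_ofReal (Real.exp_le_exp.2 ?_)
    have h2 : ‖X‖ * |t| ≤ 1 := by
      calc ‖X‖ * |t| ≤ s * (1 / s) := by gcongr
        _ = 1 := by field_simp
    have h3 : (‖X‖ * |t|) ^ 2 ≤ 1 := pow_le_one₀ (by positivity) h2
    rw [mul_pow, sq_abs] at h3
    push_cast
    linarith
  calc ∫⁻ ω, ENNReal.ofReal (Real.exp (|X ω| / s)) ∂μ
      ≤ ∫⁻ ω, (ENNReal.ofReal (Real.exp (1 / s * X ω)) +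
          ENNReal.ofReal (Real.exp (-(1 / s) * X ω))) ∂μ := by
        refine lintegral_mono fun ω => ?_
        rcases abs_cases (X ω) with ⟨h, _⟩ | ⟨h, _⟩
        · refine le_trans (le_of_eq ?_) (le_self_add)
          rw [h]; congr 2; ring
        · refine le_trans (le_of_eq ?_) (le_add_self)
          rw [h]; congr 2; ring
    _ ≤ ENNReal.ofReal (Real.exp (1 / 2)) + ENNReal.ofReal (Real.exp (1 / 2)) := by
        rw [lintegral_add_left' (by fun_prop)]
        exact add_le_add (h1 _ (by rw [abs_of_pos (by positivity)]))
          (h1 _ (by rw [abs_neg, abs_of_pos (by positivity)]))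
    _ = _ := by rw [← ENNReal.ofReal_add (by positivity) (by positivity), two_mul]

end GaussianSpace

/-! ### Continuous versions of the stationary fractional Ornstein-Uhlenbeck processes -/

section Versions

variable {W : Type*} [MeasurableSpace W] {μ : Measure W} [IsProbabilityMeasure μ]

/-- The Bochner integral in `L²` and the pathwise integral have the same integral over every event,
by Fubini. This links the Hilbert space computations to actual sample paths. -/
theorem setIntegral_curve_ae_eq {b : ℝ → W → ℝ} {B : ℝ → Lp ℝ 2 μ} (hB : Continuous B)
    (hb : ∀ t, B t =ᵐ[μ] b t) (hbm : Measurable (Function.uncurry b)) {f : ℝ → ℝ}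
    (hf : Continuous f) (s t : ℝ) :
    (∫ u in Set.Ioc s t, f u • B u : Lp ℝ 2 μ) =ᵐ[μ] fun ω => ∫ u in Set.Ioc s t, f u * b u ω := by
  have hfB : Integrable (fun u => f u • B u) (volume.restrict (Set.Ioc s t)) :=
    ((hf.smul hB).integrableOn_Icc (a := s) (b := t)).mono_set Set.Ioc_subset_Icc_self
  have hF : Measurable fun q : ℝ × W => f q.1 * b q.1 q.2 :=
    (hf.measurable.comp measurable_fst).mul hbm
  have hbi : ∀ u, Integrable (b u) μ := fun u => (L2_integrable (B u)).congr (hb u)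
  have hFi : Integrable (fun q : ℝ × W => f q.1 * b q.1 q.2)
      ((volume.restrict (Set.Ioc s t)).prod μ) := by
    rw [integrable_prod_iff hF.aestronglyMeasurable]
    refine ⟨Eventually.of_forall fun u => (hbi u).const_mul (f u), ?_⟩
    refine hfB.norm.mono' hF.norm.aestronglyMeasurable.integral_prod_right'
      (Eventually.of_forall fun u => ?_)
    rw [Real.norm_of_nonneg (integral_nonneg fun _ => norm_nonneg _), norm_smul]
    simp only [norm_mul, integral_const_mul]
    refine mul_le_mul_of_nonneg_left ?_ (norm_nonneg _)
    refine (le_of_eq ?_).trans (integral_abs_le_norm (B u))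
    exact integral_congr_ae ((hb u).symm.fun_comp fun x => |x|)
  refine (L2_integrable _).ae_eq_of_forall_setIntegral_eq _ _ hFi.integral_prod_right
    fun A hA hA' => ?_
  rw [← L2.inner_indicatorConstLp_one (𝕜 := ℝ) hA hA'.ne, ← integral_inner hfB,
    integral_integral_swap]
  · refine integral_congr_ae (Eventually.of_forall fun u => ?_)
    simp only [inner_smul_right, L2.inner_indicatorConstLp_one, integral_const_mul]
    congr 1
    exact integral_congr_ae (ae_restrict_of_ae (hb u))
  · have h : (μ.restrict A).prod (volume.restrict (Set.Ioc s t)) =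
        (μ.prod (volume.restrict (Set.Ioc s t))).restrict (A ×ˢ Set.univ) := by
      rw [← Measure.prod_restrict, Measure.restrict_univ]
    rw [h]
    exact hFi.swap.restrict

theorem integral_curve_ae_eq {b : ℝ → W → ℝ} {B : ℝ → Lp ℝ 2 μ} (hB : Continuous B)
    (hb : ∀ t, B t =ᵐ[μ] b t) (hbm : Measurable (Function.uncurry b)) {f : ℝ → ℝ}
    (hf : Continuous f) (s t : ℝ) :
    (∫ u in s..t, f u • B u : Lp ℝ 2 μ) =ᵐ[μ] fun ω => ∫ u in s..t, f u * b u ω := by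
  simp only [intervalIntegral]
  filter_upwards [setIntegral_curve_ae_eq hB hb hbm hf s t,
    setIntegral_curve_ae_eq hB hb hbm hf t s,
    Lp.coeFn_sub (∫ u in Set.Ioc s t, f u • B u : Lp ℝ 2 μ) (∫ u in Set.Ioc t s, f u • B u)]
    with ω h1 h2 h3
  rw [h3, Pi.sub_apply, h1, h2]

/-- A version with continuous paths of a stationary fractional Ornstein-Uhlenbeck process. -/
structure IsFouVersion (a : ℝ) (b : ℝ → W → ℝ) (B : ℝ → Lp ℝ 2 μ) (y : ℝ → W → ℝ) : Prop where
  continuous : ∀ ω, Continuous fun t => y t ω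
  measurable : ∀ t, Measurable (y t)
  ae_eq : ∀ t, y t =ᵐ[μ] (fouCurve a B t : Lp ℝ 2 μ)
  equation : ∀ t ω, y t ω = Real.exp (-(a * t)) * y 0 ω + b t ω -
    ∫ u in (0 : ℝ)..t, a * Real.exp (-(a * (t - u))) * b u ω

/-- Take a measurable representative of `Y(0)` and define the process by the variation of constants
formula. Continuity is then automatic for every `ω`, and `IsFBmCurve.fouCurve_eq` identifies the
value at each time almost surely. -/
theorem exists_isFouVersion {κ H a : ℝ} (ha : 0 < a) {b : ℝ → W → ℝ} {B : ℝ → Lp ℝ 2 μ}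
    (hB : IsFBmCurve κ H B) (hb : ∀ t, B t =ᵐ[μ] b t) (hbm : ∀ t, Measurable (b t))
    (hbc : ∀ ω, Continuous fun t => b t ω) (hb0 : ∀ ω, b 0 ω = 0) :
    ∃ y, IsFouVersion a b B y := by
  have hbm' : Measurable (Function.uncurry b) :=
    measurable_uncurry_of_continuous_of_measurable hbc hbm
  obtain ⟨y0, hy0, hy0e⟩ : ∃ y0 : W → ℝ, Measurable y0 ∧ ∀ ω, (fouCurve a B 0 : Lp ℝ 2 μ) ω = y0 ω :=
    ⟨_, (Lp.stronglyMeasurable _).measurable, fun _ => rfl⟩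
  have h0 : ∀ ω, Real.exp (-(a * 0)) * y0 ω + b 0 ω -
      ∫ u in (0 : ℝ)..0, a * Real.exp (-(a * (0 - u))) * b u ω = y0 ω := by
    intro ω
    simp [hb0]
  refine ⟨fun t ω => Real.exp (-(a * t)) * y0 ω + b t ω -
    ∫ u in (0 : ℝ)..t, a * Real.exp (-(a * (t - u))) * b u ω, ?_, ?_, ?_, ?_⟩
  · intro ω
    have := hbc ω
    refine ((by fun_prop : Continuous fun t => Real.exp (-(a * t)) * y0 ω + b t ω)).sub ?_
    exact intervalIntegral.continuous_parametric_intervalIntegral_of_continuous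
      (f := fun t u => a * Real.exp (-(a * (t - u))) * b u ω) (by fun_prop) continuous_id
  · intro t
    refine ((hy0.const_mul _).add (hbm t)).sub ?_
    have hF : StronglyMeasurable fun q : W × ℝ => a * Real.exp (-(a * (t - q.2))) * b q.2 q.1 := by
      refine Measurable.stronglyMeasurable (Measurable.mul (by fun_prop) ?_)
      exact hbm'.comp measurable_swap
    simp only [intervalIntegral]
    exact (hF.integral_prod_right'.sub hF.integral_prod_right').measurable
  · intro t
    have hc : Continuous fun u => a * Real.exp (-(a * (t - u))) := by fun_prop
    rw [hB.fouCurve_eq ha t]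
    filter_upwards [integral_curve_ae_eq hB.continuous hb hbm' hc 0 t, hb t,
      Lp.coeFn_sub (Real.exp (-(a * t)) • fouCurve a B 0 + B t)
        (∫ u in (0 : ℝ)..t, (a * Real.exp (-(a * (t - u)))) • B u),
      Lp.coeFn_add (Real.exp (-(a * t)) • fouCurve a B 0) (B t),
      Lp.coeFn_smul (Real.exp (-(a * t))) (fouCurve a B 0)] with ω h1 h2 h3 h4 h5
    rw [h3, Pi.sub_apply, h4, Pi.add_apply, h5, h1, h2, Pi.smul_apply, hy0e]
    rfl
  · intro t ω
    simp only [h0]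

variable {H : ℝ} {β : Mode → ℝ → W → ℂ}

theorem IsFBm.exists_version {b : ℝ → W → ℝ} (hb : IsFBm μ H b) :
    ∃ b' : ℝ → W → ℝ, (∀ t, Measurable (b' t)) ∧ (∀ ω, Continuous fun t => b' t ω) ∧
      (∀ ω, b' 0 ω = 0) ∧ ∀ᵐ ω ∂μ, ∀ t, b' t ω = b t ω := by
  classical
  obtain ⟨N, hN, hNm, hN0⟩ := exists_measurable_superset_of_null
    (ae_iff.1 (hb.cont.and hb.zero))
  refine ⟨fun t => Nᶜ.indicator (b t), fun t => (hb.measurable t).indicator hNm.compl, ?_, ?_, ?_⟩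
  · intro ω
    by_cases h : ω ∈ N
    · simpa [h] using continuous_const
    · have : Continuous (fun t => b t ω) ∧ b 0 ω = 0 := by
        by_contra h'
        exact h (hN h')
      simpa [h] using this.1
  · intro ω
    by_cases h : ω ∈ N
    · simp [h]
    · have : Continuous (fun t => b t ω) ∧ b 0 ω = 0 := by
        by_contra h'
        exact h (hN h')
      simp [h, this.2]
  · filter_upwards [measure_eq_zero_iff_ae_notMem.1 hN0] with ω h t
    simp [h]

/-- Continuous versions of the processes `∫_{-∞}^t e^{-a(t-u)} dβ(u)`, `β` the real or imaginary
part of one of the coefficients of the noise. -/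
theorem IsNoise.exists_fou (hβ : IsNoise μ H β) (hH : 0 < H ∧ H < 1) (p : Mode × Bool) {a : ℝ}
    (ha : 0 < a) :
    ∃ b y : ℝ → W → ℝ, IsFouVersion a b (hβ.curve p) y ∧ (∀ ω, Continuous fun t => b t ω) ∧
      (∀ ω, b 0 ω = 0) ∧ ∀ᵐ ω ∂μ, ∀ t, b t ω = noisePart β p t ω := by
  obtain ⟨b', h1, h2, h3, h4⟩ := (hβ.isFBm p).exists_version
  have h5 : ∀ᵐ ω ∂μ, ∀ t, (√2)⁻¹ * b' t ω = noisePart β p t ω := by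
    filter_upwards [h4] with ω h t
    rw [h t]
    field_simp
  obtain ⟨y, hy⟩ := exists_isFouVersion (b := fun t ω => (√2)⁻¹ * b' t ω) ha (hβ.isFBmCurve hH p)
    (fun t => by
      filter_upwards [hβ.coeFn_curve p t, h5] with ω h6 h7
      rw [h6, h7 t])
    (fun t => (h1 t).const_mul _) (fun ω => (h2 ω).const_mul _) (fun ω => by simp [h3 ω])
  exact ⟨_, y, hy, fun ω => (h2 ω).const_mul _, fun ω => by simp [h3 ω], h5⟩

end Versions

/-! ### Suprema of Gaussian random fields on the unit cube -/

section Chaining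

/-- The lower corner of the dyadic cube of generation `n` that contains `u`. -/
def dyadicFloor {d : ℕ} (n : ℕ) (u : Fin d → ℝ) : Fin d → ℝ := fun i => ⌊2 ^ n * u i⌋₊ / 2 ^ n

/-- The dyadic grid points of generation `n`. -/
def gridPoint {d : ℕ} (n : ℕ) (q : Fin d → ℕ) : Fin d → ℝ := fun i => q i / 2 ^ n

theorem tendsto_dyadicFloor {d : ℕ} {u : Fin d → ℝ} (hu : ∀ i, 0 ≤ u i) :
    Tendsto (fun n => dyadicFloor n u) atTop (𝓝 u) := by
  rw [tendsto_pi_nhds]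
  intro i
  have h := (tendsto_nat_floor_mul_div_atTop (hu i)).comp
    (tendsto_pow_atTop_atTop_of_one_lt (one_lt_two : (1 : ℝ) < 2))
  refine h.congr fun n => ?_
  simp [dyadicFloor, mul_comm]

theorem norm_gridPoint_sub_le {d : ℕ} (n : ℕ) (q : Fin d → ℕ) :
    ‖gridPoint (n + 1) q - gridPoint n (fun i => q i / 2)‖ ≤ (2 ^ n)⁻¹ := by
  refine (pi_norm_le_iff_of_nonneg (by positivity)).2 fun i => ?_
  have h1 := Nat.div_add_mod (q i) 2
  have h2 := Nat.mod_lt (q i) two_pos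
  have h3 : (q i : ℝ) = 2 * ((q i / 2 : ℕ) : ℝ) + ((q i % 2 : ℕ) : ℝ) := by exact_mod_cast h1.symm
  have h4 : ((q i % 2 : ℕ) : ℝ) ≤ 1 := by exact_mod_cast Nat.lt_succ_iff.1 h2
  have h5 : (gridPoint (n + 1) q - gridPoint n (fun i => q i / 2)) i =
      ((q i % 2 : ℕ) : ℝ) / 2 * (2 ^ n)⁻¹ := by
    simp only [gridPoint, Pi.sub_apply]
    rw [h3, pow_succ]
    field_simp
    ring
  rw [h5, Real.norm_of_nonneg (by positivity)]
  refine mul_le_of_le_one_left (by positivity) ?_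
  linarith

theorem dyadicFloor_eq {d : ℕ} (n : ℕ) {u : Fin d → ℝ} (hu : ∀ i, u i < 1) :
    ∃ q : Fin d → Fin (2 ^ (n + 1)), dyadicFloor (n + 1) u = gridPoint (n + 1) (fun i => (q i : ℕ)) ∧
      dyadicFloor n u = gridPoint n (fun i => (q i : ℕ) / 2) := by
  refine ⟨fun i => ⟨⌊2 ^ (n + 1) * u i⌋₊, ?_⟩, rfl, ?_⟩
  · rw [Nat.floor_lt' (by positivity)]
    push_cast
    have := hu i
    have h2 : (0 : ℝ) < 2 ^ (n + 1) := by positivity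
    nlinarith
  · funext i
    simp only [dyadicFloor, gridPoint]
    congr 2
    rw [← Nat.floor_div_natCast]
    congr 1
    rw [pow_succ]
    push_cast
    ring

/-- The constant in the bound for suprema of Gaussian fields. -/
def chainConst (d : ℕ) (γ : ℝ) : ℝ := 1 + ∑' n : ℕ, ((2 : ℝ) ^ (-γ)) ^ n * (d * (n + 1) + 4)

theorem summable_chain (d : ℕ) {γ : ℝ} (hγ : 0 < γ) :
    Summable fun n : ℕ => ((2 : ℝ) ^ (-γ)) ^ n * (d * (n + 1) + 4) := by
  have h0 : (0 : ℝ) ≤ 2 ^ (-γ) := by positivity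
  have h1 : (2 : ℝ) ^ (-γ) < 1 := Real.rpow_lt_one_of_one_lt_of_neg one_lt_two (by linarith)
  have hs := ((summable_pow_mul_geometric_of_norm_lt_one 1 (r := (2 : ℝ) ^ (-γ))
    (by rwa [Real.norm_of_nonneg h0])).mul_left (d : ℝ)).add
    ((summable_geometric_of_lt_one h0 h1).mul_left (d + 4 : ℝ))
  refine hs.congr fun n => ?_
  ring

theorem chainConst_pos (d : ℕ) {γ : ℝ} : 0 < chainConst d γ := by
  have : 0 ≤ ∑' n : ℕ, ((2 : ℝ) ^ (-γ)) ^ n * (d * (n + 1) + 4) :=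
    tsum_nonneg fun n => by positivity
  rw [chainConst]
  linarith

variable {W : Type*} [MeasurableSpace W] {μ : Measure W} [IsProbabilityMeasure μ]
  {H : ℝ} {β : Mode → ℝ → W → ℂ}

/-- From `x ≤ L + e^{x - L}`, with a single exponential bounded by the sum of all. The bound does
not depend on `i`, and its expectation stays of order `sL` as long as `e^L` is at least the number
of variables. -/
theorem abs_le_max_bound {ι : Type*} [Fintype ι] {s L : ℝ} (hs : 0 < s) (z : ι → ℝ)
    (i : ι) : |z i| ≤ s * (L + Real.exp (-L) * ∑ j, Real.exp (|z j| / s)) := by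
  have h1 : |z i| / s - L ≤ Real.exp (|z i| / s - L) := by
    have := Real.add_one_le_exp (|z i| / s - L); linarith
  have h2 : Real.exp (|z i| / s) ≤ ∑ j, Real.exp (|z j| / s) :=
    Finset.single_le_sum (f := fun j => Real.exp (|z j| / s)) (fun j _ => (Real.exp_pos _).le)
      (Finset.mem_univ i)
  have h3 : |z i| / s ≤ L + Real.exp (-L) * ∑ j, Real.exp (|z j| / s) := by
    rw [sub_eq_neg_add, Real.exp_add] at h1
    have := mul_le_mul_of_nonneg_left h2 (Real.exp_pos (-L)).le
    linarith
  rwa [div_le_iff₀' hs] at h3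

/-- Each exponential moment is at most `2 e^{1/2} ≤ 4`, and `e^{-L}` compensates the number of
summands. -/
theorem IsNoise.lintegral_max_bound (hβ : IsNoise μ H β) {ι : Type*} [Fintype ι] {s L : ℝ}
    (hs : 0 < s) (hL : 0 ≤ L) (hcard : (Fintype.card ι : ℝ) ≤ Real.exp L) {z : ι → W → ℝ}
    (hz : ∀ i, ∃ X ∈ hβ.space, ‖X‖ ≤ s ∧ X =ᵐ[μ] z i) :
    ∫⁻ ω, ENNReal.ofReal (s * (L + Real.exp (-L) * ∑ j, Real.exp (|z j ω| / s))) ∂μ ≤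
      ENNReal.ofReal (s * (L + 4)) := by
  have hexp : 2 * Real.exp (1 / 2) ≤ 4 := by
    have h1 : Real.exp (1 / 2) ^ 2 = Real.exp 1 := by rw [← Real.exp_nat_mul]; norm_num
    have h2 := Real.exp_one_lt_d9
    have h3 := Real.exp_pos (1 / 2)
    nlinarith
  have h1 : ∀ i, AEMeasurable (z i) μ ∧
      ∫⁻ ω, ENNReal.ofReal (Real.exp (|z i ω| / s)) ∂μ ≤ ENNReal.ofReal 4 := by
    intro i
    obtain ⟨X, hX, hXs, hXz⟩ := hz i
    refine ⟨(Lp.aestronglyMeasurable X).aemeasurable.congr hXz, ?_⟩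
    refine le_trans (le_of_eq ?_)
      ((hβ.lintegral_exp_abs_le hX hs hXs).trans (ENNReal.ofReal_le_ofReal hexp))
    exact lintegral_congr_ae (hXz.symm.fun_comp fun x => ENNReal.ofReal (Real.exp (|x| / s)))
  have h2 : ∀ ω, ENNReal.ofReal (s * (L + Real.exp (-L) * ∑ j, Real.exp (|z j ω| / s))) =
      ENNReal.ofReal (s * L) + ENNReal.ofReal (s * Real.exp (-L)) *
        ∑ j, ENNReal.ofReal (Real.exp (|z j ω| / s)) := by
    intro ω
    have h3 : 0 ≤ ∑ j, Real.exp (|z j ω| / s) := Finset.sum_nonneg fun j _ => (Real.exp_pos _).le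
    rw [← ENNReal.ofReal_sum_of_nonneg fun j _ => (Real.exp_pos _).le,
      ← ENNReal.ofReal_mul (by positivity), ← ENNReal.ofReal_add (by positivity) (by positivity)]
    congr 1
    ring
  have hm : ∀ j, AEMeasurable (fun ω => ENNReal.ofReal (Real.exp (|z j ω| / s))) μ := fun j => by
    have := (h1 j).1
    fun_prop
  simp only [h2]
  rw [lintegral_add_left measurable_const, lintegral_const, measure_univ, mul_one,
    lintegral_const_mul'' _ (Finset.aemeasurable_fun_sum _ fun j _ => hm j),
    lintegral_finsetSum' _ fun j _ => hm j]
  calc ENNReal.ofReal (s * L) + ENNReal.ofReal (s * Real.exp (-L)) *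
        ∑ j, ∫⁻ ω, ENNReal.ofReal (Real.exp (|z j ω| / s)) ∂μ
      ≤ ENNReal.ofReal (s * L) + ENNReal.ofReal (s * Real.exp (-L)) *
        ∑ _j : ι, ENNReal.ofReal 4 := by
        gcongr with j _
        exact (h1 j).2
    _ = ENNReal.ofReal (s * L + s * Real.exp (-L) * (Fintype.card ι * 4)) := by
        rw [Finset.sum_const, Finset.card_univ, nsmul_eq_mul, ← ENNReal.ofReal_natCast,
          ← ENNReal.ofReal_mul (by positivity), ← ENNReal.ofReal_mul (by positivity),
          ← ENNReal.ofReal_add (by positivity) (by positivity)]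
    _ ≤ ENNReal.ofReal (s * (L + 4)) := by
        refine ENNReal.ofReal_le_ofReal ?_
        have h3 : Real.exp (-L) * Fintype.card ι ≤ 1 := by
          calc Real.exp (-L) * Fintype.card ι ≤ Real.exp (-L) * Real.exp L := by gcongr
            _ = 1 := by rw [← Real.exp_add]; simp
        nlinarith

/-- Chaining: by continuity `f u` is `f 0` plus the sum of its differences along successive dyadic
floors of `u`. In generation `n` there are at most `2^{d(n+1)}` such differences, each of `L²` norm
at most `K 2^{-γn}`, so the expected maximum is `O(K n 2^{-γn})`, which is summable. The resulting
bound holds for every `ω`. -/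
theorem IsNoise.exists_sup_bound (hβ : IsNoise μ H β) {d : ℕ} {γ K : ℝ} (hγ : 0 < γ) (hK : 0 < K)
    {f : (Fin d → ℝ) → W → ℝ} (hfm : ∀ u, Measurable (f u)) (hfc : ∀ ω, Continuous fun u => f u ω)
    {X : (Fin d → ℝ) → Lp ℝ 2 μ} (hX : ∀ u, X u ∈ hβ.space) (hXf : ∀ u, X u =ᵐ[μ] f u)
    (hX0 : ‖X 0‖ ≤ K) (hXinc : ∀ u v, ‖X u - X v‖ ≤ K * ‖u - v‖ ^ γ) :
    ∃ G : W → ℝ≥0∞, Measurable G ∧ ∫⁻ ω, G ω ∂μ ≤ ENNReal.ofReal (chainConst d γ * K) ∧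
      ∀ ω u, (∀ i, 0 ≤ u i ∧ u i < 1) → ENNReal.ofReal |f u ω| ≤ G ω := by
  set s : ℕ → ℝ := fun n => K * ((2 : ℝ) ^ (-γ)) ^ n
  -- Chosen so that `e^{L n} ≥ 2^{d(n+1)}`, the number of grid differences.
  set L : ℕ → ℝ := fun n => d * (n + 1)
  have hs : ∀ n, 0 < s n := fun n => by positivity
  have hL : ∀ n, 0 ≤ L n := fun n => by positivity
  set z : ∀ n, (Fin d → Fin (2 ^ (n + 1))) → W → ℝ := fun n q ω =>
    f (gridPoint (n + 1) fun i => (q i : ℕ)) ω - f (gridPoint n fun i => (q i : ℕ) / 2) ω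
  set M : ℕ → W → ℝ := fun n ω =>
    s n * (L n + Real.exp (-L n) * ∑ q, Real.exp (|z n q ω| / s n))
  have hMm : ∀ n, Measurable (M n) := by
    intro n
    have : ∀ q, Measurable (z n q) := fun q => (hfm _).sub (hfm _)
    fun_prop
  have hM : ∀ n, ∫⁻ ω, ENNReal.ofReal (M n ω) ∂μ ≤ ENNReal.ofReal (s n * (L n + 4)) := by
    intro n
    refine hβ.lintegral_max_bound (hs n) (hL n) ?_ fun q => ?_
    · simp only [Fintype.card_fun, Fintype.card_fin]
      push_cast
      rw [← pow_mul]
      have h2 : (2 : ℝ) ≤ Real.exp 1 := by have := Real.exp_one_gt_d9; linarith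
      refine (pow_le_pow_left₀ zero_le_two h2 _).trans (le_of_eq ?_)
      rw [← Real.exp_nat_mul]
      simp only [L]
      push_cast
      ring_nf
    · refine ⟨X (gridPoint (n + 1) fun i => (q i : ℕ)) - X (gridPoint n fun i => (q i : ℕ) / 2),
        hβ.space.sub_mem (hX _) (hX _), (hXinc _ _).trans ?_, ?_⟩
      · refine mul_le_mul_of_nonneg_left ?_ hK.le
        refine (Real.rpow_le_rpow (norm_nonneg _) (norm_gridPoint_sub_le n _) hγ.le).trans
          (le_of_eq ?_)
        rw [Real.inv_rpow (by positivity), ← Real.rpow_natCast, ← Real.rpow_mul zero_le_two,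
          ← Real.rpow_neg zero_le_two, ← Real.rpow_natCast, ← Real.rpow_mul zero_le_two]
        congr 1
        ring
      · filter_upwards [Lp.coeFn_sub (X (gridPoint (n + 1) fun i => (q i : ℕ)))
          (X (gridPoint n fun i => (q i : ℕ) / 2)), hXf (gridPoint (n + 1) fun i => (q i : ℕ)),
          hXf (gridPoint n fun i => (q i : ℕ) / 2)] with ω h1 h2 h3
        rw [h1, Pi.sub_apply, h2, h3]
  refine ⟨fun ω => ENNReal.ofReal |f 0 ω| + ∑' n, ENNReal.ofReal (M n ω), ?_, ?_, ?_⟩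
  · have := hfm 0
    exact Measurable.add (by fun_prop) (Measurable.tsum fun n => (hMm n).ennreal_ofReal)
  · have hf0 : ∫⁻ ω, ENNReal.ofReal |f 0 ω| ∂μ ≤ ENNReal.ofReal K := by
      have hi : Integrable (f 0) μ := (L2_integrable (X 0)).congr (hXf 0)
      rw [← ofReal_integral_eq_lintegral_ofReal hi.abs (Eventually.of_forall fun _ => abs_nonneg _)]
      refine ENNReal.ofReal_le_ofReal (le_trans (le_of_eq ?_)
        ((integral_abs_le_norm (X 0)).trans hX0))
      exact integral_congr_ae ((hXf 0).symm.fun_comp fun x => |x|)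
    rw [lintegral_add_left (by have := hfm 0; fun_prop),
      lintegral_tsum fun n => (hMm n).ennreal_ofReal.aemeasurable]
    calc _ ≤ ENNReal.ofReal K + ∑' n, ENNReal.ofReal (s n * (L n + 4)) :=
          add_le_add hf0 (ENNReal.tsum_le_tsum hM)
      _ = _ := by
          have hsum : Summable fun n => s n * (L n + 4) := by
            refine ((summable_chain d hγ).mul_left K).congr fun n => ?_
            simp only [s, L]; ring
          rw [← ENNReal.ofReal_tsum_of_nonneg (fun n => by have := hs n; have := hL n; positivity) hsum,
            ← ENNReal.ofReal_add hK.le (tsum_nonneg fun n => by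
              have := hs n; have := hL n; positivity)]
          congr 1
          rw [chainConst, add_mul, one_mul, ← tsum_mul_right]
          congr 2
          funext n
          simp only [s, L]; ring
  · intro ω u hu
    have hstep : ∀ n, |f (dyadicFloor (n + 1) u) ω - f (dyadicFloor n u) ω| ≤ M n ω := by
      intro n
      obtain ⟨q, h1, h2⟩ := dyadicFloor_eq n fun i => (hu i).2
      rw [h1, h2]
      exact abs_le_max_bound (hs n) (fun q => z n q ω) q
    -- This is where the cube has to be half-open: the chain starts at the origin.
    have hzero : dyadicFloor 0 u = 0 := by
      funext i
      simp [dyadicFloor, Nat.floor_eq_zero.2 (hu i).2]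
    have hfin : ∀ n, ENNReal.ofReal |f (dyadicFloor n u) ω| ≤
        ENNReal.ofReal |f 0 ω| + ∑ k ∈ Finset.range n, ENNReal.ofReal (M k ω) := by
      intro n
      induction n with
      | zero => simp [hzero]
      | succ n ih =>
        rw [Finset.sum_range_succ, ← add_assoc]
        calc ENNReal.ofReal |f (dyadicFloor (n + 1) u) ω|
            ≤ ENNReal.ofReal (|f (dyadicFloor n u) ω| +
              |f (dyadicFloor (n + 1) u) ω - f (dyadicFloor n u) ω|) := by
              refine ENNReal.ofReal_le_ofReal ?_
              have := abs_add_le (f (dyadicFloor n u) ω)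
                (f (dyadicFloor (n + 1) u) ω - f (dyadicFloor n u) ω)
              simpa using this
          _ = ENNReal.ofReal |f (dyadicFloor n u) ω| +
              ENNReal.ofReal |f (dyadicFloor (n + 1) u) ω - f (dyadicFloor n u) ω| :=
              ENNReal.ofReal_add (abs_nonneg _) (abs_nonneg _)
          _ ≤ _ := add_le_add ih (ENNReal.ofReal_le_ofReal (hstep n))
    have hlim : Tendsto (fun n => ENNReal.ofReal |f (dyadicFloor n u) ω|) atTop
        (𝓝 (ENNReal.ofReal |f u ω|)) := by
      refine (ENNReal.continuous_ofReal.tendsto _).comp ((continuous_abs.tendsto _).comp ?_)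
      exact ((hfc ω).tendsto u).comp (tendsto_dyadicFloor fun i => (hu i).1)
    refine le_of_tendsto' hlim fun n => (hfin n).trans ?_
    exact add_le_add le_rfl (ENNReal.sum_le_tsum _)

end Chaining

/-! ### Trigonometric modes -/

section TrigModes

/-- The wave vector `k = 2πn`. -/
def waveVec (n : Mode) : Plane := !₂[2 * Real.pi * n.1 0, 2 * Real.pi * n.1 1]

theorem norm_waveVec (n : Mode) : ‖waveVec n‖ = waveNorm n := rfl

theorem one_le_waveNorm (n : Mode) : 1 ≤ waveNorm n := by
  have h : ∃ i, n.1 i ≠ 0 := by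
    by_contra! h
    exact n.2 (funext h)
  obtain ⟨i, hi⟩ := h
  have h1 : (1 : ℝ) ≤ |(n.1 i : ℝ)| := by exact_mod_cast Int.one_le_abs hi
  have h2 : ‖waveVec n i‖ ≤ ‖waveVec n‖ := PiLp.norm_apply_le _ i
  have h3 : ‖waveVec n i‖ = 2 * Real.pi * |(n.1 i : ℝ)| := by
    have : waveVec n i = 2 * Real.pi * n.1 i := by fin_cases i <;> rfl
    rw [this, norm_mul, Real.norm_of_nonneg (by positivity), Real.norm_eq_abs]
  rw [← norm_waveVec]
  have h4 := Real.pi_gt_three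
  nlinarith

/-- The phase of a trigonometric mode. -/
def phase (b : Bool) : ℝ := if b then 0 else Real.pi / 2

theorem mFourier_cover (n : Mode) (x : Plane) :
    UnitAddTorus.mFourier n.1 (cover x) = Complex.exp ((inner ℝ (waveVec n) x : ℝ) * Complex.I) := by
  have h : ∀ i, fourier (n.1 i) (cover x i) =
      Complex.exp ((2 * Real.pi * n.1 i * x i : ℝ) * Complex.I) := by
    intro i
    rw [cover, fourier_coe_apply]
    congr 1
    push_cast
    ring
  simp only [UnitAddTorus.mFourier, ContinuousMap.coe_mk, Fin.prod_univ_two, h]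
  rw [← Complex.exp_add]
  congr 1
  simp only [waveVec, PiLp.inner_apply, Fin.sum_univ_two]
  simp
  ring

/-- The functions `cos(⟨k, x⟩)` and `-sin(⟨k, x⟩)`. -/
def trigMode (m : ℕ) (n : Mode) (b : Bool) : CmTorus m :=
  ⟨⟨fun z => (Complex.exp (phase b * Complex.I) * UnitAddTorus.mFourier n.1 z).re, by fun_prop⟩, by
    have h : (fun x : Plane => (Complex.exp (phase b * Complex.I) *
        UnitAddTorus.mFourier n.1 (cover x)).re) =
        fun x => Real.cos (inner ℝ (waveVec n) x + phase b) := by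
      funext x
      rw [mFourier_cover, ← Complex.exp_add, ← add_mul, ← Complex.ofReal_add,
        Complex.exp_ofReal_mul_I_re, add_comm]
    change ContDiff ℝ m (fun x : Plane => (Complex.exp (phase b * Complex.I) *
        UnitAddTorus.mFourier n.1 (cover x)).re)
    rw [h]
    exact Real.contDiff_cos.comp
      ((contDiff_const.inner ℝ contDiff_id).add contDiff_const)⟩

theorem trigMode_toCont (m : ℕ) (n : Mode) (b : Bool) (z : Torus) :
    (trigMode m n b).toCont z =
      (Complex.exp (phase b * Complex.I) * UnitAddTorus.mFourier n.1 z).re := rfl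

theorem trigMode_pull (m : ℕ) (n : Mode) (b : Bool) :
    (trigMode m n b).pull = fun x => Real.cos (inner ℝ (waveVec n) x + phase b) := by
  funext x
  rw [CmTorus.pull, trigMode_toCont, mFourier_cover, ← Complex.exp_add, ← add_mul,
    ← Complex.ofReal_add, Complex.exp_ofReal_mul_I_re, add_comm]

theorem iteratedDeriv_cos_add (j : ℕ) (θ : ℝ) :
    iteratedDeriv j (fun s => Real.cos (s + θ)) =
      fun s => Real.cos (s + θ + j * (Real.pi / 2)) := by
  induction j with
  | zero => simp
  | succ j ih =>
    rw [iteratedDeriv_succ, ih]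
    funext s
    have h : HasDerivAt (fun s => Real.cos (s + θ + j * (Real.pi / 2)))
        (-Real.sin (s + θ + j * (Real.pi / 2)) * 1) s :=
      (Real.hasDerivAt_cos _).comp s (((hasDerivAt_id s).add_const θ).add_const _)
    rw [h.deriv, mul_one, ← Real.cos_add_pi_div_two]
    congr 1
    push_cast
    ring

/-- The partial derivatives of order `j` as linear functionals on `C^m(𝕋²)`. -/
def jetEval {m : ℕ} (j : Fin (m + 1)) (σ : Fin (j : ℕ) → Fin 2) (x : Plane) : CmTorus m →ₗ[ℝ] ℝ where
  toFun f := iteratedFDeriv ℝ (j : ℕ) f.pull x fun i => EuclideanSpace.single (σ i) (1 : ℝ)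
  map_add' f g := by
    have h : jets m (f + g) j x = jets m f j x + jets m g j x := by rw [map_add]; rfl
    exact congrArg (fun L => L fun i => EuclideanSpace.single (σ i) (1 : ℝ)) h
  map_smul' c f := by
    have h : jets m (c • f) j x = c • jets m f j x := by rw [map_smul]; rfl
    exact congrArg (fun L => L fun i => EuclideanSpace.single (σ i) (1 : ℝ)) h

theorem jetEval_apply {m : ℕ} (j : Fin (m + 1)) (σ : Fin (j : ℕ) → Fin 2) (x : Plane)
    (f : CmTorus m) : jetEval j σ x f =
      iteratedFDeriv ℝ (j : ℕ) f.pull x fun i => EuclideanSpace.single (σ i) (1 : ℝ) := rfl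

theorem continuous_jetEval {m : ℕ} (j : Fin (m + 1)) (σ : Fin (j : ℕ) → Fin 2) (f : CmTorus m) :
    Continuous fun x => jetEval j σ x f := by
  have h : Continuous fun x => iteratedFDeriv ℝ (j : ℕ) f.pull x :=
    f.contDiff_pull.continuous_iteratedFDeriv (by exact_mod_cast Nat.lt_succ_iff.1 j.2)
  exact (ContinuousMultilinearMap.apply ℝ (fun _ : Fin (j : ℕ) => Plane) ℝ _).continuous.comp h

/-- Each derivative of the cosine advances the phase by `π/2`, and the chain rule contributes one
component of the wave vector per direction. -/
theorem jetEval_trigMode {m : ℕ} (j : Fin (m + 1)) (σ : Fin (j : ℕ) → Fin 2) (x : Plane) (n : Mode)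
    (b : Bool) : jetEval j σ x (trigMode m n b) =
      (∏ i, waveVec n (σ i)) *
        Real.cos (inner ℝ (waveVec n) x + (phase b + (j : ℕ) * (Real.pi / 2))) := by
  rw [jetEval_apply, trigMode_pull]
  have h := (innerSL ℝ (waveVec n)).iteratedFDeriv_comp_right (n := (j : ℕ))
    (f := fun s => Real.cos (s + phase b)) (by fun_prop) x le_rfl
  have h2 : ((fun s => Real.cos (s + phase b)) ∘ ⇑(innerSL ℝ (waveVec n))) =
      fun x => Real.cos (inner ℝ (waveVec n) x + phase b) := rfl
  rw [h2] at h
  rw [h, ContinuousMultilinearMap.compContinuousLinearMap_apply,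
    iteratedFDeriv_apply_eq_iteratedDeriv_mul_prod, iteratedDeriv_cos_add, smul_eq_mul]
  congr 1
  · refine Finset.prod_congr rfl fun i _ => ?_
    rw [innerSL_apply_apply, real_inner_comm, EuclideanSpace.inner_single_left]
    simp
  · rw [innerSL_apply_apply, ← add_assoc]

theorem abs_prod_waveVec_le {m : ℕ} (j : Fin (m + 1)) (σ : Fin (j : ℕ) → Fin 2) (n : Mode) :
    |∏ i, waveVec n (σ i)| ≤ waveNorm n ^ m := by
  rw [Finset.abs_prod]
  calc ∏ i, |waveVec n (σ i)| ≤ ∏ _i : Fin (j : ℕ), waveNorm n :=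
        Finset.prod_le_prod (fun _ _ => abs_nonneg _) fun i _ => PiLp.norm_apply_le (waveVec n) _
    _ = waveNorm n ^ (j : ℕ) := by simp
    _ ≤ waveNorm n ^ m := pow_le_pow_right₀ (one_le_waveNorm n) (Nat.lt_succ_iff.1 j.2)

theorem abs_jetEval_trigMode_le {m : ℕ} (j : Fin (m + 1)) (σ : Fin (j : ℕ) → Fin 2) (x : Plane)
    (n : Mode) (b : Bool) : |jetEval j σ x (trigMode m n b)| ≤ waveNorm n ^ m := by
  rw [jetEval_trigMode, abs_mul]
  exact (mul_le_of_le_one_right (abs_nonneg _) (Real.abs_cos_le_one _)).trans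
    (abs_prod_waveVec_le j σ n)

theorem abs_cos_sub_cos_le_rpow {γ : ℝ} (h0 : 0 ≤ γ) (h1 : γ ≤ 1) (a b : ℝ) :
    |Real.cos a - Real.cos b| ≤ 2 * |a - b| ^ γ := by
  rcases le_total |a - b| 1 with h | h
  · have h2 : |Real.cos a - Real.cos b| ≤ |a - b| := Real.abs_cos_sub_cos_le a b
    have h3 : |a - b| ≤ |a - b| ^ γ := by
      rcases eq_or_lt_of_le (abs_nonneg (a - b)) with h4 | h4
      · rw [← h4]; positivity
      · simpa using Real.rpow_le_rpow_of_exponent_ge h4 h h1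
    have h4 : 0 ≤ |a - b| ^ γ := by positivity
    linarith
  · have h2 := abs_sub (Real.cos a) (Real.cos b)
    have h3 := Real.abs_cos_le_one a
    have h4 := Real.abs_cos_le_one b
    have h5 := Real.one_le_rpow h h0
    linarith

theorem abs_jetEval_trigMode_sub_le {m : ℕ} (j : Fin (m + 1)) (σ : Fin (j : ℕ) → Fin 2)
    (x y : Plane) (n : Mode) (b : Bool) {γ : ℝ} (h0 : 0 ≤ γ) (h1 : γ ≤ 1) :
    |jetEval j σ x (trigMode m n b) - jetEval j σ y (trigMode m n b)| ≤
      waveNorm n ^ m * (2 * (waveNorm n ^ γ * ‖x - y‖ ^ γ)) := by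
  rw [jetEval_trigMode, jetEval_trigMode, ← mul_sub, abs_mul]
  refine mul_le_mul (abs_prod_waveVec_le j σ n) ?_ (abs_nonneg _)
    (pow_nonneg (zero_le_one.trans (one_le_waveNorm n)) _)
  refine (abs_cos_sub_cos_le_rpow h0 h1 _ _).trans ?_
  rw [add_sub_add_right_eq_sub, ← inner_sub_right,
    ← Real.mul_rpow (zero_le_one.trans (one_le_waveNorm n)) (norm_nonneg _)]
  gcongr
  exact abs_real_inner_le_norm (waveVec n) _

theorem norm_multilinear_le_sum {j : ℕ} (L : Plane [×j]→L[ℝ] ℝ) :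
    ‖L‖ ≤ ∑ σ : Fin j → Fin 2, |L fun i => EuclideanSpace.single (σ i) 1| := by
  refine ContinuousMultilinearMap.opNorm_le_bound
    (Finset.sum_nonneg fun _ _ => abs_nonneg _) fun v => ?_
  have h : v = fun i => ∑ a : Fin 2, v i a • EuclideanSpace.single a (1 : ℝ) := by
    funext i
    ext b
    fin_cases b <;> simp
  have h2 : L v = ∑ σ : Fin j → Fin 2,
      (∏ i, v i (σ i)) • L fun i => EuclideanSpace.single (σ i) 1 := by
    conv_lhs => rw [h]
    rw [ContinuousMultilinearMap.map_sum]
    exact Finset.sum_congr rfl fun σ _ => L.map_smul_univ _ _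
  rw [h2, Finset.sum_mul]
  refine (norm_sum_le _ _).trans (Finset.sum_le_sum fun σ _ => ?_)
  rw [norm_smul, mul_comm, Real.norm_eq_abs (L _), norm_prod]
  gcongr with i _
  exact PiLp.norm_apply_le _ _

theorem CmTorus.exists_iteratedFDeriv_eq {m : ℕ} (f : CmTorus m) (x : Plane) :
    ∃ y : Plane, (∀ i, 0 ≤ y i ∧ y i < 1) ∧
      ∀ j : ℕ, iteratedFDeriv ℝ j f.pull x = iteratedFDeriv ℝ j f.pull y := by
  set y : Plane := WithLp.toLp 2 fun i => Int.fract (x i)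
  set a : Plane := WithLp.toLp 2 fun i => ((⌊x i⌋ : ℤ) : ℝ)
  have hx : x = y + a := by
    ext i
    simp [y, a, Int.fract_add_floor]
  have ha : ∀ z : Plane, cover (z + a) = cover z := by
    intro z
    funext i
    simp [cover, a]
  refine ⟨y, fun i => ⟨Int.fract_nonneg _, Int.fract_lt_one _⟩, fun j => ?_⟩
  rw [hx, ← iteratedFDeriv_comp_add_right j a y]
  congr 1
  funext z
  simp [CmTorus.pull, ha]

/-- By periodicity and multilinearity the `C^m` norm is controlled by finitely many scalar fields on
the unit square, the coordinate partial derivatives. Chaining applies to each of them. -/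
theorem CmTorus.norm_le_of_jetEval {m : ℕ} (f : CmTorus m)
    {B : (j : Fin (m + 1)) → (Fin (j : ℕ) → Fin 2) → ℝ}
    (h : ∀ j σ x, (∀ i, 0 ≤ x i ∧ x i < 1) → |jetEval j σ x f| ≤ B j σ) :
    ‖f‖ ≤ ∑ j, ∑ σ, B j σ := by
  have hB : ∀ j σ, 0 ≤ B j σ := fun j σ => (abs_nonneg _).trans (h j σ 0 (by simp))
  refine (f.norm_le_iff (Finset.sum_nonneg fun j _ => Finset.sum_nonneg fun σ _ => hB j σ)).2
    fun j hj x => ?_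
  obtain ⟨y, hy, he⟩ := f.exists_iteratedFDeriv_eq x
  rw [he]
  refine (norm_multilinear_le_sum _).trans ((Finset.sum_le_sum fun σ _ =>
    h ⟨j, Nat.lt_succ_of_le hj⟩ σ y hy).trans ?_)
  exact Finset.single_le_sum (f := fun j => ∑ σ, B j σ)
    (fun j _ => Finset.sum_nonneg fun σ _ => hB j σ) (Finset.mem_univ (⟨j, Nat.lt_succ_of_le hj⟩ : Fin (m + 1)))

/-! ### Fourier coefficients of the trigonometric modes -/

theorem trigMode_toL2 (m : ℕ) (n : Mode) (b : Bool) : (trigMode m n b).toL2 =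
    (Complex.exp (phase b * Complex.I) / 2) • expBasis n.1 +
      (Complex.exp (-(phase b * Complex.I)) / 2) • expBasis (-n).1 := by
  rw [expBasis_apply, expBasis_apply, CmTorus.toL2, ← map_smul, ← map_smul, ← map_add]
  congr 1
  ext z
  have h1 : (-n).1 = -n.1 := rfl
  simp only [ContinuousMap.comp_apply, ContinuousMap.coe_mk, trigMode_toCont,
    ContinuousMap.add_apply, ContinuousMap.smul_apply, smul_eq_mul, h1, UnitAddTorus.mFourier_neg]
  rw [Complex.re_eq_add_conj, map_mul, ← Complex.exp_conj]
  simp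
  ring

theorem coeff_trigMode (m : ℕ) (n : Mode) (b : Bool) (l : Fin 2 → ℤ) :
    coeff l (trigMode m n b) = (if l = n.1 then Complex.exp (phase b * Complex.I) / 2 else 0) +
      (if l = (-n).1 then Complex.exp (-(phase b * Complex.I)) / 2 else 0) := by
  have h : ∀ k, inner ℂ (expBasis l) (expBasis k) = if l = k then (1 : ℂ) else 0 :=
    fun k => orthonormal_iff_ite.1 expBasis.orthonormal l k
  rw [coeff_apply, trigMode_toL2, inner_add_right, inner_smul_right, inner_smul_right, h, h]
  simp

end TrigModes

/-! ### Random series in `C(ℝ, C^m(𝕋²))` -/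

section RandomSeries

variable {W : Type*} [MeasurableSpace W] {μ : Measure W} [IsProbabilityMeasure μ]
  {H : ℝ} {β : Mode → ℝ → W → ℂ}

theorem norm_sum_sq_of_inner_eq_zero {E ι : Type*} [NormedAddCommGroup E] [InnerProductSpace ℝ E]
    (s : Finset ι) (Z : ι → E) (h : ∀ i ∈ s, ∀ j ∈ s, i ≠ j → inner ℝ (Z i) (Z j) = 0) :
    ‖∑ i ∈ s, Z i‖ ^ 2 = ∑ i ∈ s, ‖Z i‖ ^ 2 := by
  rw [← real_inner_self_eq_norm_sq, sum_inner]
  refine Finset.sum_congr rfl fun i hi => ?_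
  rw [inner_sum, Finset.sum_eq_single i (fun j hj hij => h i hi j hj hij.symm)
    (fun h' => absurd hi h'), real_inner_self_eq_norm_sq]

/-- Gaussian processes `y p` with orthogonal images `Y p` in `L²` and functions `c p` such that the
derivatives of the random fields `y p ⊗ c p` satisfy summable Hölder bounds in `L²`. -/
structure IsModeSeries (hβ : IsNoise μ H β) (γ : ℝ) {m : ℕ} {ι : Type*} (c : ι → CmTorus m)
    (y : ι → ℝ → W → ℝ) (Y : ι → ℝ → Lp ℝ 2 μ) (w : ι → ℝ) : Prop where
  continuous : ∀ p ω, Continuous fun t => y p t ω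
  measurable : ∀ p t, Measurable (y p t)
  ae_eq : ∀ p t, Y p t =ᵐ[μ] y p t
  mem : ∀ p t, Y p t ∈ hβ.space
  orthogonal : ∀ p q, p ≠ q → ∀ s t, inner ℝ (Y p s) (Y q t) = 0
  nonneg : ∀ p, 0 ≤ w p
  summable : Summable w
  bound : ∀ (j : Fin (m + 1)) (σ : Fin (j : ℕ) → Fin 2) p t x,
    ‖jetEval j σ x (c p) • Y p t‖ ^ 2 ≤ w p
  increment : ∀ (j : Fin (m + 1)) (σ : Fin (j : ℕ) → Fin 2) p s t x x' δ, |s - t| ≤ δ →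
    ‖x - x'‖ ≤ 2 * δ →
    ‖jetEval j σ x (c p) • Y p s - jetEval j σ x' (c p) • Y p t‖ ^ 2 ≤ w p * (δ ^ γ) ^ 2

variable {hβ : IsNoise μ H β} {γ : ℝ} {m : ℕ} {ι : Type*} {c : ι → CmTorus m}
  {y : ι → ℝ → W → ℝ} {Y : ι → ℝ → Lp ℝ 2 μ} {w : ι → ℝ}

/-- The constant in the bound for suprema of norms in `C^m(𝕋²)`. -/
def blockConst (m : ℕ) (γ : ℝ) : ℝ :=
  ∑ j : Fin (m + 1), ∑ _σ : Fin (j : ℕ) → Fin 2, chainConst 3 γ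

theorem blockConst_nonneg (m : ℕ) (γ : ℝ) : 0 ≤ blockConst m γ :=
  Finset.sum_nonneg fun _ _ => Finset.sum_nonneg fun _ _ => (chainConst_pos 3).le

/-- Time in a unit window and the two space coordinates form a field on the unit cube in dimension
3. Orthogonality of the modes turns the `L²` norms of values and increments into sums of weights, so
the chaining constant is the square root of the total weight. -/
theorem IsModeSeries.exists_field_bound (h : IsModeSeries hβ γ c y Y w) (hγ : 0 < γ) (D : Finset ι)
    {K : ℝ} (hK : 0 < K) (hD : ∑ p ∈ D, w p ≤ K ^ 2) (r : ℝ) (j : Fin (m + 1))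
    (σ : Fin (j : ℕ) → Fin 2) :
    ∃ G : W → ℝ≥0∞, Measurable G ∧ ∫⁻ ω, G ω ∂μ ≤ ENNReal.ofReal (chainConst 3 γ * K) ∧
      ∀ ω, ∀ t ∈ Set.Ico r (r + 1), ∀ x : Plane, (∀ i, 0 ≤ x i ∧ x i < 1) →
        ENNReal.ofReal |jetEval j σ x (∑ p ∈ D, y p t ω • c p)| ≤ G ω := by
  set pt : (Fin 3 → ℝ) → Plane := fun u => !₂[u 1, u 2]
  have hpt : Continuous pt := by
    refine (PiLp.continuous_toLp 2 _).comp (continuous_pi fun i => ?_)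
    fin_cases i
    · exact continuous_apply 1
    · exact continuous_apply 2
  -- The cube carries the sup norm and the plane the Euclidean norm. The factor 2, a convenient
  -- bound for `√2`, is the one allowed in `IsModeSeries.increment`.
  have hpt2 : ∀ u v : Fin 3 → ℝ, ‖pt u - pt v‖ ≤ 2 * ‖u - v‖ := by
    intro u v
    rw [EuclideanSpace.norm_eq]
    refine Real.sqrt_le_iff.2 ⟨by positivity, ?_⟩
    have h1 : |u 1 - v 1| ≤ ‖u - v‖ := norm_le_pi_norm (u - v) 1
    have h2 : |u 2 - v 2| ≤ ‖u - v‖ := norm_le_pi_norm (u - v) 2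
    have h3 := pow_le_pow_left₀ (abs_nonneg _) h1 2
    have h4 := pow_le_pow_left₀ (abs_nonneg _) h2 2
    simp only [Fin.sum_univ_two, pt, PiLp.sub_apply, Real.norm_eq_abs]
    simp only [Matrix.cons_val_zero, Matrix.cons_val_one]
    nlinarith
  set f : (Fin 3 → ℝ) → W → ℝ := fun u ω =>
    ∑ p ∈ D, y p (r + u 0) ω * jetEval j σ (pt u) (c p)
  set X : (Fin 3 → ℝ) → Lp ℝ 2 μ := fun u => ∑ p ∈ D, jetEval j σ (pt u) (c p) • Y p (r + u 0)
  have hfX : ∀ u, X u =ᵐ[μ] f u := by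
    intro u
    have h1 : ∀ᵐ ω ∂μ, ∀ p ∈ D, (jetEval j σ (pt u) (c p) • Y p (r + u 0) : Lp ℝ 2 μ) ω =
        y p (r + u 0) ω * jetEval j σ (pt u) (c p) := by
      rw [Finset.eventually_all]
      intro p _
      filter_upwards [Lp.coeFn_smul (jetEval j σ (pt u) (c p)) (Y p (r + u 0)),
        h.ae_eq p (r + u 0)] with ω h1 h2
      rw [h1, Pi.smul_apply, h2, smul_eq_mul, mul_comm]
    filter_upwards [h1, Lp.coeFn_fun_finsetSum D
      fun p => jetEval j σ (pt u) (c p) • Y p (r + u 0)] with ω h1 h2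
    rw [h2, Finset.sum_congr rfl h1]
  obtain ⟨G, hGm, hG, hfG⟩ := hβ.exists_sup_bound (d := 3) (f := f) (X := X) hγ hK
    (fun u => Finset.measurable_fun_sum _ fun p _ => (h.measurable p _).mul_const _)
    (fun ω => continuous_finsetSum _ fun p _ =>
      ((h.continuous p ω).comp (by fun_prop : Continuous fun u : Fin 3 → ℝ => r + u 0)).mul
        ((continuous_jetEval j σ (c p)).comp hpt))
    (fun u => hβ.space.sum_mem fun p _ => hβ.space.smul_mem _ (h.mem p _)) hfX
    (by
      refine abs_le_of_sq_le_sq' ?_ hK.le |>.2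
      rw [norm_sum_sq_of_inner_eq_zero]
      · exact (Finset.sum_le_sum fun p _ => h.bound j σ p _ _).trans hD
      · intro p _ q _ hpq
        rw [real_inner_smul_left, real_inner_smul_right, h.orthogonal p q hpq, mul_zero, mul_zero])
    (fun u v => by
      refine abs_le_of_sq_le_sq' ?_ (by positivity) |>.2
      rw [← Finset.sum_sub_distrib, norm_sum_sq_of_inner_eq_zero]
      · refine (Finset.sum_le_sum fun p _ => h.increment j σ p _ _ _ _ ‖u - v‖ ?_
          (hpt2 u v)).trans ?_
        · rw [add_sub_add_left_eq_sub]
          exact norm_le_pi_norm (u - v) 0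
        · rw [← Finset.sum_mul, mul_pow]
          gcongr
      · intro p _ q _ hpq
        simp only [inner_sub_left, inner_sub_right, real_inner_smul_left, real_inner_smul_right,
          h.orthogonal p q hpq, mul_zero, sub_zero])
  refine ⟨G, hGm, hG, fun ω t ht x hx => ?_⟩
  have h1 := hfG ω ![t - r, x 0, x 1] (by
    intro i
    fin_cases i
    · exact ⟨by simpa using ht.1, by have := ht.2; simp; linarith⟩
    · exact hx 0
    · exact hx 1)
  refine le_trans (le_of_eq ?_) h1
  have h2 : pt ![t - r, x 0, x 1] = x := by
    ext i
    fin_cases i <;> rfl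
  simp only [f, h2, map_sum, map_smul, smul_eq_mul]
  simp

theorem IsModeSeries.exists_block_bound (h : IsModeSeries hβ γ c y Y w) (hγ : 0 < γ) (D : Finset ι)
    {K : ℝ} (hK : 0 < K) (hD : ∑ p ∈ D, w p ≤ K ^ 2) (r : ℝ) :
    ∃ G : W → ℝ≥0∞, Measurable G ∧ ∫⁻ ω, G ω ∂μ ≤ ENNReal.ofReal (blockConst m γ * K) ∧
      ∀ ω, ∀ t ∈ Set.Ico r (r + 1), ‖∑ p ∈ D, y p t ω • c p‖ₑ ≤ G ω := by
  choose G hGm hG hfG using fun j σ => h.exists_field_bound hγ D hK hD r j σ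
  refine ⟨fun ω => ∑ j, ∑ σ, G j σ ω, ?_, ?_, fun ω t ht => ?_⟩
  · exact Finset.measurable_fun_sum _ fun j _ => Finset.measurable_fun_sum _ fun σ _ => hGm j σ
  · rw [lintegral_finsetSum _ fun j _ => Finset.measurable_fun_sum _ fun σ _ => hGm j σ]
    rw [blockConst, Finset.sum_mul, ENNReal.ofReal_sum_of_nonneg fun j _ =>
      mul_nonneg (Finset.sum_nonneg fun _ _ => (chainConst_pos 3).le) hK.le]
    refine Finset.sum_le_sum fun j _ => ?_
    rw [lintegral_finsetSum _ fun σ _ => hGm j σ, Finset.sum_mul,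
      ENNReal.ofReal_sum_of_nonneg fun σ _ => mul_nonneg (chainConst_pos 3).le hK.le]
    exact Finset.sum_le_sum fun σ _ => hG j σ
  · by_cases htop : ∃ j σ, G j σ ω = ⊤
    · obtain ⟨j, σ, hjσ⟩ := htop
      have : ∑ j, ∑ σ, G j σ ω = ⊤ :=
        ENNReal.sum_eq_top.2 ⟨j, Finset.mem_univ _, ENNReal.sum_eq_top.2 ⟨σ, Finset.mem_univ _, hjσ⟩⟩
      exact le_top.trans_eq this.symm
    · push Not at htop
      have h1 := CmTorus.norm_le_of_jetEval (∑ p ∈ D, y p t ω • c p)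
        (B := fun j σ => (G j σ ω).toReal) fun j σ x hx =>
          (ENNReal.ofReal_le_iff_le_toReal (htop j σ)).1 (hfG j σ ω t ht x hx)
      rw [← ofReal_norm]
      refine (ENNReal.ofReal_le_ofReal h1).trans (le_of_eq ?_)
      rw [ENNReal.ofReal_sum_of_nonneg fun j _ => Finset.sum_nonneg fun σ _ => ENNReal.toReal_nonneg]
      refine Finset.sum_congr rfl fun j _ => ?_
      rw [ENNReal.ofReal_sum_of_nonneg fun σ _ => ENNReal.toReal_nonneg]
      exact Finset.sum_congr rfl fun σ _ => ENNReal.ofReal_toReal (htop j σ)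

/-- The supremum of a block is controlled by the square root of its weight, and square roots of a
summable sequence need not be summable. Cutting the series where the remaining weight is below
`16^{-n}` gives blocks with square roots at most `4^{-n}`. -/
theorem exists_finset_blocks [Countable ι] (hw0 : ∀ p, 0 ≤ w p) (hw : Summable w) :
    ∃ (F D : ℕ → Finset ι) (K : ℕ → ℝ), Tendsto F atTop atTop ∧ (∀ n, 0 < K n) ∧ Summable K ∧
      (∀ n, ∑ p ∈ D n, w p ≤ K n ^ 2) ∧
      ∀ (E : Type) [AddCommGroup E] (z : ι → E) (n : ℕ),
        ∑ k ∈ Finset.range (n + 1), ∑ p ∈ D k, z p = ∑ p ∈ F n, z p := by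
  classical
  obtain ⟨F, hFm, hF⟩ := exists_seq_monotone_tendsto_atTop_atTop (Finset ι)
  have hS : Tendsto (fun n => ∑ p ∈ F n, w p) atTop (𝓝 (∑' p, w p)) := hw.hasSum.comp hF
  obtain ⟨φ, hφ, hφ2⟩ := extraction_forall_of_eventually
    (P := fun k n => ∑' p, w p - (1 / 16) ^ k < ∑ p ∈ F n, w p)
    fun k => hS.eventually_const_lt (sub_lt_self _ (by positivity))
  have hmono : ∀ n, F (φ n) ⊆ F (φ (n + 1)) := fun n => hFm (hφ.monotone n.le_succ)
  -- The first block is bounded by the total weight; the added 1 keeps its constant positive even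
  -- when all weights vanish.
  refine ⟨F ∘ φ, fun n => Nat.casesOn n (F (φ 0)) fun n => F (φ (n + 1)) \ F (φ n),
    fun n => Nat.casesOn n (√(∑' p, w p) + 1) fun n => (1 / 4) ^ n, hF.comp hφ.tendsto_atTop,
    ?_, ?_, ?_, ?_⟩
  · rintro (_ | n)
    · change 0 < √(∑' p, w p) + 1
      positivity
    · change (0 : ℝ) < (1 / 4) ^ n
      positivity
  · exact (summable_nat_add_iff 1).1 (summable_geometric_of_lt_one (by norm_num) (by norm_num))
  · rintro (_ | n)
    · have h1 : ∑ p ∈ F (φ 0), w p ≤ ∑' p, w p := hw.sum_le_tsum _ fun p _ => hw0 p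
      have h2 : 0 ≤ ∑' p, w p := tsum_nonneg hw0
      have h3 := Real.sq_sqrt h2
      have h4 := Real.sqrt_nonneg (∑' p, w p)
      change ∑ p ∈ F (φ 0), w p ≤ (√(∑' p, w p) + 1) ^ 2
      nlinarith
    · have h1 : ∑ p ∈ F (φ (n + 1)), w p ≤ ∑' p, w p := hw.sum_le_tsum _ fun p _ => hw0 p
      have h2 := hφ2 n
      have h3 := Finset.sum_sdiff (f := w) (hmono n)
      change ∑ p ∈ F (φ (n + 1)) \ F (φ n), w p ≤ ((1 / 4) ^ n) ^ 2
      have h4 : (((1 : ℝ) / 4) ^ n) ^ 2 = (1 / 16) ^ n := by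
        rw [← pow_mul, mul_comm, pow_mul]; norm_num
      linarith
  · intro E _ z n
    induction n with
    | zero => simp
    | succ n ih =>
      rw [Finset.sum_range_succ, ih, add_comm]
      exact Finset.sum_sdiff (hmono n)

/-- For each unit window the expected suprema of the blocks are summable, so almost surely the
blocks converge absolutely in `C^m`, uniformly on every window. On the exceptional null set the path
is set to zero, which keeps the bounds valid for every `ω`. -/
theorem IsModeSeries.exists_path [Countable ι] (h : IsModeSeries hβ γ c y Y w) (hγ : 0 < γ) :
    ∃ (Ψ : W → PathSpace m) (F : ℕ → Finset ι) (C : ℝ), Measurable Ψ ∧ Tendsto F atTop atTop ∧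
      (∀ᵐ ω ∂μ, ∀ t, Tendsto (fun n => ∑ p ∈ F n, y p t ω • c p) atTop (𝓝 ((Ψ ω).at t))) ∧
      ∀ r : ℤ, ∃ G : W → ℝ≥0∞, Measurable G ∧ ∫⁻ ω, G ω ∂μ ≤ ENNReal.ofReal C ∧
        ∀ ω, ∀ t ∈ Set.Ico (r : ℝ) (r + 1), ‖(Ψ ω).at t‖ₑ ≤ G ω := by
  obtain ⟨F, D, K, hF, hK, hKs, hD, hFD⟩ := exists_finset_blocks h.nonneg h.summable
  choose G hGm hG hfG using fun (n : ℕ) (r : ℤ) => h.exists_block_bound hγ (D n) (hK n) (hD n) (r : ℝ)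
  set S : ℤ → W → ℝ≥0∞ := fun r ω => ∑' n, G n r ω
  have hSm : ∀ r, Measurable (S r) := fun r => Measurable.tsum fun n => hGm n r
  have hS : ∀ r, ∫⁻ ω, S r ω ∂μ ≤ ENNReal.ofReal (∑' n, blockConst m γ * K n) := by
    intro r
    rw [lintegral_tsum fun n => (hGm n r).aemeasurable, ENNReal.ofReal_tsum_of_nonneg
      (fun n => mul_nonneg (blockConst_nonneg m γ) (hK n).le) (hKs.mul_left _)]
    exact ENNReal.tsum_le_tsum fun n => hG n r
  set N : Set W := ⋃ r, {ω | S r ω = ⊤}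
  have hNm : MeasurableSet N := MeasurableSet.iUnion fun r => (hSm r) (measurableSet_singleton _)
  have hN : ∀ᵐ ω ∂μ, ω ∉ N := by
    have : ∀ r, ∀ᵐ ω ∂μ, S r ω < ⊤ := fun r =>
      ae_lt_top (hSm r) ((hS r).trans_lt ENNReal.ofReal_lt_top).ne
    filter_upwards [ae_all_iff.2 this] with ω hω
    simpa [N] using fun r => (hω r).ne
  set z : ℕ → ℝ → W → CmTorus m := fun n t ω => ∑ p ∈ D n, y p t ω • c p
  have hzc : ∀ n ω, Continuous fun t => z n t ω := fun n ω =>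
    continuous_finsetSum _ fun p _ => (h.continuous p ω).smul continuous_const
  have hzS : ∀ n (r : ℤ) ω, ω ∉ N → ∀ t ∈ Set.Ico (r : ℝ) (r + 1), ‖z n t ω‖ ≤ (G n r ω).toReal := by
    intro n r ω hω t ht
    have h1 : G n r ω ≠ ⊤ := fun h2 => hω (Set.mem_iUnion.2 ⟨r, by
      have := ENNReal.le_tsum (f := fun n => G n r ω) n
      rw [h2] at this
      exact top_le_iff.1 this⟩)
    have h2 := hfG n r ω t ht
    rwa [← ofReal_norm, ENNReal.ofReal_le_iff_le_toReal h1] at h2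
  have hGs : ∀ (r : ℤ) ω, ω ∉ N → Summable fun n => (G n r ω).toReal := fun r ω hω =>
    ENNReal.summable_toReal fun h2 => hω (Set.mem_iUnion.2 ⟨r, h2⟩)
  have hzs : ∀ ω, ω ∉ N → ∀ t, Summable fun n => z n t ω := fun ω hω t =>
    Summable.of_norm_bounded (hGs ⌊t⌋ ω hω) fun n =>
      hzS n ⌊t⌋ ω hω t ⟨Int.floor_le t, Int.lt_floor_add_one t⟩
  have hcont : ∀ ω, ω ∉ N → Continuous fun t => ∑' n, z n t ω := by
    intro ω hω
    rw [continuous_iff_continuousAt]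
    intro t
    -- Windows are half-open, so the preceding one is included in order to have a neighbourhood of
    -- an integer time.
    have h1 : ContinuousOn (fun t => ∑' n, z n t ω) (Set.Ioo ((⌊t⌋ : ℝ) - 1) (⌊t⌋ + 1)) := by
      refine continuousOn_tsum (u := fun n => (G n (⌊t⌋ - 1) ω).toReal + (G n ⌊t⌋ ω).toReal)
        (fun n => (hzc n ω).continuousOn) ((hGs _ ω hω).add (hGs _ ω hω)) fun n s hs => ?_
      rcases lt_or_ge s (⌊t⌋ : ℝ) with hst | hst
      · refine (hzS n (⌊t⌋ - 1) ω hω s ⟨?_, ?_⟩).trans (le_add_of_nonneg_right ENNReal.toReal_nonneg)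
        · push_cast; exact hs.1.le
        · push_cast; linarith
      · exact (hzS n ⌊t⌋ ω hω s ⟨hst, hs.2⟩).trans (le_add_of_nonneg_left ENNReal.toReal_nonneg)
    exact h1.continuousAt (Ioo_mem_nhds (by have := Int.floor_le t; linarith)
      (Int.lt_floor_add_one t))
  classical
  set Ψ : W → PathSpace m := fun ω => (⟨fun t => if ω ∈ N then 0 else ∑' n, z n t ω, by
    by_cases hω : ω ∈ N
    · simpa [hω] using continuous_const
    · simpa [hω] using hcont ω hω⟩ : C(ℝ, CmTorus m))
  have hΨ : ∀ ω t, (Ψ ω).at t = if ω ∈ N then 0 else ∑' n, z n t ω := fun _ _ => rfl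
  refine ⟨Ψ, F, ∑' n, blockConst m γ * K n, ?_, hF, ?_, fun r => ⟨S r, hSm r, hS r, ?_⟩⟩
  · rw [measurable_path_iff]
    intro q n
    refine (coeff n).continuous.measurable.comp ?_
    simp only [hΨ]
    refine measurable_of_tendsto_metrizable
      (f := fun M ω => if ω ∈ N then 0 else ∑ k ∈ Finset.range M, z k q ω)
      (fun M => Measurable.ite hNm measurable_const (Finset.measurable_fun_sum _ fun k _ =>
        Finset.measurable_fun_sum _ fun p _ => (h.measurable p q).smul_const _)) ?_
    rw [tendsto_pi_nhds]
    intro ω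
    by_cases hω : ω ∈ N
    · simp [hω]
    · simpa [hω] using (hzs ω hω q).hasSum.tendsto_sum_nat
  · filter_upwards [hN] with ω hω t
    rw [hΨ, if_neg hω]
    have h1 := (tendsto_add_atTop_iff_nat 1).2 (hzs ω hω t).hasSum.tendsto_sum_nat
    refine h1.congr fun n => ?_
    exact hFD (CmTorus m) (fun p => y p t ω • c p) n
  · intro ω t ht
    rw [hΨ]
    split_ifs with hω
    · simp
    · refine enorm_tsum_le_tsum_enorm.trans (ENNReal.tsum_le_tsum fun n => hfG n r ω t ht)

end RandomSeries

/-! ### Construction of the stationary solution -/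

section Construction

/-- The interpolated increment bound needs an exponent at most `H`, so `γ` is lowered to `min γ H`.
Both series stay summable because `α k ≥ c > 0` and `|k| ≥ 1`. -/
theorem summable_weights {α lam : Mode → ℝ} {H γ : ℝ} {m : ℕ} (hspec : IsSpectralData α lam)
    (hH : 0 < H ∧ H < 1) (hγ : 0 < γ ∧ γ < 1)
    (hsum₁ : Summable fun k : Mode =>
      lam k * α k ^ (2 * γ - 2 * H) * waveNorm k ^ (2 * (m : ℝ)))
    (hsum₂ : Summable fun k : Mode =>
      lam k * α k ^ (-(2 * H)) * waveNorm k ^ (2 * (m : ℝ) + 2 * γ)) :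
    ∃ γ', 0 < γ' ∧ γ' < 1 ∧ γ' ≤ H ∧
      (Summable fun k : Mode => lam k * α k ^ (2 * γ' - 2 * H) * waveNorm k ^ (2 * (m : ℝ))) ∧
      Summable fun k : Mode =>
        lam k * α k ^ (-(2 * H)) * waveNorm k ^ (2 * (m : ℝ) + 2 * γ') := by
  obtain ⟨c, hc, hcα⟩ := hspec.alpha_lower
  have hw : ∀ k, 0 ≤ waveNorm k := fun k => zero_le_one.trans (one_le_waveNorm k)
  have hα : ∀ k, 0 < α k := fun k => hc.trans_le (hcα k)
  have hle : min γ H ≤ γ := min_le_left _ _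
  refine ⟨min γ H, lt_min hγ.1 hH.1, (min_le_left _ _).trans_lt hγ.2, min_le_right _ _, ?_, ?_⟩
  · refine Summable.of_nonneg_of_le (fun k => ?_) (fun k => ?_)
      (hsum₁.mul_left (c ^ (2 * min γ H - 2 * γ)))
    · have := hspec.lam_nonneg k; have := hα k; have := hw k
      positivity
    · have h1 : α k ^ (2 * min γ H - 2 * H) =
          α k ^ (2 * min γ H - 2 * γ) * α k ^ (2 * γ - 2 * H) := by
        rw [← Real.rpow_add (hα k)]; congr 1; ring
      have h2 : α k ^ (2 * min γ H - 2 * γ) ≤ c ^ (2 * min γ H - 2 * γ) :=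
        Real.rpow_le_rpow_of_nonpos hc (hcα k) (by linarith)
      rw [h1]
      have h3 : 0 ≤ lam k * α k ^ (2 * γ - 2 * H) * waveNorm k ^ (2 * (m : ℝ)) := by
        have := hspec.lam_nonneg k; have := hα k; have := hw k
        positivity
      calc _ = α k ^ (2 * min γ H - 2 * γ) *
            (lam k * α k ^ (2 * γ - 2 * H) * waveNorm k ^ (2 * (m : ℝ))) := by ring
        _ ≤ _ := mul_le_mul_of_nonneg_right h2 h3
  · refine Summable.of_nonneg_of_le (fun k => ?_) (fun k => ?_) hsum₂
    · have := hspec.lam_nonneg k; have := hα k; have := hw k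
      positivity
    · refine mul_le_mul_of_nonneg_left (Real.rpow_le_rpow_of_exponent_le (one_le_waveNorm k)
        (by linarith)) ?_
      have := hspec.lam_nonneg k; have := hα k
      positivity

/-- The amplitude `√λₖ ν^H` of a mode. -/
def amplitude (H ν : ℝ) (lam : Mode → ℝ) (k : Mode) : ℝ := √(lam k) * ν ^ H

/-- The weight of a mode in the Hölder bounds. -/
def modeWeight (H ν γ : ℝ) (α lam : Mode → ℝ) (m : ℕ) (k : Mode) : ℝ :=
  128 * (2 * √(2 * (1 / 4)) * (1 + Real.Gamma (H + 1))) ^ 2 * amplitude H ν lam k ^ 2 *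
    ((waveNorm k ^ m * waveNorm k ^ γ * (ν * α k) ^ (-H)) ^ 2 +
      (waveNorm k ^ m * (ν * α k) ^ (γ - H)) ^ 2)

theorem summable_modeWeight {α lam : Mode → ℝ} {H ν γ : ℝ} {m : ℕ} (hspec : IsSpectralData α lam)
    (hν : 0 < ν)
    (hsum₁ : Summable fun k : Mode =>
      lam k * α k ^ (2 * γ - 2 * H) * waveNorm k ^ (2 * (m : ℝ)))
    (hsum₂ : Summable fun k : Mode =>
      lam k * α k ^ (-(2 * H)) * waveNorm k ^ (2 * (m : ℝ) + 2 * γ)) :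
    Summable (modeWeight H ν γ α lam m) := by
  obtain ⟨c, hc, hcα⟩ := hspec.alpha_lower
  set C := 128 * (2 * √(2 * (1 / 4)) * (1 + Real.Gamma (H + 1))) ^ 2
  refine ((hsum₂.mul_left (C * ((ν ^ H) ^ 2 * ν ^ (-(2 * H))))).add
    (hsum₁.mul_left (C * ((ν ^ H) ^ 2 * ν ^ (2 * γ - 2 * H))))).congr fun k => ?_
  have hα : 0 < α k := hc.trans_le (hcα k)
  have hw : 0 < waveNorm k := zero_lt_one.trans_le (one_le_waveNorm k)
  have h1 : ∀ x y : ℝ, 0 < x → (x ^ y) ^ 2 = x ^ (2 * y) := fun x y hx => by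
    rw [← Real.rpow_natCast, ← Real.rpow_mul hx.le]; congr 1; push_cast; ring
  have h2 : (waveNorm k ^ m) ^ 2 = waveNorm k ^ (2 * (m : ℝ)) := by
    rw [← Real.rpow_natCast (waveNorm k) m, h1 _ _ hw]
  simp only [modeWeight, amplitude, mul_pow]
  rw [h2, h1 _ (-H) (mul_pos hν hα), h1 _ (γ - H) (mul_pos hν hα), h1 _ γ hw,
    Real.sq_sqrt (hspec.lam_nonneg k), Real.rpow_add hw,
    Real.mul_rpow hν.le hα.le, Real.mul_rpow hν.le hα.le, show 2 * -H = -(2 * H) by ring,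
    show 2 * (γ - H) = 2 * γ - 2 * H by ring]
  simp only [C, mul_pow]
  ring

theorem inner_fouCurve_fouCurve_eq_zero {E : Type*} [NormedAddCommGroup E] [InnerProductSpace ℝ E]
    [CompleteSpace E] {κ κ' H H' a a' : ℝ} {B B' : ℝ → E} (hB : IsFBmCurve κ H B)
    (hB' : IsFBmCurve κ' H' B') (ha : 0 < a) (ha' : 0 < a') (h : ∀ s t, inner ℝ (B s) (B' t) = 0)
    (s t : ℝ) : inner ℝ (fouCurve a B s) (fouCurve a' B' t) = 0 := by
  refine hB'.inner_fouCurve_eq_zero ha' (fun t => ?_) t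
  rw [real_inner_comm]
  refine hB.inner_fouCurve_eq_zero ha (fun s => ?_) s
  rw [real_inner_comm]
  exact h s t

variable {W : Type*} [MeasurableSpace W] {μ : Measure W} [IsProbabilityMeasure μ]
  {H ν γ : ℝ} {m : ℕ} {α lam : Mode → ℝ} {β : Mode → ℝ → W → ℂ}

theorem IsNoise.inner_curve_half (hβ : IsNoise μ H β) {p q : halfLattice × Bool} (h : p ≠ q)
    (s t : ℝ) : inner ℝ (hβ.curve (p.1, p.2) s) (hβ.curve (q.1, q.2) t) = 0 := by
  obtain ⟨⟨k, hk⟩, b⟩ := p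
  obtain ⟨⟨l, hl⟩, c⟩ := q
  by_cases hkl : k = l
  · subst hkl
    cases b <;> cases c
    · exact absurd rfl h
    · rw [real_inner_comm]
      exact hβ.inner_re_im k t s
    · exact hβ.inner_re_im k s t
    · exact absurd rfl h
  · refine hβ.inner_curve_eq_zero hkl (fun h1 => ?_) b c s t
    exact neg_notMem_halfLattice l hl (h1 ▸ hk)

/-- The stationary Ornstein-Uhlenbeck process of a mode, as a curve in `L²`. -/
def IsNoise.fou (hβ : IsNoise μ H β) (ν : ℝ) (α : Mode → ℝ) (p : Mode × Bool) (t : ℝ) :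
    Lp ℝ 2 μ := fouCurve (ν * α p.1) (hβ.curve p) t

/-- Conjugate modes combine to `βₖ eₖ + β₋ₖ e₋ₖ = 2 (Re βₖ cos⟨k, x⟩ - Im βₖ sin⟨k, x⟩)`, which
explains the factor 2 and the restriction to a half lattice. An increment is split by the product
rule: differences in space cost `|k|^γ a^{-H}`, differences in time cost `a^{γ-H}`. -/
theorem IsNoise.isModeSeries (hβ : IsNoise μ H β) (hH : 0 < H ∧ H < 1) (hν : 0 < ν)
    (hspec : IsSpectralData α lam) (hγ : 0 < γ ∧ γ < 1) (hγH : γ ≤ H)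
    (hsum : Summable (modeWeight H ν γ α lam m)) {b y : halfLattice × Bool → ℝ → W → ℝ}
    (hy : ∀ p, IsFouVersion (ν * α p.1) (b p) (hβ.curve (p.1, p.2)) (y p)) :
    IsModeSeries hβ γ (fun p : halfLattice × Bool =>
        (2 * amplitude H ν lam p.1) • trigMode m p.1 p.2) y
      (fun p => hβ.fou ν α (p.1, p.2)) (fun p => modeWeight H ν γ α lam m p.1) := by
  obtain ⟨c, hc, hcα⟩ := hspec.alpha_lower
  have ha : ∀ k, 0 < ν * α k := fun k => mul_pos hν (hc.trans_le (hcα k))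
  have hB := hβ.isFBmCurve hH
  have hG : 0 < Real.Gamma (H + 1) := Real.Gamma_pos_of_pos (by linarith [hH.1])
  have hamp : ∀ k, 0 ≤ amplitude H ν lam k := fun k => by unfold amplitude; positivity
  have hw : ∀ k, 1 ≤ waveNorm k := one_le_waveNorm
  have hj : ∀ (j : Fin (m + 1)) (σ : Fin (j : ℕ) → Fin 2) (p : halfLattice × Bool) x,
      |jetEval j σ x ((2 * amplitude H ν lam p.1) • trigMode m p.1 p.2)| ≤
        2 * amplitude H ν lam p.1 * waveNorm p.1 ^ m := by
    intro j σ p x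
    rw [map_smul, smul_eq_mul, abs_mul, abs_of_nonneg (by have := hamp p.1; positivity)]
    exact mul_le_mul_of_nonneg_left (abs_jetEval_trigMode_le j σ x p.1 p.2)
      (by have := hamp p.1; positivity)
  set Cy := 2 * √(2 * (1 / 4)) * (1 + Real.Gamma (H + 1)) with hCy
  have hCy0 : 0 ≤ Cy := by positivity
  have hY : ∀ (p : halfLattice × Bool) t,
      ‖hβ.fou ν α (p.1, p.2) t‖ ≤ Cy * (ν * α p.1) ^ (-H) := by
    intro p t
    refine ((hB (p.1, p.2)).norm_fouCurve_le (ha p.1) t).trans ?_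
    refine mul_le_mul_of_nonneg_right ?_ (Real.rpow_nonneg (ha p.1).le _)
    rw [hCy]
    have := Real.sqrt_nonneg (2 * (1 / 4) : ℝ)
    nlinarith
  refine ⟨fun p => (hy p).continuous, fun p => (hy p).measurable,
    fun p t => ((hy p).ae_eq t).symm, fun p t => ?_, fun p q hpq s t => ?_, fun p => ?_, ?_,
    fun j σ p t x => ?_, fun j σ p s t x x' δ hst hxx => ?_⟩
  · exact (hB _).fouCurve_mem (ha p.1) hβ.isClosed_space (fun t => hβ.curve_mem_space _ t) t
  · exact inner_fouCurve_fouCurve_eq_zero (hB _) (hB _) (ha p.1) (ha q.1)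
      (fun s t => hβ.inner_curve_half hpq s t) s t
  · unfold modeWeight
    positivity
  · have h1 : Summable fun k : halfLattice => modeWeight H ν γ α lam m k :=
      hsum.comp_injective Subtype.val_injective
    have h2 : Summable fun p : halfLattice × Bool =>
        modeWeight H ν γ α lam m p.1 * (1 : ℝ) :=
      h1.mul_of_nonneg (g := fun _ : Bool => (1 : ℝ)) (Summable.of_finite)
        (fun k => by unfold modeWeight; positivity) (fun _ => zero_le_one)
    simpa using h2
  · set A := amplitude H ν lam p.1
    have hA : 0 ≤ A := hamp p.1
    have hk : 0 ≤ waveNorm p.1 := zero_le_one.trans (hw p.1)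
    have hγ1 : 1 ≤ waveNorm p.1 ^ γ := Real.one_le_rpow (hw p.1) hγ.1.le
    have ha0 := Real.rpow_nonneg (ha p.1).le (-H)
    have h1 : ‖jetEval j σ x ((2 * A) • trigMode m p.1 p.2) • hβ.fou ν α (p.1, p.2) t‖ ≤
        2 * A * Cy * (waveNorm p.1 ^ m * waveNorm p.1 ^ γ * (ν * α p.1) ^ (-H)) := by
      rw [norm_smul]
      calc _ ≤ 2 * A * waveNorm p.1 ^ m * (Cy * (ν * α p.1) ^ (-H)) :=
            mul_le_mul (hj j σ p x) (hY p t) (norm_nonneg _) (by positivity)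
        _ = 2 * A * Cy * (waveNorm p.1 ^ m * 1 * (ν * α p.1) ^ (-H)) := by ring
        _ ≤ _ := by gcongr
    refine (pow_le_pow_left₀ (norm_nonneg _) h1 2).trans ?_
    unfold modeWeight
    rw [← hCy]
    set X := waveNorm p.1 ^ m * waveNorm p.1 ^ γ * (ν * α p.1) ^ (-H)
    set Z := waveNorm p.1 ^ m * (ν * α p.1) ^ (γ - H)
    have h3 : 0 ≤ (Cy * A * X) ^ 2 := sq_nonneg _
    have h4 : 0 ≤ (Cy * A * Z) ^ 2 := sq_nonneg _
    calc (2 * A * Cy * X) ^ 2 = 4 * (Cy * A * X) ^ 2 := by ring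
      _ ≤ 128 * (Cy * A * X) ^ 2 + 128 * (Cy * A * Z) ^ 2 := by linarith
      _ = 128 * Cy ^ 2 * A ^ 2 * (X ^ 2 + Z ^ 2) := by ring
  · set A := amplitude H ν lam p.1
    have hA : 0 ≤ A := hamp p.1
    have hk : 0 ≤ waveNorm p.1 := zero_le_one.trans (hw p.1)
    have hδ : 0 ≤ δ := (abs_nonneg _).trans hst
    have ha0 := Real.rpow_nonneg (ha p.1).le (-H)
    have ha1 := Real.rpow_nonneg (ha p.1).le (γ - H)
    set g := jetEval j σ x ((2 * A) • trigMode m p.1 p.2)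
    set g' := jetEval j σ x' ((2 * A) • trigMode m p.1 p.2)
    set X := waveNorm p.1 ^ m * waveNorm p.1 ^ γ * (ν * α p.1) ^ (-H)
    set Z := waveNorm p.1 ^ m * (ν * α p.1) ^ (γ - H)
    have hX : 0 ≤ X := by positivity
    have hZ : 0 ≤ Z := by positivity
    have h1 : |g - g'| ≤ 8 * A * (waveNorm p.1 ^ m * waveNorm p.1 ^ γ) * δ ^ γ := by
      have h2 := abs_jetEval_trigMode_sub_le j σ x x' p.1 p.2 hγ.1.le hγ.2.le
      have h3 : ‖x - x'‖ ^ γ ≤ 2 * δ ^ γ := by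
        refine (Real.rpow_le_rpow (norm_nonneg _) hxx hγ.1.le).trans ?_
        rw [Real.mul_rpow zero_le_two hδ]
        refine mul_le_mul_of_nonneg_right ?_ (by positivity)
        simpa using Real.rpow_le_rpow_of_exponent_le one_le_two hγ.2.le
      have h4 : g - g' = 2 * A * (jetEval j σ x (trigMode m p.1 p.2) -
          jetEval j σ x' (trigMode m p.1 p.2)) := by
        simp only [g, g', map_smul, smul_eq_mul]
        ring
      rw [h4, abs_mul, abs_of_nonneg (by positivity)]
      calc _ ≤ 2 * A * (waveNorm p.1 ^ m * (2 * (waveNorm p.1 ^ γ * (2 * δ ^ γ)))) := by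
            refine mul_le_mul_of_nonneg_left (h2.trans ?_) (by positivity)
            gcongr
        _ = _ := by ring
    have h5 : ‖hβ.fou ν α (p.1, p.2) s - hβ.fou ν α (p.1, p.2) t‖ ≤
        Cy * (ν * α p.1) ^ (γ - H) * δ ^ γ := by
      refine ((hB (p.1, p.2)).norm_fouCurve_sub_le_rpow (ha p.1) hγ.1.le hγH s t).trans ?_
      have := Real.rpow_le_rpow (abs_nonneg _) hst hγ.1.le
      exact mul_le_mul_of_nonneg_left this (by positivity)
    have h6 : ‖g • hβ.fou ν α (p.1, p.2) s - g' • hβ.fou ν α (p.1, p.2) t‖ ≤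
        8 * A * Cy * (X + Z) * δ ^ γ := by
      have h7 : g • hβ.fou ν α (p.1, p.2) s - g' • hβ.fou ν α (p.1, p.2) t =
          (g - g') • hβ.fou ν α (p.1, p.2) s +
            g' • (hβ.fou ν α (p.1, p.2) s - hβ.fou ν α (p.1, p.2) t) := by
        rw [sub_smul, smul_sub]; abel
      rw [h7]
      refine (norm_add_le _ _).trans ?_
      rw [norm_smul, norm_smul]
      calc _ ≤ 8 * A * (waveNorm p.1 ^ m * waveNorm p.1 ^ γ) * δ ^ γ * (Cy * (ν * α p.1) ^ (-H)) +
            2 * A * waveNorm p.1 ^ m * (Cy * (ν * α p.1) ^ (γ - H) * δ ^ γ) :=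
            add_le_add (mul_le_mul h1 (hY p s) (norm_nonneg _) (by positivity))
              (mul_le_mul (hj j σ p x') h5 (norm_nonneg _) (by positivity))
        _ = 8 * A * Cy * X * δ ^ γ + 2 * A * Cy * Z * δ ^ γ := by simp only [X, Z]; ring
        _ ≤ _ := by
            have : 0 ≤ A * Cy * Z * δ ^ γ := by positivity
            linarith
    refine (pow_le_pow_left₀ (norm_nonneg _) h6 2).trans ?_
    unfold modeWeight
    rw [← hCy]
    change (8 * A * Cy * (X + Z) * δ ^ γ) ^ 2 ≤ 128 * Cy ^ 2 * A ^ 2 * (X ^ 2 + Z ^ 2) * (δ ^ γ) ^ 2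
    -- The constant is `128 = 2 · 8²`, from `(X + Z)² ≤ 2 (X² + Z²)`.
    have h8 : 0 ≤ (A * Cy * δ ^ γ) ^ 2 * (X - Z) ^ 2 := by positivity
    nlinarith

end Construction

/-! ### Fourier coefficients of the stationary solution -/

section Coefficients

variable {m : ℕ}

theorem coeff_neg (n : Fin 2 → ℤ) (f : CmTorus m) : coeff (-n) f = starRingEnd ℂ (coeff n f) := by
  have h : ∀ l, coeff l f = ∫ x, starRingEnd ℂ (UnitAddTorus.mFourier l x) * (f.toCont x : ℂ)
      ∂torusMeasure := by
    intro l
    rw [coeff_apply, expBasis_apply, CmTorus.toL2, ContinuousMap.inner_toLp]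
    refine integral_congr_ae (Eventually.of_forall fun x => ?_)
    simp [mul_comm]
  rw [h, h, ← integral_conj]
  refine integral_congr_ae (Eventually.of_forall fun x => ?_)
  simp [UnitAddTorus.mFourier_neg]

theorem pathIntegral_ofReal {a : ℝ} {b₁ b₂ : ℝ → ℝ} (h₁ : Continuous b₁) (h₂ : Continuous b₂)
    (h₁0 : b₁ 0 = 0) (h₂0 : b₂ 0 = 0) (t : ℝ) :
    pathIntegral (fun u => Real.exp (-((t - u) * a))) (fun u => b₁ u + b₂ u * Complex.I) 0 t =
      ((b₁ t - ∫ u in (0 : ℝ)..t, a * Real.exp (-(a * (t - u))) * b₁ u : ℝ) : ℂ) +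
      ((b₂ t - ∫ u in (0 : ℝ)..t, a * Real.exp (-(a * (t - u))) * b₂ u : ℝ) : ℂ) * Complex.I := by
  have hd : deriv (fun u => Real.exp (-((t - u) * a))) =
      fun u => a * Real.exp (-(a * (t - u))) := by
    funext u
    have h : HasDerivAt (fun u => Real.exp (-((t - u) * a)))
        (Real.exp (-((t - u) * a)) * -((0 - 1) * a)) u := by
      refine ((((hasDerivAt_const u t).sub (hasDerivAt_id u)).mul_const a).neg).exp
    rw [h.deriv, mul_comm (t - u) a]
    ring
  rw [pathIntegral, hd]
  have h3 : (∫ u in (0 : ℝ)..t, (a * Real.exp (-(a * (t - u)))) • ((b₁ u : ℂ) + b₂ u * Complex.I)) =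
      ((∫ u in (0 : ℝ)..t, a * Real.exp (-(a * (t - u))) * b₁ u : ℝ) : ℂ) +
      ((∫ u in (0 : ℝ)..t, a * Real.exp (-(a * (t - u))) * b₂ u : ℝ) : ℂ) * Complex.I := by
    rw [← intervalIntegral.integral_ofReal, ← intervalIntegral.integral_ofReal,
      ← intervalIntegral.integral_mul_const, ← intervalIntegral.integral_add]
    · refine intervalIntegral.integral_congr fun u _ => ?_
      simp only [Complex.real_smul]
      push_cast
      ring
    · exact Continuous.intervalIntegrable (by fun_prop) _ _
    · exact Continuous.intervalIntegrable (by fun_prop) _ _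
  rw [h3]
  simp only [sub_self, zero_mul, neg_zero, Real.exp_zero, one_smul, h₁0, h₂0]
  push_cast
  simp
  ring

/-- A half lattice contains no `-l` with `l`, so only the two functions of the mode `l` contribute;
the cosine has coefficient `1/2` and minus the sine has coefficient `i/2`. -/
theorem sum_coeff_trigMode {F : Finset (halfLattice × Bool)} {l : Mode} (hl : l ∈ halfLattice)
    (hF : ∀ b, (⟨l, hl⟩, b) ∈ F) (A : Mode → ℝ) (y : halfLattice × Bool → ℝ) :
    coeff l.1 (∑ p ∈ F, y p • (2 * A p.1) • trigMode m p.1 p.2) =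
      A l * (y (⟨l, hl⟩, true) + y (⟨l, hl⟩, false) * Complex.I) := by
  have hn : ∀ k : halfLattice, l.1 ≠ (-(k : Mode)).1 := fun k h => by
    have h1 : l = -(k : Mode) := Subtype.ext h
    exact neg_notMem_halfLattice k k.2 (h1 ▸ hl)
  have hsub : ({(⟨l, hl⟩, true), (⟨l, hl⟩, false)} : Finset (halfLattice × Bool)) ⊆ F := by
    intro p hp
    simp only [Finset.mem_insert, Finset.mem_singleton] at hp
    rcases hp with rfl | rfl
    · exact hF _
    · exact hF _
  rw [map_sum, ← Finset.sum_subset hsub]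
  · rw [Finset.sum_pair (by simp)]
    simp only [map_smul, coeff_trigMode, if_neg (hn ⟨l, hl⟩), if_true, phase, Complex.real_smul]
    have h1 : Complex.exp ((Real.pi / 2 : ℝ) * Complex.I) = Complex.I := by
      push_cast; exact Complex.exp_pi_div_two_mul_I
    simp only [Bool.false_eq_true, if_false, h1]
    push_cast
    simp
    ring
  · intro p _ hp
    have h1 : l.1 ≠ p.1.1.1 := by
      intro h
      apply hp
      have h2 : p.1 = ⟨l, hl⟩ := Subtype.ext (Subtype.ext h.symm)
      obtain ⟨k, b⟩ := p
      simp only at h2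
      subst h2
      cases b <;> simp
    rw [map_smul, map_smul, coeff_trigMode, if_neg h1, if_neg (hn _)]
    simp

variable {W : Type*} [MeasurableSpace W] {μ : Measure W} [IsProbabilityMeasure μ]
  {H ν γ : ℝ} {α lam : Mode → ℝ} {β : Mode → ℝ → W → ℂ}

/-- The real (`true`) or imaginary (`false`) part of a complex number. -/
def part (b : Bool) (z : ℂ) : ℝ := if b then z.re else z.im

theorem IsNoise.fou_neg_re (hβ : IsNoise μ H β) (hα : ∀ k, α (-k) = α k) (k : Mode) (t : ℝ) :
    hβ.fou ν α (-k, true) t = hβ.fou ν α (k, true) t := by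
  simp only [IsNoise.fou, fouCurve, hα, hβ.curve_neg_re]

theorem IsNoise.fou_neg_im (hβ : IsNoise μ H β) (hα : ∀ k, α (-k) = α k) (k : Mode) (t : ℝ) :
    hβ.fou ν α (-k, false) t = -hβ.fou ν α (k, false) t := by
  simp only [IsNoise.fou, fouCurve, hα, hβ.curve_neg_im]
  rw [← integral_neg]
  refine integral_congr_ae (Eventually.of_forall fun v => ?_)
  simp only [← smul_neg]
  congr 1
  abel

/-- A process with paths in `C(ℝ, C^m(𝕋²))` whose Fourier coefficients are stationary fractional
Ornstein-Uhlenbeck processes driven by the noise. -/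
structure IsFouField (hβ : IsNoise μ H β) (ν : ℝ) (α lam : Mode → ℝ) (Ψ : W → PathSpace m) :
    Prop where
  measurable : Measurable Ψ
  coeff_zero : ∀ᵐ ω ∂μ, ∀ t, coeff 0 ((Ψ ω).at t) = 0
  part_coeff : ∀ (l : Mode) b t, (fun ω => part b (coeff l.1 ((Ψ ω).at t))) =ᵐ[μ]
    (amplitude H ν lam l • hβ.fou ν α (l, b) t : Lp ℝ 2 μ)
  equation : ∀ l : Mode, ∀ᵐ ω ∂μ, ∀ t, coeff l.1 ((Ψ ω).at t) =
    (Real.exp (-(t * ν * α l)) : ℂ) * coeff l.1 ((Ψ ω).at 0) + convCoeff H ν α lam β l t ω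

theorem part_conj (b : Bool) (z : ℂ) :
    part b (starRingEnd ℂ z) = if b then part b z else -part b z := by
  cases b <;> simp [part]

theorem convCoeff_neg (hα : ∀ k, α (-k) = α k) (hlam : ∀ k, lam (-k) = lam k) {k : Mode} {ω : W}
    (h : ∀ t, β (-k) t ω = starRingEnd ℂ (β k t ω)) (t : ℝ) :
    convCoeff H ν α lam β (-k) t ω = starRingEnd ℂ (convCoeff H ν α lam β k t ω) := by
  simp only [convCoeff, hα, hlam, pathIntegral, h, map_mul, map_sub, Complex.conj_ofReal,
    Complex.real_smul]
  rw [intervalIntegral.intervalIntegral_eq_integral_uIoc,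
    intervalIntegral.intervalIntegral_eq_integral_uIoc, Complex.real_smul, Complex.real_smul,
    map_mul, ← integral_conj, Complex.conj_ofReal]
  simp only [map_mul, Complex.conj_ofReal]

/-- The random series is summed over a half lattice. Coefficients for the other modes are
conjugates, on the one hand because the functions are real-valued, on the other because the noise
has the same symmetry. -/
theorem IsNoise.exists_fouField (hβ : IsNoise μ H β) (hH : 0 < H ∧ H < 1) (hν : 0 < ν)
    (hspec : IsSpectralData α lam) (hγ : 0 < γ ∧ γ < 1) (hγH : γ ≤ H)
    (hsum : Summable (modeWeight H ν γ α lam m)) :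
    ∃ (Ψ : W → PathSpace m) (C : ℝ), IsFouField hβ ν α lam Ψ ∧
      ∀ r : ℤ, ∃ G : W → ℝ≥0∞, Measurable G ∧ ∫⁻ ω, G ω ∂μ ≤ ENNReal.ofReal C ∧
        ∀ ω, ∀ t ∈ Set.Ico (r : ℝ) (r + 1), ‖(Ψ ω).at t‖ₑ ≤ G ω := by
  obtain ⟨c, hc, hcα⟩ := hspec.alpha_lower
  have ha : ∀ k, 0 < ν * α k := fun k => mul_pos hν (hc.trans_le (hcα k))
  choose b y hy hbc hb0 hbβ using fun p : halfLattice × Bool =>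
    hβ.exists_fou hH (p.1, p.2) (ha p.1)
  have hser := hβ.isModeSeries hH hν hspec hγ hγH hsum hy
  obtain ⟨Ψ, F, C, hΨm, hF, hΨF, hG⟩ := hser.exists_path hγ.1
  set A := amplitude H ν lam
  have hcoef : ∀ᵐ ω ∂μ, ∀ (k : halfLattice) t, coeff k.1.1 ((Ψ ω).at t) =
      A k * (y (k, true) t ω + y (k, false) t ω * Complex.I) := by
    filter_upwards [hΨF] with ω hω k t
    have h1 := ((coeff (m := m) k.1.1).continuous.tendsto _).comp (hω t)
    have hev : ∀ p, ∀ᶠ n in atTop, p ∈ F n := fun p =>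
      (hF.eventually_ge_atTop {p}).mono fun n hn => hn (Finset.mem_singleton_self p)
    refine tendsto_nhds_unique h1 (tendsto_const_nhds.congr' ?_)
    filter_upwards [hev (k, true), hev (k, false)] with n h2 h3
    exact (sum_coeff_trigMode k.2 (fun b => by cases b <;> assumption) A fun p => y p t ω).symm
  have hcoef0 : ∀ᵐ ω ∂μ, ∀ t, coeff 0 ((Ψ ω).at t) = 0 := by
    filter_upwards [hΨF] with ω hω t
    have h1 := ((coeff (m := m) 0).continuous.tendsto _).comp (hω t)
    refine tendsto_nhds_unique h1 (tendsto_const_nhds.congr fun n => ?_)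
    simp only [Function.comp_apply, map_sum, map_smul, coeff_trigMode]
    refine (Finset.sum_eq_zero fun p _ => ?_).symm
    rw [if_neg p.1.1.2.symm, if_neg (-p.1.1).2.symm]
    simp
  have hparth : ∀ (k : halfLattice) b t, (fun ω => part b (coeff k.1.1 ((Ψ ω).at t))) =ᵐ[μ]
      (A k • hβ.fou ν α (k, b) t : Lp ℝ 2 μ) := by
    intro k b t
    filter_upwards [hcoef, (hy (k, b)).ae_eq t, Lp.coeFn_smul (A k) (hβ.fou ν α (k, b) t)]
      with ω h1 h2 h3
    rw [h1 k t, h3, Pi.smul_apply, IsNoise.fou, ← h2]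
    cases b <;> simp [part]
  have heqh : ∀ k : halfLattice, ∀ᵐ ω ∂μ, ∀ t, coeff k.1.1 ((Ψ ω).at t) =
      (Real.exp (-(t * ν * α k)) : ℂ) * coeff k.1.1 ((Ψ ω).at 0) +
        convCoeff H ν α lam β k t ω := by
    intro k
    filter_upwards [hcoef, hbβ (k, true), hbβ (k, false)] with ω h1 h2 h3 t
    have h4 : (fun u => β k u ω) = fun u => (b (k, true) u ω : ℂ) + b (k, false) u ω * Complex.I := by
      funext u
      rw [h2 u, h3 u]
      exact (Complex.re_add_im _).symm
    have h5 : (fun u => Real.exp (-((t - u) * ν * α k))) =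
        fun u => Real.exp (-((t - u) * (ν * α k))) := by
      funext u; rw [mul_assoc]
    rw [h1 k t, h1 k 0, (hy (k, true)).equation t ω, (hy (k, false)).equation t ω, convCoeff, h4, h5,
      pathIntegral_ofReal (hbc _ ω) (hbc _ ω) (hb0 _ ω) (hb0 _ ω)]
    simp only [A, amplitude]
    rw [show -(t * ν * α k) = -(ν * α k * t) by ring]
    push_cast
    ring
  refine ⟨Ψ, C, ⟨hΨm, hcoef0, fun l b t => ?_, fun l => ?_⟩, hG⟩
  · rcases mem_halfLattice_or l with hl | hl
    · exact hparth ⟨l, hl⟩ b t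
    · have h1 := hparth ⟨-l, hl⟩ b t
      have h2 : A (-l) = A l := by simp only [A, amplitude, hspec.lam_neg]
      have h3 : ∀ ω, part b (coeff l.1 ((Ψ ω).at t)) =
          if b then part b (coeff (-l).1 ((Ψ ω).at t)) else -part b (coeff (-l).1 ((Ψ ω).at t)) := by
        intro ω
        have : l.1 = -(-l).1 := (neg_neg l.1).symm
        rw [← part_conj, ← coeff_neg, ← this]
      simp only [h3]
      cases b
      · have h4 : hβ.fou ν α (l, false) t = -hβ.fou ν α (-l, false) t := by
          rw [hβ.fou_neg_im hspec.alpha_neg, neg_neg]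
        rw [h4, smul_neg]
        filter_upwards [h1, Lp.coeFn_neg (A l • hβ.fou ν α (-l, false) t)] with ω h5 h6
        simp only [h2] at h5
        rw [h6, Pi.neg_apply, ← h5]
        simp
      · rw [← hβ.fou_neg_re hspec.alpha_neg]
        simp only [h2] at h1
        simpa using h1
  · rcases mem_halfLattice_or l with hl | hl
    · exact heqh ⟨l, hl⟩
    · filter_upwards [heqh ⟨-l, hl⟩, hβ.conj l] with ω h1 h2 t
      have h3 : l.1 = -(-l).1 := (neg_neg l.1).symm
      have h4 : convCoeff H ν α lam β l t ω =
          starRingEnd ℂ (convCoeff H ν α lam β (-l) t ω) := by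
        rw [convCoeff_neg hspec.alpha_neg hspec.lam_neg h2, Complex.conj_conj]
      rw [h4, h3, coeff_neg, coeff_neg, h1 t, hspec.alpha_neg, map_add, map_mul, Complex.conj_ofReal]

end Coefficients

/-! ### The law of the stationary solution -/

section Law

variable {W : Type*} [MeasurableSpace W] {μ : Measure W} [IsProbabilityMeasure μ]
  {H ν : ℝ} {m : ℕ} {α lam : Mode → ℝ} {β : Mode → ℝ → W → ℂ}

/-- Reduces every covariance between components, including those of `k` and `-k`, to the
autocovariance of a single curve. -/
theorem IsNoise.fou_orthogonal_or_smul (hβ : IsNoise μ H β) (hH : 0 < H ∧ H < 1)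
    (ha : ∀ k, 0 < ν * α k) (hα : ∀ k, α (-k) = α k) (p q : Mode × Bool) :
    (∀ s t, inner ℝ (hβ.fou ν α p s) (hβ.fou ν α q t) = 0) ∨
      ∃ ε : ℝ, ∀ t, hβ.fou ν α q t = ε • hβ.fou ν α p t := by
  have hB := hβ.isFBmCurve hH
  have horth : (∀ s t, inner ℝ (hβ.curve p s) (hβ.curve q t) = 0) →
      ∀ s t, inner ℝ (hβ.fou ν α p s) (hβ.fou ν α q t) = 0 := fun h s t =>
    inner_fouCurve_fouCurve_eq_zero (hB p) (hB q) (ha _) (ha _) h s t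
  obtain ⟨k, b⟩ := p
  obtain ⟨l, c⟩ := q
  by_cases h1 : k = l
  · subst h1
    cases b <;> cases c
    · exact Or.inr ⟨1, fun t => (one_smul _ _).symm⟩
    · exact Or.inl (horth fun s t => by rw [real_inner_comm]; exact hβ.inner_re_im k t s)
    · exact Or.inl (horth fun s t => hβ.inner_re_im k s t)
    · exact Or.inr ⟨1, fun t => (one_smul _ _).symm⟩
  by_cases h2 : k = -l
  · have h3 : l = -k := by rw [h2, Mode.neg_neg]
    subst h3
    cases b <;> cases c
    · exact Or.inr ⟨-1, fun t => by rw [hβ.fou_neg_im hα, neg_one_smul]⟩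
    · refine Or.inl (horth fun s t => ?_)
      rw [hβ.curve_neg_re, real_inner_comm]
      exact hβ.inner_re_im k t s
    · refine Or.inl (horth fun s t => ?_)
      rw [hβ.curve_neg_im, inner_neg_right, hβ.inner_re_im, neg_zero]
    · exact Or.inr ⟨1, fun t => by rw [hβ.fou_neg_re hα, one_smul]⟩
  · exact Or.inl (horth fun s t => hβ.inner_curve_eq_zero h1 h2 b c s t)

theorem IsNoise.inner_fou_shift (hβ : IsNoise μ H β) (hH : 0 < H ∧ H < 1)
    (ha : ∀ k, 0 < ν * α k) (hα : ∀ k, α (-k) = α k) (p q : Mode × Bool) (s t r : ℝ) :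
    inner ℝ (hβ.fou ν α p (s + r)) (hβ.fou ν α q (t + r)) =
      inner ℝ (hβ.fou ν α p s) (hβ.fou ν α q t) := by
  rcases hβ.fou_orthogonal_or_smul hH ha hα p q with h | ⟨ε, h⟩
  · rw [h, h]
  · rw [h, h, real_inner_smul_right, real_inner_smul_right]
    congr 1
    exact (hβ.isFBmCurve hH p).inner_fouCurve_shift (ha p.1) s t r

theorem IsNoise.tendsto_inner_fou (hβ : IsNoise μ H β) (hH : 0 < H ∧ H < 1)
    (ha : ∀ k, 0 < ν * α k) (hα : ∀ k, α (-k) = α k) (p q : Mode × Bool) (s t : ℝ) :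
    Tendsto (fun r => inner ℝ (hβ.fou ν α p (s + r)) (hβ.fou ν α q t)) atTop (𝓝 0) := by
  rcases hβ.fou_orthogonal_or_smul hH ha hα p q with h | ⟨ε, h⟩
  · simp only [h]
    exact tendsto_const_nhds
  · simp only [h, real_inner_smul_right]
    rw [← mul_zero ε]
    refine Tendsto.const_mul ε ?_
    have h1 := ((hβ.isFBmCurve hH p).tendsto_inner_fouCurve (ha p.1)).comp
      (tendsto_atTop_add_const_left atTop (s - t) tendsto_id)
    refine h1.congr fun r => ?_
    have h2 := (hβ.isFBmCurve hH p).inner_fouCurve_shift (ha p.1) (s - t + r) 0 t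
    rw [show s - t + r + t = s + r by ring, zero_add] at h2
    exact h2.symm

/-- The random variable `Re (z ψ̂(t, n))` as an element of `L²`. -/
def IsNoise.modeVec (hβ : IsNoise μ H β) (ν : ℝ) (α lam : Mode → ℝ) (z : ℂ) (n : Fin 2 → ℤ) (t : ℝ) :
    Lp ℝ 2 μ :=
  if h : n ≠ 0 then amplitude H ν lam ⟨n, h⟩ •
    (z.re • hβ.fou ν α (⟨n, h⟩, true) t - z.im • hβ.fou ν α (⟨n, h⟩, false) t) else 0

theorem IsNoise.inner_modeVec_shift (hβ : IsNoise μ H β) (hH : 0 < H ∧ H < 1)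
    (ha : ∀ k, 0 < ν * α k) (hα : ∀ k, α (-k) = α k) (z w : ℂ) (n l : Fin 2 → ℤ) (s t r : ℝ) :
    inner ℝ (hβ.modeVec ν α lam z n (s + r)) (hβ.modeVec ν α lam w l (t + r)) =
      inner ℝ (hβ.modeVec ν α lam z n s) (hβ.modeVec ν α lam w l t) := by
  unfold IsNoise.modeVec
  split_ifs
  · simp only [real_inner_smul_left, real_inner_smul_right, inner_sub_left, inner_sub_right,
      hβ.inner_fou_shift hH ha hα]
  all_goals simp

theorem IsNoise.tendsto_inner_modeVec (hβ : IsNoise μ H β) (hH : 0 < H ∧ H < 1)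
    (ha : ∀ k, 0 < ν * α k) (hα : ∀ k, α (-k) = α k) (z w : ℂ) (n l : Fin 2 → ℤ) (s t : ℝ) :
    Tendsto (fun r => inner ℝ (hβ.modeVec ν α lam z n (s + r)) (hβ.modeVec ν α lam w l t))
      atTop (𝓝 0) := by
  unfold IsNoise.modeVec
  split_ifs with h1 h2
  · simp only [real_inner_smul_left, real_inner_smul_right, inner_sub_left, inner_sub_right]
    have h := fun p q => hβ.tendsto_inner_fou hH ha hα p q s t
    have := ((((h (⟨n, h1⟩, true) (⟨l, h2⟩, true)).const_mul z.re).sub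
      ((h (⟨n, h1⟩, false) (⟨l, h2⟩, true)).const_mul z.im)).const_mul w.re).sub
      ((((h (⟨n, h1⟩, true) (⟨l, h2⟩, false)).const_mul z.re).sub
      ((h (⟨n, h1⟩, false) (⟨l, h2⟩, false)).const_mul z.im)).const_mul w.im)
    have h3 := (this.const_mul (amplitude H ν lam ⟨l, h2⟩)).const_mul (amplitude H ν lam ⟨n, h1⟩)
    simp only [mul_zero, sub_zero] at h3
    refine h3.congr fun r => ?_
    ring
  all_goals simp

/-- A linear functional of the Fourier coefficients at finitely many times, shifted by `r`. -/
def IsNoise.funVec (hβ : IsNoise μ H β) (ν : ℝ) (α lam : Mode → ℝ) (I : Finset (ℝ × (Fin 2 → ℤ)))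
    (c : ℝ × (Fin 2 → ℤ) → ℂ) (r : ℝ) : Lp ℝ 2 μ :=
  ∑ p ∈ I, hβ.modeVec ν α lam (c p) p.2 (p.1 + r)

variable {I : Finset (ℝ × (Fin 2 → ℤ))} {c : ℝ × (Fin 2 → ℤ) → ℂ}

theorem IsNoise.funVec_mem (hβ : IsNoise μ H β) (hH : 0 < H ∧ H < 1) (ha : ∀ k, 0 < ν * α k) (r : ℝ) :
    hβ.funVec ν α lam I c r ∈ hβ.space := by
  have h : ∀ p t, hβ.fou ν α p t ∈ hβ.space := fun p t =>
    (hβ.isFBmCurve hH p).fouCurve_mem (ha p.1) hβ.isClosed_space (fun t => hβ.curve_mem_space _ t) t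
  refine hβ.space.sum_mem fun p _ => ?_
  unfold IsNoise.modeVec
  split_ifs
  · exact hβ.space.smul_mem _ (hβ.space.sub_mem (hβ.space.smul_mem _ (h _ _))
      (hβ.space.smul_mem _ (h _ _)))
  · exact hβ.space.zero_mem

theorem IsNoise.inner_funVec_shift (hβ : IsNoise μ H β) (hH : 0 < H ∧ H < 1)
    (ha : ∀ k, 0 < ν * α k) (hα : ∀ k, α (-k) = α k) (s r : ℝ) :
    inner ℝ (hβ.funVec ν α lam I c (s + r)) (hβ.funVec ν α lam I c r) =
      inner ℝ (hβ.funVec ν α lam I c s) (hβ.funVec ν α lam I c 0) := by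
  simp only [IsNoise.funVec, sum_inner, inner_sum]
  refine Finset.sum_congr rfl fun p _ => Finset.sum_congr rfl fun q _ => ?_
  rw [← add_assoc, hβ.inner_modeVec_shift hH ha hα, add_zero]

theorem IsNoise.norm_funVec (hβ : IsNoise μ H β) (hH : 0 < H ∧ H < 1)
    (ha : ∀ k, 0 < ν * α k) (hα : ∀ k, α (-k) = α k) (r : ℝ) :
    ‖hβ.funVec ν α lam I c r‖ = ‖hβ.funVec ν α lam I c 0‖ := by
  have h := hβ.inner_funVec_shift (lam := lam) (I := I) (c := c) hH ha hα 0 r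
  rw [zero_add, real_inner_self_eq_norm_sq, real_inner_self_eq_norm_sq] at h
  exact (pow_left_inj₀ (norm_nonneg _) (norm_nonneg _) two_ne_zero).1 h

theorem IsNoise.tendsto_inner_funVec (hβ : IsNoise μ H β) (hH : 0 < H ∧ H < 1)
    (ha : ∀ k, 0 < ν * α k) (hα : ∀ k, α (-k) = α k) :
    Tendsto (fun r => inner ℝ (hβ.funVec ν α lam I c r) (hβ.funVec ν α lam I c 0)) atTop (𝓝 0) := by
  simp only [IsNoise.funVec, sum_inner, inner_sum]
  rw [show 𝓝 (0 : ℝ) = 𝓝 (∑ _p ∈ I, ∑ _q ∈ I, 0) by simp]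
  exact tendsto_finsetSum _ fun p _ => tendsto_finsetSum _ fun q _ =>
    hβ.tendsto_inner_modeVec hH ha hα _ _ _ _ _ _

variable {hβ : IsNoise μ H β} {Ψ : W → PathSpace m}

theorem IsFouField.coeff_ae_eq (hΨ : IsFouField hβ ν α lam Ψ) (z : ℂ) (n : Fin 2 → ℤ) (t : ℝ) :
    (fun ω => (z * coeff n ((Ψ ω).at t)).re) =ᵐ[μ] hβ.modeVec ν α lam z n t := by
  unfold IsNoise.modeVec
  split_ifs with h
  · set Y := fun b => hβ.fou ν α (⟨n, h⟩, b) t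
    set A := amplitude H ν lam ⟨n, h⟩
    have h1 := hΨ.part_coeff ⟨n, h⟩ true t
    have h2 := hΨ.part_coeff ⟨n, h⟩ false t
    filter_upwards [h1, h2, Lp.coeFn_smul A (Y true), Lp.coeFn_smul A (Y false),
      Lp.coeFn_smul A (z.re • Y true - z.im • Y false), Lp.coeFn_sub (z.re • Y true) (z.im • Y false),
      Lp.coeFn_smul z.re (Y true), Lp.coeFn_smul z.im (Y false)] with ω e1 e2 e3 e4 e5 e6 e7 e8
    rw [e5, Pi.smul_apply, e6, Pi.sub_apply, e7, e8]
    rw [e3] at e1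
    rw [e4] at e2
    simp only [part, if_true, Bool.false_eq_true, if_false, Pi.smul_apply, smul_eq_mul] at *
    rw [Complex.mul_re, e1, e2]
    ring
  · push Not at h
    subst h
    filter_upwards [hΨ.coeff_zero, Lp.coeFn_zero ℝ 2 μ] with ω h1 h2
    rw [h1 t, h2]
    simp

theorem IsFouField.modeFun_ae_eq (hΨ : IsFouField hβ ν α lam Ψ) (r : ℝ) :
    (fun ω => modeFun I c (shift r (Ψ ω))) =ᵐ[μ] hβ.funVec ν α lam I c r := by
  have h : ∀ᵐ ω ∂μ, ∀ p ∈ I, (c p * coeff p.2 ((Ψ ω).at (p.1 + r))).re =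
      hβ.modeVec ν α lam (c p) p.2 (p.1 + r) ω :=
    (Finset.eventually_all _).2 fun p _ => hΨ.coeff_ae_eq _ _ _
  filter_upwards [h, Lp.coeFn_fun_finsetSum I
    fun p => hβ.modeVec ν α lam (c p) p.2 (p.1 + r)] with ω h1 h2
  rw [IsNoise.funVec, h2, modeFun]
  refine Finset.sum_congr rfl fun p hp => ?_
  rw [shift_at, add_comm r, h1 p hp]

/-- A linear functional of the coefficients is an element of the Gaussian space whose norm does not
change under shifts. So neither does its characteristic function, and this is stationarity. -/
theorem IsFouField.integral_cexp (hΨ : IsFouField hβ ν α lam Ψ) (hH : 0 < H ∧ H < 1)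
    (ha : ∀ k, 0 < ν * α k) (hα : ∀ k, α (-k) = α k) (r : ℝ) :
    ∫ ω, Complex.exp ((modeFun I c (shift r (Ψ ω)) : ℂ) * Complex.I) ∂μ =
      Complex.exp (-(‖hβ.funVec ν α lam I c 0‖ ^ 2 / 2 : ℝ)) := by
  rw [← hβ.norm_funVec hH ha hα r, ← hβ.gaussChar_of_mem_space (hβ.funVec_mem hH ha r), gaussChar]
  exact integral_congr_ae ((hΨ.modeFun_ae_eq r).fun_comp fun x : ℝ => Complex.exp (x * Complex.I))

theorem IsFouField.map_shift (hΨ : IsFouField hβ ν α lam Ψ) (hH : 0 < H ∧ H < 1)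
    (ha : ∀ k, 0 < ν * α k) (hα : ∀ k, α (-k) = α k) (r : ℝ) :
    μ.map (fun ω => shift r (Ψ ω)) = μ.map Ψ := by
  have h0 := hΨ.measurable
  have hr : Measurable fun ω => shift r (Ψ ω) := (measurable_shift_right r).comp h0
  have := Measure.isProbabilityMeasure_map (μ := μ) h0.aemeasurable
  have := Measure.isProbabilityMeasure_map (μ := μ) hr.aemeasurable
  refine path_measure_ext fun I c => ?_
  have hm : Measurable fun ψ : PathSpace m => Complex.exp ((modeFun I c ψ : ℂ) * Complex.I) := by
    have := measurable_modeFun (m := m) I c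
    fun_prop
  rw [integral_map hr.aemeasurable hm.aestronglyMeasurable,
    integral_map h0.aemeasurable hm.aestronglyMeasurable, hΨ.integral_cexp hH ha hα r]
  have h1 := hΨ.integral_cexp (I := I) (c := c) hH ha hα 0
  simp only [shift_zero, id] at h1
  exact h1.symm

/-! ### Ergodicity -/

theorem norm_setIntegral_sq_le {T : W → ℂ} (hT : MemLp T 2 μ) (A : Set W) :
    ‖∫ ω in A, T ω ∂μ‖ ^ 2 ≤ ∫ ω, ‖T ω‖ ^ 2 ∂μ := by
  have h1 : ‖∫ ω in A, T ω ∂μ‖ ≤ ∫ ω, ‖T ω‖ ∂μ :=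
    (norm_integral_le_integral_norm _).trans (setIntegral_le_integral
      (hT.integrable one_le_two).norm (Eventually.of_forall fun _ => norm_nonneg _))
  have h := variance_nonneg (fun ω => ‖T ω‖) μ
  rw [variance_eq_sub (X := fun ω => ‖T ω‖) hT.norm] at h
  have h2 : ∫ ω, ((fun ω => ‖T ω‖) ^ 2) ω ∂μ = ∫ ω, ‖T ω‖ ^ 2 ∂μ := rfl
  rw [h2] at h
  exact (pow_le_pow_left₀ (norm_nonneg _) h1 2).trans (by linarith)

/-- Averages of `e^{iX}` over a fixed event factorize for a stationary Gaussian sequence that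
decorrelates, provided that they do not depend on time. -/
theorem IsNoise.setIntegral_cexp_eq (hβ : IsNoise μ H β) {X : ℝ → Lp ℝ 2 μ}
    (hX : ∀ r, X r ∈ hβ.space) {v : ℝ} (hv : ∀ r, ‖X r‖ = v) {ρ : ℝ → ℝ}
    (hXρ : ∀ r s, inner ℝ (X (s + r)) (X r) = ρ s) (hρ : Tendsto ρ atTop (𝓝 0)) {A : Set W} {a : ℂ}
    (ha : ∀ r, ∫ ω in A, Complex.exp (X r ω * Complex.I) ∂μ = a) :
    a = μ.real A * Complex.exp (-(v ^ 2 / 2 : ℝ)) := by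
  set e : ℂ := Complex.exp (-(v ^ 2 / 2 : ℝ)) with he
  have hGX : ∀ r, gaussChar (X r) = e := fun r => by
    rw [hβ.gaussChar_of_mem_space (hX r), hv, he]
  set Z : ℝ → W → ℂ := fun r ω => Complex.exp (X r ω * Complex.I) - e
  have hexpi : ∀ r, Integrable (fun ω => Complex.exp (X r ω * Complex.I)) μ := fun r =>
    integrable_cexp (Lp.aestronglyMeasurable (X r))
  have hZm : ∀ r, MemLp (Z r) 2 μ := fun r => by
    refine MemLp.of_bound ((hexpi r).aestronglyMeasurable.sub aestronglyMeasurable_const) (1 + ‖e‖)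
      (Eventually.of_forall fun ω => (norm_sub_le _ _).trans ?_)
    rw [Complex.norm_exp_ofReal_mul_I]
  have hZA : ∀ r, ∫ ω in A, Z r ω ∂μ = a - μ.real A * e := fun r => by
    rw [integral_sub (hexpi r).integrableOn (integrable_const _), ha, setIntegral_const,
      Complex.real_smul]
  have hcov : ∀ r s, ∫ ω, Z r ω * starRingEnd ℂ (Z s ω) ∂μ =
      Complex.exp (-(‖X r - X s‖ ^ 2 / 2 : ℝ)) - e ^ 2 := by
    intro r s
    have hec : starRingEnd ℂ e = e := by rw [he, ← Complex.ofReal_neg, ← Complex.ofReal_exp, Complex.conj_ofReal]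
    have h1 : (fun ω => Z r ω * starRingEnd ℂ (Z s ω)) =ᵐ[μ] fun ω =>
        (Complex.exp ((X r - X s : Lp ℝ 2 μ) ω * Complex.I) - e * Complex.exp (X r ω * Complex.I)) -
          (e * starRingEnd ℂ (Complex.exp (X s ω * Complex.I)) - e ^ 2) := by
      filter_upwards [Lp.coeFn_sub (X r) (X s)] with ω h2
      have h3 : Complex.exp (X r ω * Complex.I) * starRingEnd ℂ (Complex.exp (X s ω * Complex.I)) =
          Complex.exp ((X r - X s : Lp ℝ 2 μ) ω * Complex.I) := by
        rw [← Complex.exp_conj, ← Complex.exp_add, h2]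
        congr 1
        simp
        ring
      rw [← h3]
      simp only [Z, map_sub, hec]
      ring
    have hconj : Integrable (fun ω => starRingEnd ℂ (Complex.exp (X s ω * Complex.I))) μ :=
      (Complex.conjCLE : ℂ →L[ℝ] ℂ).integrable_comp (hexpi s)
    have hs : ∫ ω, starRingEnd ℂ (Complex.exp (X s ω * Complex.I)) ∂μ = e := by
      rw [integral_conj]
      exact (congrArg _ (hGX s)).trans hec
    have hr : ∫ ω, Complex.exp (X r ω * Complex.I) ∂μ = e := hGX r
    have hrs : ∫ ω, Complex.exp ((X r - X s : Lp ℝ 2 μ) ω * Complex.I) ∂μ =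
        Complex.exp (-(‖X r - X s‖ ^ 2 / 2 : ℝ)) :=
      hβ.gaussChar_of_mem_space (hβ.space.sub_mem (hX r) (hX s))
    have hirs := integrable_cexp (Lp.aestronglyMeasurable (X r - X s))
    have i1 : Integrable (fun ω => Complex.exp ((X r - X s : Lp ℝ 2 μ) ω * Complex.I) -
        e * Complex.exp (X r ω * Complex.I)) μ := hirs.sub ((hexpi r).const_mul e)
    have i2 : Integrable (fun ω => e * starRingEnd ℂ (Complex.exp (X s ω * Complex.I)) - e ^ 2) μ :=
      (hconj.const_mul e).sub (integrable_const _)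
    rw [integral_congr_ae h1, integral_sub i1 i2, integral_sub hirs ((hexpi r).const_mul e),
      integral_sub (hconj.const_mul e) (integrable_const (e ^ 2)), integral_const_mul,
      integral_const_mul, hs, hr, hrs]
    simp
    ring
  -- The centred variables `Z (i R)`, `i < N`, all have the same integral over `A`. Hence the
  -- integral of their sum is `N` times the quantity to be shown zero, and it is at most the `L²`
  -- norm of the sum.
  have hbound : ∀ (N : ℕ) (R : ℝ), (N * ‖a - μ.real A * e‖) ^ 2 ≤
      ∑ i ∈ Finset.range N, ∑ j ∈ Finset.range N,
        (Complex.exp (-(‖X (i * R) - X (j * R)‖ ^ 2 / 2 : ℝ)) - e ^ 2).re := by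
    intro N R
    have hT : MemLp (fun ω => ∑ i ∈ Finset.range N, Z (i * R) ω) 2 μ :=
      memLp_finsetSum _ fun i _ => hZm _
    have h1 := norm_setIntegral_sq_le hT A
    rw [integral_finsetSum (Finset.range N) (f := fun (i : ℕ) ω => Z (i * R) ω)
      fun i _ => ((hZm (i * R)).integrable one_le_two).integrableOn] at h1
    simp only [hZA, Finset.sum_const, Finset.card_range, nsmul_eq_mul, norm_mul,
      Complex.norm_natCast] at h1
    refine h1.trans (le_of_eq ?_)
    have hZi : ∀ i j : ℕ, Integrable (fun ω => Z (i * R) ω * starRingEnd ℂ (Z (j * R) ω)) μ :=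
      fun i j => (hZm (i * R)).integrable_mul (hZm (j * R)).star
    have h2 : ∀ ω, ‖∑ i ∈ Finset.range N, Z (i * R) ω‖ ^ 2 =
        ∑ i ∈ Finset.range N, ∑ j ∈ Finset.range N,
          (Z (i * R) ω * starRingEnd ℂ (Z (j * R) ω)).re := by
      intro ω
      have h3 := Complex.mul_conj (∑ i ∈ Finset.range N, Z (i * R) ω)
      rw [Complex.normSq_eq_norm_sq, map_sum, Finset.sum_mul_sum] at h3
      have h4 := congrArg Complex.re h3
      rw [Complex.ofReal_re] at h4
      simp only [Complex.re_sum] at h4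
      exact h4.symm
    simp only [h2]
    have hre : ∀ i j : ℕ, Integrable (fun ω => (Z (i * R) ω * starRingEnd ℂ (Z (j * R) ω)).re) μ :=
      fun i j => (hZi i j).re
    rw [integral_finsetSum _ fun i _ => integrable_finsetSum _ fun j _ => hre i j]
    refine Finset.sum_congr rfl fun i _ => ?_
    rw [integral_finsetSum _ fun j _ => hre i j]
    refine Finset.sum_congr rfl fun j _ => ?_
    rw [← hcov]
    exact integral_re (hZi i j)
  -- As the spacing `R` grows, `‖X (i R) - X (j R)‖²` tends to `2v²`, so the exponential tends to
  -- `exp(-v²) = e²` and the off-diagonal covariances vanish.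
  have hlim : ∀ i j : ℕ, i ≠ j → Tendsto (fun R : ℝ =>
      (Complex.exp (-(‖X (i * R) - X (j * R)‖ ^ 2 / 2 : ℝ)) - e ^ 2).re) atTop (𝓝 0) := by
    have key : ∀ i j : ℕ, j < i → Tendsto (fun R : ℝ =>
        (Complex.exp (-(‖X (i * R) - X (j * R)‖ ^ 2 / 2 : ℝ)) - e ^ 2).re) atTop (𝓝 0) := by
      intro i j hij
      have h1 : ∀ R : ℝ, ‖X (i * R) - X (j * R)‖ ^ 2 = 2 * v ^ 2 - 2 * ρ ((i - j : ℝ) * R) := by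
        intro R
        rw [norm_sub_sq_real, hv, hv, ← hXρ (j * R) ((i - j : ℝ) * R),
          show (i - j : ℝ) * R + j * R = i * R by ring]
        ring
      have h2 : Tendsto (fun R : ℝ => ρ ((i - j : ℝ) * R)) atTop (𝓝 0) :=
        hρ.comp (tendsto_id.const_mul_atTop (sub_pos.2 (by exact_mod_cast hij)))
      have h3 : Tendsto (fun R : ℝ => Real.exp (-((2 * v ^ 2 - 2 * ρ ((i - j : ℝ) * R)) / 2)) -
          Real.exp (-(v ^ 2 / 2)) ^ 2) atTop (𝓝 0) := by
        have h4 : Continuous fun x : ℝ => Real.exp (-((2 * v ^ 2 - 2 * x) / 2)) -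
          Real.exp (-(v ^ 2 / 2)) ^ 2 := by fun_prop
        have h5 := (h4.tendsto 0).comp h2
        have h6 : Real.exp (-((2 * v ^ 2 - 2 * 0) / 2)) - Real.exp (-(v ^ 2 / 2)) ^ 2 = 0 := by
          rw [← Real.exp_nat_mul, sub_eq_zero]
          congr 1
          push_cast
          ring
        rwa [h6] at h5
      refine h3.congr fun R => ?_
      rw [h1, he]
      rw [← Complex.ofReal_neg, ← Complex.ofReal_neg, ← Complex.ofReal_exp, ← Complex.ofReal_exp,
        ← Complex.ofReal_pow, ← Complex.ofReal_sub, Complex.ofReal_re]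
    intro i j hij
    rcases lt_or_gt_of_ne hij with h | h
    · simpa only [norm_sub_rev] using key j i h
    · exact key i j h
  -- Only the diagonal remains in the limit. Quadratic growth on the left against linear growth on
  -- the right forces the quantity to vanish.
  have hfin : ∀ N : ℕ, (N * ‖a - μ.real A * e‖) ^ 2 ≤ N := by
    intro N
    have h1 : Tendsto (fun R : ℝ => ∑ i ∈ Finset.range N, ∑ j ∈ Finset.range N,
        (Complex.exp (-(‖X (i * R) - X (j * R)‖ ^ 2 / 2 : ℝ)) - e ^ 2).re) atTop
        (𝓝 (∑ i ∈ Finset.range N, ∑ j ∈ Finset.range N, if i = j then (1 - e ^ 2).re else 0)) := by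
      refine tendsto_finsetSum _ fun i _ => tendsto_finsetSum _ fun j _ => ?_
      split_ifs with h
      · subst h
        simp
      · exact hlim i j h
    refine (ge_of_tendsto' h1 (hbound N)).trans ?_
    have h2 : (1 - e ^ 2).re ≤ 1 := by
      have : e ^ 2 = ((Real.exp (-(v ^ 2 / 2)) ^ 2 : ℝ) : ℂ) := by
        rw [he, ← Complex.ofReal_neg, ← Complex.ofReal_exp, Complex.ofReal_pow]
      rw [this, Complex.sub_re, Complex.one_re, Complex.ofReal_re]
      have := sq_nonneg (Real.exp (-(v ^ 2 / 2)))
      linarith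
    calc _ = ∑ _i ∈ Finset.range N, (1 - e ^ 2).re := by
          refine Finset.sum_congr rfl fun i hi => ?_
          rw [Finset.sum_ite_eq, if_pos hi]
      _ = (N : ℝ) * (1 - e ^ 2).re := by rw [Finset.sum_const, Finset.card_range, nsmul_eq_mul]
      _ ≤ (N : ℝ) := mul_le_of_le_one_right (Nat.cast_nonneg N) h2
  have hzero : ‖a - μ.real A * e‖ = 0 := by
    by_contra hne
    have hpos : 0 < ‖a - μ.real A * e‖ ^ 2 := by positivity
    obtain ⟨N, hN⟩ := exists_nat_gt (1 / ‖a - μ.real A * e‖ ^ 2)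
    have h1 : 0 < (N : ℝ) := (by positivity : (0 : ℝ) < 1 / ‖a - μ.real A * e‖ ^ 2).trans hN
    have h2 := hfin N
    rw [div_lt_iff₀ hpos] at hN
    nlinarith
  exact sub_eq_zero.1 (norm_eq_zero.1 hzero)

/-- For an invariant `A` the integral over `A` of the exponential of a linear functional does not
change under shifts, so it factorizes by decorrelation. Thus `P` restricted to `A` and `P(A) P` have
the same characteristic functions, hence coincide, and evaluation at `A` gives `P(A) = P(A)²`. -/
theorem IsFouField.ergodic (hΨ : IsFouField hβ ν α lam Ψ) (hH : 0 < H ∧ H < 1)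
    (ha : ∀ k, 0 < ν * α k) (hα : ∀ k, α (-k) = α k) {A : Set (PathSpace m)} (hA : MeasurableSet A)
    (hinv : ∀ t, shift t ⁻¹' A = A) : μ.map Ψ A = 0 ∨ μ.map Ψ A = 1 := by
  have h0 := hΨ.measurable
  set P := μ.map Ψ with hP
  have : IsProbabilityMeasure P := Measure.isProbabilityMeasure_map (μ := μ) h0.aemeasurable
  have hm : ∀ I c, Measurable fun ψ : PathSpace m => Complex.exp ((modeFun I c ψ : ℂ) * Complex.I) := by
    intro I c
    have := measurable_modeFun (m := m) I c
    fun_prop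
  have hPr : ∀ r, P.map (shift r) = P := by
    intro r
    rw [hP, Measure.map_map (measurable_shift_right r) h0]
    exact hΨ.map_shift hH ha hα r
  have hmain : ∀ I c, ∫ ψ in A, Complex.exp ((modeFun I c ψ : ℂ) * Complex.I) ∂P =
      P.real A * ∫ ψ, Complex.exp ((modeFun I c ψ : ℂ) * Complex.I) ∂P := by
    intro I c
    have h1 : ∀ r, ∫ ω in Ψ ⁻¹' A, Complex.exp (hβ.funVec ν α lam I c r ω * Complex.I) ∂μ =
        ∫ ψ in A, Complex.exp ((modeFun I c ψ : ℂ) * Complex.I) ∂P := by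
      intro r
      have e1 : ∫ ω in Ψ ⁻¹' A, Complex.exp (hβ.funVec ν α lam I c r ω * Complex.I) ∂μ =
          ∫ ω in Ψ ⁻¹' A, Complex.exp ((modeFun I c (shift r (Ψ ω)) : ℂ) * Complex.I) ∂μ :=
        integral_congr_ae (ae_restrict_of_ae ((hΨ.modeFun_ae_eq r).symm.fun_comp
          fun x : ℝ => Complex.exp (x * Complex.I)))
      have e2 := setIntegral_map (μ := μ) (g := Ψ) (s := A)
        (f := fun ψ => Complex.exp ((modeFun I c (shift r ψ) : ℂ) * Complex.I)) hA
        ((hm I c).comp (measurable_shift_right r)).aestronglyMeasurable h0.aemeasurable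
      have e3 := setIntegral_map (μ := P) (g := shift r) (s := A)
        (f := fun ψ => Complex.exp ((modeFun I c ψ : ℂ) * Complex.I)) hA
        (hm I c).aestronglyMeasurable (measurable_shift_right r).aemeasurable
      rw [hPr, hinv] at e3
      rw [e1, e3, ← e2]
    have h2 := hβ.setIntegral_cexp_eq (fun r => hβ.funVec_mem (lam := lam) (I := I) (c := c) hH ha r)
      (fun r => hβ.norm_funVec hH ha hα r)
      (fun r s => hβ.inner_funVec_shift hH ha hα s r) (hβ.tendsto_inner_funVec hH ha hα) h1
    have h3 : ∫ ψ, Complex.exp ((modeFun I c ψ : ℂ) * Complex.I) ∂P =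
        Complex.exp (-(‖hβ.funVec ν α lam I c 0‖ ^ 2 / 2 : ℝ)) := by
      rw [hP, integral_map h0.aemeasurable (hm I c).aestronglyMeasurable]
      have h4 := hΨ.integral_cexp (I := I) (c := c) hH ha hα 0
      simpa only [shift_zero, id] using h4
    rw [h2, h3]
    congr 2
    rw [hP, measureReal_def, measureReal_def, Measure.map_apply h0 hA]
  have hrestr : P.restrict A = P A • P := by
    have : IsFiniteMeasure (P A • P) := Measure.smul_finite P (measure_ne_top P A)
    refine path_measure_ext fun I c => ?_
    rw [hmain, integral_smul_measure, measureReal_def, Complex.real_smul]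
  have h5 : P A = P A * P A := by
    have := congrArg (fun Q : Measure (PathSpace m) => Q A) hrestr
    simpa using this
  by_cases h6 : P A = 0
  · exact Or.inl h6
  · right
    have h7 := (ENNReal.mul_right_inj h6 (measure_ne_top P A)).1 ((mul_one _).trans h5)
    exact h7.symm

theorem IsFouField.isErgodicMDS (hΨ : IsFouField hβ ν α lam Ψ) (hH : 0 < H ∧ H < 1)
    (ha : ∀ k, 0 < ν * α k) (hα : ∀ k, α (-k) = α k) : IsErgodicMDS (μ.map Ψ) shift where
  prob := Measure.isProbabilityMeasure_map hΨ.measurable.aemeasurable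
  measurable := measurable_shift
  zero := shift_zero
  flow := shift_add
  preserves t A hA := by
    rw [← Measure.map_apply (measurable_shift_right t) hA,
      Measure.map_map (measurable_shift_right t) hΨ.measurable]
    exact congrArg (fun Q : Measure (PathSpace m) => Q A) (hΨ.map_shift hH ha hα t)
  ergodic A hA h := hΨ.ergodic hH ha hα hA h

end Law

/-! ### Sublinear growth of stationary paths -/

section Growth

variable {m : ℕ}

/-- The paths of sublinear growth. -/
def growthSet (m : ℕ) : Set (PathSpace m) :=
  ⋂ n : ℕ, ⋃ C : ℕ, {ψ | ∀ t, ‖ψ.at t‖ ≤ |t| / (n + 1) + C}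

theorem mem_growthSet {ψ : PathSpace m} :
    ψ ∈ growthSet m ↔ ∀ n : ℕ, ∃ C : ℕ, ∀ t, ‖ψ.at t‖ ≤ |t| / (n + 1) + C := by
  simp [growthSet]

theorem measurableSet_growthSet : MeasurableSet (growthSet m) := by
  refine MeasurableSet.iInter fun n => MeasurableSet.iUnion fun C => IsClosed.measurableSet ?_
  rw [Set.ofPred_forall]
  exact isClosed_iInter fun t => isClosed_le (continuous_at_left t).norm continuous_const

theorem shift_mem_growthSet {ψ : PathSpace m} (h : ψ ∈ growthSet m) (t : ℝ) :
    shift t ψ ∈ growthSet m := by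
  rw [mem_growthSet] at h ⊢
  intro n
  obtain ⟨C, hC⟩ := h n
  refine ⟨⌈|t|⌉₊ + C, fun s => ?_⟩
  rw [shift_at]
  have h1 : |t + s| / (n + 1) ≤ |s| / (n + 1) + |t| := by
    have h2 : |t| / ((n : ℝ) + 1) ≤ |t| := div_le_self (abs_nonneg t) (by simp)
    have h3 : |t + s| / ((n : ℝ) + 1) ≤ (|t| + |s|) / (n + 1) := by
      gcongr
      exact abs_add_le t s
    rw [add_div] at h3
    linarith
  have h4 := Nat.le_ceil |t|
  have := hC (t + s)
  push_cast
  linarith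

theorem shift_preimage_growthSet (t : ℝ) : shift t ⁻¹' growthSet m = growthSet m := by
  refine Set.Subset.antisymm (fun ψ h => ?_) fun ψ h => shift_mem_growthSet h t
  have h1 := shift_mem_growthSet (Set.mem_preimage.1 h) (-t)
  have h2 : shift (-t) (shift t ψ) = ψ := by
    have := congrFun (shift_add (m := m) t (-t)) ψ
    rw [neg_add_cancel, shift_zero] at this
    exact this.symm
  rwa [h2] at h1

/-- The supremum of the norm of a path over the unit interval. -/
def windowSup (ψ : PathSpace m) : ℝ≥0∞ := ⨆ t ∈ Set.Ico (0 : ℝ) 1, ‖ψ.at t‖ₑ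

theorem measurable_windowSup : Measurable (windowSup (m := m)) :=
  (lowerSemicontinuous_biSup fun t _ => (continuous_at_left t).enorm.lowerSemicontinuous).measurable

theorem PathSpace.exists_norm_le (ψ : PathSpace m) (R : ℝ) :
    ∃ C, ∀ t, |t| ≤ R → ‖ψ.at t‖ ≤ C := by
  obtain ⟨C, hC⟩ := (isCompact_Icc (a := -R) (b := R)).exists_bound_of_continuousOn
    (continuous_at_right ψ).continuousOn
  exact ⟨C, fun t ht => hC t (abs_le.1 ht)⟩

theorem windowSup_ne_top (ψ : PathSpace m) : windowSup ψ ≠ ∞ := by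
  obtain ⟨C, hC⟩ := ψ.exists_norm_le 1
  refine ne_top_of_le_ne_top (ENNReal.ofReal_ne_top (r := C)) (iSup₂_le fun t ht => ?_)
  rw [← ofReal_norm]
  exact ENNReal.ofReal_le_ofReal (hC t (by rw [abs_of_nonneg ht.1]; exact ht.2.le))

theorem norm_at_le_windowSup (ψ : PathSpace m) (r t : ℝ) (ht : t - r ∈ Set.Ico (0 : ℝ) 1) :
    ‖ψ.at t‖ ≤ (windowSup (shift r ψ)).toReal := by
  have h : ‖ψ.at t‖ₑ ≤ windowSup (shift r ψ) := by
    refine le_trans (le_of_eq ?_) (le_iSup₂ (f := fun s (_ : s ∈ Set.Ico (0 : ℝ) 1) =>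
      ‖(shift r ψ).at s‖ₑ) (t - r) ht)
    rw [shift_at, add_sub_cancel]
  have := ENNReal.toReal_mono (windowSup_ne_top _) h
  rwa [toReal_enorm] at this

/-- Borel-Cantelli: by invariance the probabilities are those of `Y > j`, whose sum is finite for an
integrable `Y`. No independence is involved. -/
theorem ae_eventually_shift_le {P : Measure (PathSpace m)} (hP : IsErgodicMDS P shift)
    {Y : PathSpace m → ℝ} (hYm : Measurable Y) (hY : Integrable Y P) (hY0 : 0 ≤ Y) (r : ℕ → ℝ) :
    ∀ᵐ ψ ∂P, ∀ᶠ j : ℕ in atTop, Y (shift (r j) ψ) ≤ j := by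
  have h1 : ∑' j : ℕ, P {ψ | Y ψ ∈ Set.Ioi (j : ℝ)} ≠ ∞ := by
    let _ : MeasureSpace (PathSpace m) := ⟨P⟩
    have : IsProbabilityMeasure (volume : Measure (PathSpace m)) := hP.prob
    exact (tsum_prob_mem_Ioi_lt_top hY hY0).ne
  have h2 : ∑' j : ℕ, P (shift (r j) ⁻¹' {ψ | Y ψ ∈ Set.Ioi (j : ℝ)}) ≠ ∞ := by
    have h3 : ∀ j : ℕ, P (shift (r j) ⁻¹' {ψ | Y ψ ∈ Set.Ioi (j : ℝ)}) =
        P {ψ | Y ψ ∈ Set.Ioi (j : ℝ)} := fun j => hP.preserves _ _ (hYm measurableSet_Ioi)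
    rwa [tsum_congr h3]
  filter_upwards [ae_eventually_notMem h2] with ψ h3
  filter_upwards [h3] with j h4
  exact not_lt.1 h4

/-- Applied to `n + 1` times the window supremum at the times `±j`, Borel-Cantelli bounds the path
by about `|t| / (n + 1)` far out. On the remaining compact interval continuity suffices. -/
theorem isGrowthSet_growthSet {P : Measure (PathSpace m)} (hP : IsErgodicMDS P shift)
    (hs : ∫⁻ ψ, windowSup ψ ∂P ≠ ∞) : IsGrowthSet P (growthSet m) where
  measurableSet := measurableSet_growthSet
  invariant := shift_preimage_growthSet
  full := by
    have := hP.prob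
    rw [prob_compl_eq_zero_iff measurableSet_growthSet |>.symm, ← mem_ae_iff]
    have h1 : ∀ n : ℕ, ∀ᵐ ψ ∂P, ∃ C : ℕ, ∀ t, ‖ψ.at t‖ ≤ |t| / (n + 1) + C := by
      intro n
      have hn : 0 < (n : ℝ) + 1 := by positivity
      have hYm : Measurable fun ψ : PathSpace m => (n + 1) * (windowSup ψ).toReal :=
        measurable_windowSup.ennreal_toReal.const_mul _
      have hY : Integrable (fun ψ : PathSpace m => (n + 1) * (windowSup ψ).toReal) P :=
        (integrable_toReal_of_lintegral_ne_top measurable_windowSup.aemeasurable hs).const_mul _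
      have hY0 : 0 ≤ fun ψ : PathSpace m => (n + 1) * (windowSup ψ).toReal :=
        fun ψ => by positivity
      filter_upwards [ae_eventually_shift_le hP hYm hY hY0 fun j => (j : ℝ),
        ae_eventually_shift_le hP hYm hY hY0 fun j => -(j : ℝ)] with ψ h2 h3
      obtain ⟨J, hJ⟩ := eventually_atTop.1 (h2.and h3)
      obtain ⟨B, hB⟩ := ψ.exists_norm_le (J + 1)
      -- The added 1 covers the error of replacing `t` by its integer part; likewise `|t| > J + 1`
      -- ensures that the integer part has absolute value at least `J`.
      refine ⟨⌈B⌉₊ + 1, fun t => ?_⟩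
      have hB' := Nat.le_ceil B
      push_cast
      by_cases ht : |t| ≤ J + 1
      · have h4 : 0 ≤ |t| / ((n : ℝ) + 1) := by positivity
        linarith [hB t ht]
      · have h5 : |(⌊t⌋ : ℝ)| ≤ |t| + 1 := by
          have := abs_sub_abs_le_abs_sub (⌊t⌋ : ℝ) t
          have h6 : |(⌊t⌋ : ℝ) - t| ≤ 1 := by
            rw [abs_sub_comm, Int.self_sub_floor, abs_of_nonneg (Int.fract_nonneg t)]
            exact (Int.fract_lt_one t).le
          linarith
        have h7 : (J : ℝ) ≤ ⌊t⌋.natAbs := by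
          have := abs_sub_abs_le_abs_sub t (⌊t⌋ : ℝ)
          have h6 : |t - ⌊t⌋| ≤ 1 := by
            rw [Int.self_sub_floor, abs_of_nonneg (Int.fract_nonneg t)]
            exact (Int.fract_lt_one t).le
          rw [Nat.cast_natAbs, Int.cast_abs]
          linarith [not_le.1 ht]
        have h8 : (n + 1) * (windowSup (shift (⌊t⌋ : ℝ) ψ)).toReal ≤ |(⌊t⌋ : ℝ)| := by
          have h9 := hJ ⌊t⌋.natAbs (by exact_mod_cast h7)
          rcases Int.natAbs_eq ⌊t⌋ with h | h
          · rw [← Int.cast_abs, ← Nat.cast_natAbs]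
            have h10 : (⌊t⌋ : ℝ) = (⌊t⌋.natAbs : ℝ) := by
              simpa only [Int.cast_natCast] using congrArg (Int.cast (R := ℝ)) h
            conv_lhs => rw [h10]
            exact h9.1
          · rw [← Int.cast_abs, ← Nat.cast_natAbs]
            have h10 : (⌊t⌋ : ℝ) = -(⌊t⌋.natAbs : ℝ) := by
              simpa only [Int.cast_neg, Int.cast_natCast] using congrArg (Int.cast (R := ℝ)) h
            conv_lhs => rw [h10]
            exact h9.2
        have h11 := norm_at_le_windowSup ψ ⌊t⌋ t
          (by rw [Int.self_sub_floor]; exact ⟨Int.fract_nonneg t, Int.fract_lt_one t⟩)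
        have h12 : (windowSup (shift (⌊t⌋ : ℝ) ψ)).toReal ≤ (|t| + 1) / (n + 1) := by
          rw [le_div_iff₀ hn]
          linarith
        have h13 : 1 / ((n : ℝ) + 1) ≤ 1 := by
          rw [div_le_one hn]
          simp
        have h14 : (0 : ℝ) ≤ ⌈B⌉₊ := Nat.cast_nonneg _
        rw [add_div] at h12
        linarith
    filter_upwards [ae_all_iff.2 h1] with ψ h
    exact mem_growthSet.2 h
  growth ψ hψ δ hδ := by
    obtain ⟨n, hn⟩ := exists_nat_one_div_lt hδ
    obtain ⟨C, hC⟩ := mem_growthSet.1 hψ n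
    refine ⟨C + 1, by positivity, fun t => (hC t).trans ?_⟩
    have : |t| / ((n : ℝ) + 1) ≤ δ * |t| := by
      rw [div_eq_mul_one_div, mul_comm]
      exact mul_le_mul_of_nonneg_right hn.le (abs_nonneg t)
    linarith

end Growth

/-! ### The stationary mild solution -/

section Semigroup

variable {ν : ℝ} {α : Mode → ℝ}

theorem enorm_sq_eq_tsum (f : L2Torus) :
    ‖f‖ₑ ^ 2 = ∑' n, ‖(inner ℂ (expBasis n) f : ℂ)‖ₑ ^ 2 := by
  have h1 : HasSum (fun n => ‖(inner ℂ (expBasis n) f : ℂ)‖ ^ 2) (‖f‖ ^ 2) := by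
    have h2 := Complex.hasSum_re (expBasis.hasSum_inner_mul_inner f f)
    rw [inner_self_eq_norm_sq_to_K] at h2
    convert h2 using 1
    · funext n
      rw [← inner_conj_symm f (expBasis n), mul_comm, Complex.mul_conj, Complex.ofReal_re,
        Complex.normSq_eq_norm_sq]
    · norm_cast
  have h3 : ∀ {E : Type} [NormedAddCommGroup E] (x : E), ‖x‖ₑ ^ 2 = ENNReal.ofReal (‖x‖ ^ 2) := by
    intro E _ x
    rw [← ofReal_norm, ENNReal.ofReal_pow (norm_nonneg _)]
  rw [h3, ← h1.tsum_eq, ENNReal.ofReal_tsum_of_nonneg (fun _ => sq_nonneg _) h1.summable]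
  simp only [h3]

/-- The Fourier coefficients of `S(t) f`. -/
def semigroupCoeff (ν : ℝ) (α : Mode → ℝ) (t : ℝ) (f : L2Torus) (n : Fin 2 → ℤ) : ℂ :=
  if h : n ≠ 0 then (Real.exp (-(t * ν * α ⟨n, h⟩)) : ℂ) * inner ℂ (expBasis n) f else 0

/-- For `t ≥ 0` the factors `e^{-tνα}` are at most 1, so the coefficients are square summable and
the sum defining `semigroup` really converges, instead of taking its default value zero. -/
theorem inner_semigroup (ha : ∀ k, 0 < ν * α k) {t : ℝ} (ht : 0 ≤ t) (f : L2Torus)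
    (n : Fin 2 → ℤ) :
    inner ℂ (expBasis n) (semigroup ν α t f) = semigroupCoeff ν α t f n := by
  have hmem : Memℓp (semigroupCoeff ν α t f) 2 := by
    have h0 : Memℓp (fun n => expBasis.repr f n) 2 := lp.memℓp (expBasis.repr f)
    refine h0.mono' fun n => ?_
    rw [expBasis.repr_apply_apply, semigroupCoeff]
    split_ifs with h
    · rw [norm_mul, Complex.norm_real, Real.norm_of_nonneg (Real.exp_pos _).le]
      refine mul_le_of_le_one_left (norm_nonneg _) (Real.exp_le_one_iff.2 ?_)
      rw [mul_assoc]
      exact neg_nonpos.2 (mul_nonneg ht (ha _).le)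
    · simp
  have h1 := expBasis.hasSum_repr_symm ⟨_, hmem⟩
  have h2 : semigroup ν α t f = expBasis.repr.symm ⟨_, hmem⟩ := by
    rw [← (hasSum_subtype_iff_of_support_subset (s := {n : Fin 2 → ℤ | n ≠ 0}) ?_).2 h1 |>.tsum_eq,
      semigroup]
    · refine tsum_congr fun k => ?_
      have h3 : semigroupCoeff ν α t f k.1 =
          (Real.exp (-(t * ν * α k)) : ℂ) * inner ℂ (expBasis k.1) f := by
        rw [semigroupCoeff, dif_pos k.2]
      rw [expMode_eq, ← h3]
      rfl
    · intro n hn h0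
      refine hn ?_
      have : semigroupCoeff ν α t f n = 0 := by
        rw [semigroupCoeff, dif_neg (not_not.2 h0)]
      change semigroupCoeff ν α t f n • expBasis n = 0
      rw [this, zero_smul]
  rw [h2, ← expBasis.repr_apply_apply, LinearIsometryEquiv.apply_symm_apply]

theorem inner_remainder_zero (ha : ∀ k, 0 < ν * α k) {t : ℝ} (ht : 0 ≤ t) (f g : L2Torus)
    (s : Finset Mode) (c : Mode → ℂ) :
    inner ℂ (expBasis 0) (f - semigroup ν α t g - ∑ k ∈ s, c k • expMode k) =
      inner ℂ (expBasis 0) f := by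
  have h : ∑ k ∈ s, inner ℂ (expBasis 0) (c k • expMode k) = 0 :=
    Finset.sum_eq_zero fun k _ => by
      rw [inner_smul_right, expMode_eq, expBasis.orthonormal.inner_eq_zero k.2.symm, mul_zero]
  rw [inner_sub_right, inner_sub_right, inner_sum, h, inner_semigroup ha ht, semigroupCoeff,
    dif_neg (by simp), sub_zero, sub_zero]

open Classical in
theorem inner_remainder (ha : ∀ k, 0 < ν * α k) {t : ℝ} (ht : 0 ≤ t) (f g : L2Torus)
    (s : Finset Mode) (c : Mode → ℂ) (l : Mode) :
    inner ℂ (expBasis l.1) (f - semigroup ν α t g - ∑ k ∈ s, c k • expMode k) =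
      inner ℂ (expBasis l.1) f - (Real.exp (-(t * ν * α l)) : ℂ) * inner ℂ (expBasis l.1) g -
        if l ∈ s then c l else 0 := by
  have h : ∑ k ∈ s, inner ℂ (expBasis l.1) (c k • expMode k) = if l ∈ s then c l else 0 := by
    rw [← Finset.sum_ite_eq s l c]
    refine Finset.sum_congr rfl fun k _ => ?_
    rw [inner_smul_right, expMode_eq, orthonormal_iff_ite.1 expBasis.orthonormal]
    simp only [Subtype.val_inj, mul_ite, mul_one, mul_zero]
  rw [inner_sub_right, inner_sub_right, inner_sum, h, inner_semigroup ha ht, semigroupCoeff,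
    dif_pos l.2]

end Semigroup

/-! ### Existence and uniqueness of stationary mild solutions -/

section Solution

variable {W : Type*} [MeasurableSpace W] {μ : Measure W} [IsProbabilityMeasure μ]
  {H ν γ : ℝ} {m : ℕ} {α lam : Mode → ℝ} {β : Mode → ℝ → W → ℂ} {hβ : IsNoise μ H β}
  {Ψ Ψ' : W → PathSpace m}

/-- The contribution of the noise to the Fourier coefficients of a solution. -/
def increment (ν : ℝ) (α : Mode → ℝ) (l : Mode) (t : ℝ) (ψ : PathSpace m) : ℂ :=
  coeff l.1 (ψ.at t) - (Real.exp (-(t * ν * α l)) : ℂ) * coeff l.1 (ψ.at 0)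

theorem measurable_increment (l : Mode) (t : ℝ) :
    Measurable (increment (m := m) ν α l t) :=
  (measurable_coeff_at t _).sub ((measurable_coeff_at 0 _).const_mul _)

theorem enorm_sub_sq_le (x y : ℂ) : ‖x - y‖ₑ ^ 2 ≤ 2 * (‖x‖ₑ ^ 2 + ‖y‖ₑ ^ 2) := by
  have h3 : ∀ x : ℂ, ‖x‖ₑ ^ 2 = ENNReal.ofReal (‖x‖ ^ 2) := fun x => by
    rw [← ofReal_norm, ENNReal.ofReal_pow (norm_nonneg _)]
  rw [h3, h3, h3, ← ENNReal.ofReal_add (sq_nonneg _) (sq_nonneg _),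
    show (2 : ℝ≥0∞) = ENNReal.ofReal 2 by simp, ← ENNReal.ofReal_mul zero_le_two]
  refine ENNReal.ofReal_le_ofReal ?_
  have h4 := norm_sub_le x y
  have h5 := pow_le_pow_left₀ (norm_nonneg _) h4 2
  nlinarith [sq_nonneg (‖x‖ - ‖y‖)]

theorem lintegral_sq_eq (X : Lp ℝ 2 μ) :
    ∫⁻ ω, ENNReal.ofReal (X ω ^ 2) ∂μ = ENNReal.ofReal (‖X‖ ^ 2) := by
  rw [L2_norm_sq, ofReal_integral_eq_lintegral_ofReal (Lp.memLp X).integrable_sq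
    (Eventually.of_forall fun _ => sq_nonneg _)]

theorem IsFouField.lintegral_coeff_le (hΨ : IsFouField hβ ν α lam Ψ) (hH : 0 < H ∧ H < 1)
    (hγ : 0 ≤ γ) (ha : ∀ k, 0 < ν * α k) (l : Mode) (t : ℝ) :
    ∫⁻ ω, ‖coeff l.1 ((Ψ ω).at t)‖ₑ ^ 2 ∂μ ≤ ENNReal.ofReal (modeWeight H ν γ α lam m l) := by
  set A := amplitude H ν lam l
  set C := √(2 * (1 / 4)) * Real.Gamma (H + 1) with hC
  have h1 : ∀ b, ∫⁻ ω, ENNReal.ofReal (part b (coeff l.1 ((Ψ ω).at t)) ^ 2) ∂μ ≤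
      ENNReal.ofReal ((A * (C * (ν * α l) ^ (-H))) ^ 2) := by
    intro b
    have h2 : ∫⁻ ω, ENNReal.ofReal (part b (coeff l.1 ((Ψ ω).at t)) ^ 2) ∂μ =
        ∫⁻ ω, ENNReal.ofReal ((A • hβ.fou ν α (l, b) t : Lp ℝ 2 μ) ω ^ 2) ∂μ := by
      refine lintegral_congr_ae ?_
      filter_upwards [hΨ.part_coeff l b t] with ω h
      rw [h]
    rw [h2, lintegral_sq_eq]
    refine ENNReal.ofReal_le_ofReal ?_
    rw [norm_smul, mul_pow, mul_pow, Real.norm_eq_abs, sq_abs]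
    refine mul_le_mul_of_nonneg_left (pow_le_pow_left₀ (norm_nonneg _) ?_ 2) (sq_nonneg _)
    exact (hβ.isFBmCurve hH (l, b)).norm_fouCurve_le (ha l) t
  have h3 : ∀ z : ℂ, ‖z‖ₑ ^ 2 =
      ENNReal.ofReal (part true z ^ 2) + ENNReal.ofReal (part false z ^ 2) := by
    intro z
    rw [← ofReal_norm, ← ENNReal.ofReal_pow (norm_nonneg _),
      ← ENNReal.ofReal_add (sq_nonneg _) (sq_nonneg _), ← Complex.normSq_eq_norm_sq,
      Complex.normSq_apply]
    simp [part, sq]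
  have hm : Measurable fun ω => ENNReal.ofReal (part true (coeff l.1 ((Ψ ω).at t)) ^ 2) := by
    have := (measurable_coeff_at t l.1).comp hΨ.measurable
    simp only [part, if_true]
    exact ((Complex.measurable_re.comp this).pow_const 2).ennreal_ofReal
  simp only [h3]
  rw [lintegral_add_left hm]
  refine (add_le_add (h1 true) (h1 false)).trans ?_
  rw [← ENNReal.ofReal_add (sq_nonneg _) (sq_nonneg _)]
  refine ENNReal.ofReal_le_ofReal ?_
  have hw := one_le_waveNorm l
  have hΓ : 0 < Real.Gamma (H + 1) := Real.Gamma_pos_of_pos (by linarith [hH.1])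
  have hC0 : 0 ≤ C := by positivity
  have hp : 0 ≤ (ν * α l) ^ (-H) := Real.rpow_nonneg (ha l).le _
  have hCC : C ≤ 2 * √(2 * (1 / 4)) * (1 + Real.Gamma (H + 1)) := by
    have : 0 ≤ √(2 * (1 / 4) : ℝ) := Real.sqrt_nonneg _
    rw [hC]
    nlinarith
  have hw1 : (1 : ℝ) ≤ waveNorm l ^ m * waveNorm l ^ γ :=
    one_le_mul_of_one_le_of_one_le (one_le_pow₀ hw) (Real.one_le_rpow hw hγ)
  have h4 : (A * (C * (ν * α l) ^ (-H))) ^ 2 ≤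
      (2 * √(2 * (1 / 4)) * (1 + Real.Gamma (H + 1))) ^ 2 * A ^ 2 *
        (waveNorm l ^ m * waveNorm l ^ γ * (ν * α l) ^ (-H)) ^ 2 := by
    rw [mul_pow, mul_pow, mul_left_comm, ← mul_assoc]
    gcongr
    exact le_mul_of_one_le_left hp hw1
  have h5 : 0 ≤ (2 * √(2 * (1 / 4)) * (1 + Real.Gamma (H + 1))) ^ 2 * A ^ 2 *
      (waveNorm l ^ m * (ν * α l) ^ (γ - H)) ^ 2 := by positivity
  have h6 := sq_nonneg (A * (C * (ν * α l) ^ (-H)))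
  rw [modeWeight]
  linarith

theorem IsFouField.lintegral_increment_le (hΨ : IsFouField hβ ν α lam Ψ) (hH : 0 < H ∧ H < 1)
    (hγ : 0 ≤ γ) (ha : ∀ k, 0 < ν * α k) (l : Mode) {t : ℝ} (ht : 0 ≤ t) :
    ∫⁻ ω, ‖increment ν α l t (Ψ ω)‖ₑ ^ 2 ∂μ ≤
      ENNReal.ofReal (4 * modeWeight H ν γ α lam m l) := by
  have hm : ∀ t, Measurable fun ω => ‖coeff l.1 ((Ψ ω).at t)‖ₑ ^ 2 := fun t =>
    ((measurable_coeff_at t l.1).comp hΨ.measurable).enorm.pow_const 2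
  calc ∫⁻ ω, ‖increment ν α l t (Ψ ω)‖ₑ ^ 2 ∂μ
      ≤ ∫⁻ ω, 2 * (‖coeff l.1 ((Ψ ω).at t)‖ₑ ^ 2 + ‖coeff l.1 ((Ψ ω).at 0)‖ₑ ^ 2) ∂μ := by
        refine lintegral_mono fun ω => (enorm_sub_sq_le _ _).trans ?_
        gcongr
        rw [enorm_mul]
        refine mul_le_of_le_one_left' ?_
        rw [← ofReal_norm, Complex.norm_real, Real.norm_of_nonneg (Real.exp_pos _).le]
        refine ENNReal.ofReal_le_one.2 (Real.exp_le_one_iff.2 ?_)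
        rw [mul_assoc]
        exact neg_nonpos.2 (mul_nonneg ht (ha _).le)
    _ ≤ 2 * (ENNReal.ofReal (modeWeight H ν γ α lam m l) +
          ENNReal.ofReal (modeWeight H ν γ α lam m l)) := by
        rw [lintegral_const_mul' _ _ ENNReal.ofNat_ne_top, lintegral_add_left (hm t)]
        gcongr <;> exact hΨ.lintegral_coeff_le hH hγ ha l _
    _ = _ := by
        rw [← two_mul, ← mul_assoc, ENNReal.ofReal_mul (by norm_num)]
        norm_num

/-- By Parseval the mean square remainder after the modes in `s` is the sum over `l ∉ s` of the mean
squares of the increments, the tail of a series dominated by the mode weights. -/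
theorem IsFouField.tendsto_remainder (hΨ : IsFouField hβ ν α lam Ψ) (hH : 0 < H ∧ H < 1)
    (hγ : 0 ≤ γ) (ha : ∀ k, 0 < ν * α k) (hsum : Summable (modeWeight H ν γ α lam m)) {t : ℝ} (ht : 0 ≤ t) :
    Tendsto (fun s : Finset Mode =>
      ∫⁻ ω, ‖((Ψ ω).at t).toL2 - semigroup ν α t ((Ψ ω).at 0).toL2
        - ∑ k ∈ s, convCoeff H ν α lam β k t ω • expMode k‖ₑ ^ 2 ∂μ) atTop (𝓝 0) := by
  classical
  have hfin : ∑' l : Mode, ∫⁻ ω, ‖increment ν α l t (Ψ ω)‖ₑ ^ 2 ∂μ ≠ ∞ :=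
    ne_top_of_le_ne_top ((hsum.mul_left 4).tsum_ofReal_ne_top)
      (ENNReal.tsum_le_tsum fun l => hΨ.lintegral_increment_le hH hγ ha l ht)
  refine (ENNReal.tendsto_tsum_compl_atTop_zero hfin).congr fun s => ?_
  have hm : ∀ l : Mode, Measurable fun ω => ‖increment ν α l t (Ψ ω)‖ₑ ^ 2 := fun l =>
    ((measurable_increment l t).comp hΨ.measurable).enorm.pow_const 2
  rw [← lintegral_tsum fun l : {l // l ∉ s} => (hm l).aemeasurable]
  refine lintegral_congr_ae ?_
  have heq : ∀ᵐ ω ∂μ, ∀ l : Mode, increment ν α l t (Ψ ω) = convCoeff H ν α lam β l t ω := by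
    refine ae_all_iff.2 fun l => ?_
    filter_upwards [hΨ.equation l] with ω h
    rw [increment, h t, add_sub_cancel_left]
  filter_upwards [heq, hΨ.coeff_zero] with ω h1 h2
  rw [enorm_sq_eq_tsum]
  set V := ((Ψ ω).at t).toL2 - semigroup ν α t ((Ψ ω).at 0).toL2
        - ∑ k ∈ s, convCoeff H ν α lam β k t ω • expMode k
  have hsupp : Function.support (fun n => ‖(inner ℂ (expBasis n) V : ℂ)‖ₑ ^ 2) ⊆
      Set.range fun l : {l : Mode // l ∉ s} => l.1.1 := by
    intro n hn
    by_cases h0 : n = 0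
    · refine absurd ?_ hn
      subst h0
      have h3 : (inner ℂ (expBasis 0) V : ℂ) = coeff 0 ((Ψ ω).at t) :=
        inner_remainder_zero ha ht _ _ s _
      simp [h3, h2 t]
    · refine ⟨⟨⟨n, h0⟩, fun hs => hn ?_⟩, rfl⟩
      have h3 : (inner ℂ (expBasis n) V : ℂ) = increment ν α ⟨n, h0⟩ t (Ψ ω) -
          if (⟨n, h0⟩ : Mode) ∈ s then convCoeff H ν α lam β ⟨n, h0⟩ t ω else 0 :=
        inner_remainder ha ht _ _ s _ ⟨n, h0⟩
      simp [h3, hs, h1]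
  have hinj : Function.Injective fun l : {l : Mode // l ∉ s} => l.1.1 :=
    Subtype.val_injective.comp Subtype.val_injective
  rw [← hinj.tsum_eq hsupp]
  refine tsum_congr fun l => ?_
  have h3 : (inner ℂ (expBasis l.1.1) V : ℂ) = increment ν α l.1 t (Ψ ω) -
      if l.1 ∈ s then convCoeff H ν α lam β l.1 t ω else 0 :=
    inner_remainder ha ht _ _ s _ l.1
  rw [h3, if_neg l.2, sub_zero]

theorem IsFouField.isStationaryMildSolution (hΨ : IsFouField hβ ν α lam Ψ) (hH : 0 < H ∧ H < 1)
    (hγ : 0 ≤ γ) (ha : ∀ k, 0 < ν * α k) (hα : ∀ k, α (-k) = α k)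
    (hsum : Summable (modeWeight H ν γ α lam m)) :
    IsStationaryMildSolution μ H ν α lam β Ψ where
  measurable := hΨ.measurable.aemeasurable
  mean_zero t := by
    filter_upwards [hΨ.coeff_zero] with ω h
    have := h t
    rw [coeff_zero_eq] at this
    exact_mod_cast this
  mild t ht := hΨ.tendsto_remainder hH hγ ha hsum ht
  stationary n t r := by
    have hm : Measurable fun (ψ : PathSpace m) (i : Fin n) => ψ.at (t i) :=
      measurable_pi_lambda _ fun i => (continuous_at_left (t i)).measurable
    have h1 := congrArg (Measure.map fun (ψ : PathSpace m) (i : Fin n) => ψ.at (t i))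
      (hΨ.map_shift hH ha hα r)
    have h2 : Measurable fun ω => shift r (Ψ ω) := (measurable_shift_right r).comp hΨ.measurable
    rw [Measure.map_map hm h2,
      Measure.map_map hm hΨ.measurable] at h1
    simpa only [Function.comp_def, shift_at, add_comm r] using h1

/-! ### Uniqueness of the stationary law -/

theorem IsStationaryMildSolution.coeff_zero (h : IsStationaryMildSolution μ H ν α lam β Ψ') (t : ℝ) :
    ∀ᵐ ω ∂μ, coeff 0 ((Ψ' ω).at t) = 0 := by
  filter_upwards [h.mean_zero t] with ω h1
  rw [coeff_zero_eq, h1, Complex.ofReal_zero]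

/-- Once `l ∈ s`, the coefficient at `l` of the remainder no longer depends on `s`, while the
remainder tends to zero in mean square. So the increment of any mild solution equals the noise term,
and two solutions share it. -/
theorem IsStationaryMildSolution.increment_ae_eq (h : IsStationaryMildSolution μ H ν α lam β Ψ')
    (hΨ : IsFouField hβ ν α lam Ψ) (ha : ∀ k, 0 < ν * α k) (l : Mode) {t : ℝ} (ht : 0 ≤ t) :
    (fun ω => increment ν α l t (Ψ' ω)) =ᵐ[μ] fun ω => increment ν α l t (Ψ ω) := by
  classical
  have heq : ∀ᵐ ω ∂μ, increment ν α l t (Ψ ω) = convCoeff H ν α lam β l t ω := by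
    filter_upwards [hΨ.equation l] with ω h
    rw [increment, h t, add_sub_cancel_left]
  have hle : ∀ s : Finset Mode, l ∈ s →
      ∫⁻ ω, ‖increment ν α l t (Ψ' ω) - increment ν α l t (Ψ ω)‖ₑ ^ 2 ∂μ ≤
      ∫⁻ ω, ‖((Ψ' ω).at t).toL2 - semigroup ν α t ((Ψ' ω).at 0).toL2
        - ∑ k ∈ s, convCoeff H ν α lam β k t ω • expMode k‖ₑ ^ 2 ∂μ := by
    intro s hs
    refine lintegral_mono_ae ?_
    filter_upwards [heq] with ω h1
    rw [enorm_sq_eq_tsum (_ - _)]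
    refine le_trans (le_of_eq ?_) (ENNReal.le_tsum l.1)
    rw [inner_remainder ha ht, if_pos hs, h1]
    rfl
  have hzero : ∫⁻ ω, ‖increment ν α l t (Ψ' ω) - increment ν α l t (Ψ ω)‖ₑ ^ 2 ∂μ = 0 := by
    refine le_antisymm (ge_of_tendsto (h.mild t ht) ?_) zero_le
    filter_upwards [eventually_ge_atTop {l}] with s hs
    exact hle s (hs (Finset.mem_singleton_self l))
  have hm : AEMeasurable (fun ω => ‖increment ν α l t (Ψ' ω) - increment ν α l t (Ψ ω)‖ₑ ^ 2) μ :=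
    (((measurable_increment l t).comp_aemeasurable h.measurable).sub
      ((measurable_increment l t).comp hΨ.measurable).aemeasurable).enorm.pow_const 2
  filter_upwards [(lintegral_eq_zero_iff' hm).1 hzero] with ω h1
  simpa [sub_eq_zero] using h1

/-- With the noise terms cancelled, the difference at time `j + t` is `e^{-(j+t)νÎ±}` times the
initial difference, with `α` that of the mode; the zero mode vanishes for both solutions. -/
theorem IsStationaryMildSolution.coeff_sub_ae_eq (h : IsStationaryMildSolution μ H ν α lam β Ψ')
    (hΨ : IsFouField hβ ν α lam Ψ) (ha : ∀ k, 0 < ν * α k) (n : Fin 2 → ℤ) (t : ℝ) :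
    ∀ᵐ ω ∂μ, Tendsto (fun j : ℕ => coeff n ((Ψ' ω).at (j + t)) - coeff n ((Ψ ω).at (j + t)))
      atTop (𝓝 0) := by
  by_cases hn : n = 0
  · subst hn
    filter_upwards [ae_all_iff.2 fun j : ℕ => h.coeff_zero (j + t), hΨ.coeff_zero] with ω h1 h2
    simp only [h1, h2, sub_zero, tendsto_const_nhds]
  · have h1 : ∀ j : ℕ, ∀ᵐ ω ∂μ, 0 ≤ j + t → increment ν α ⟨n, hn⟩ (j + t) (Ψ' ω) =
        increment ν α ⟨n, hn⟩ (j + t) (Ψ ω) := by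
      intro j
      by_cases hj : 0 ≤ j + t
      · filter_upwards [h.increment_ae_eq hΨ ha ⟨n, hn⟩ hj] with ω h2 _
        exact h2
      · exact Eventually.of_forall fun ω h2 => absurd h2 hj
    have htop : Tendsto (fun j : ℕ => (j : ℝ) + t) atTop atTop :=
      tendsto_atTop_add_const_right _ _ tendsto_natCast_atTop_atTop
    filter_upwards [ae_all_iff.2 h1] with ω h2
    have h3 : Tendsto (fun j : ℕ => (Real.exp (-((j + t) * ν * α ⟨n, hn⟩)) : ℂ) *
        (coeff n ((Ψ' ω).at 0) - coeff n ((Ψ ω).at 0))) atTop (𝓝 0) := by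
      have h4 : Tendsto (fun j : ℕ => Real.exp (-((j + t) * ν * α ⟨n, hn⟩))) atTop (𝓝 0) := by
        refine Real.tendsto_exp_neg_atTop_nhds_zero.comp ?_
        simp only [mul_assoc]
        exact htop.atTop_mul_const (ha _)
      have h5 := (Complex.continuous_ofReal.tendsto _).comp h4
      simpa using h5.mul_const (coeff n ((Ψ' ω).at 0) - coeff n ((Ψ ω).at 0))
    refine h3.congr' ?_
    filter_upwards [htop.eventually_ge_atTop 0] with j hj
    have h4 := h2 j hj
    simp only [increment] at h4
    linear_combination -h4

variable {I : Finset (ℝ × (Fin 2 → ℤ))} {c : ℝ × (Fin 2 → ℤ) → ℂ}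

theorem measurable_cexp_modeFun :
    Measurable fun ψ : PathSpace m => Complex.exp ((modeFun I c ψ : ℂ) * Complex.I) := by
  have := measurable_modeFun (m := m) I c
  fun_prop

theorem IsStationaryMildSolution.integral_cexp_shift
    (h : IsStationaryMildSolution μ H ν α lam β Ψ') (r : ℝ) :
    ∫ ω, Complex.exp ((modeFun I c (shift r (Ψ' ω)) : ℂ) * Complex.I) ∂μ =
      ∫ ω, Complex.exp ((modeFun I c (Ψ' ω) : ℂ) * Complex.I) ∂μ := by
  let e := I.equivFin
  let t : Fin I.card → ℝ := fun i => (e.symm i).1.1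
  let F : (Fin I.card → CmTorus m) → ℂ := fun x => Complex.exp
    (((∑ i, (c (e.symm i).1 * coeff (e.symm i).1.2 (x i)).re : ℝ) : ℂ) * Complex.I)
  have hF : Measurable F := by
    have : ∀ i, Measurable fun x : Fin I.card → CmTorus m => coeff (e.symm i).1.2 (x i) := fun i =>
      (coeff (e.symm i).1.2).continuous.measurable.comp (measurable_pi_apply i)
    have := fun i => Complex.measurable_re.comp ((this i).const_mul (c (e.symm i).1))
    have := Finset.measurable_sum Finset.univ fun i _ => this i
    exact Complex.measurable_exp.comp ((Complex.measurable_ofReal.comp this).mul_const _)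
  have h1 : ∀ r, (fun ω => Complex.exp ((modeFun I c (shift r (Ψ' ω)) : ℂ) * Complex.I)) =
      fun ω => F fun i => (Ψ' ω).at (t i + r) := by
    intro r
    funext ω
    simp only [F, t, modeFun, shift_at, add_comm r]
    rw [← Finset.sum_coe_sort I, ← e.symm.sum_comp]
  have h2 : ∀ r, AEMeasurable (fun ω (i : Fin I.card) => (Ψ' ω).at (t i + r)) μ := fun r =>
    aemeasurable_pi_lambda _ fun i =>
      (continuous_at_left (t i + r)).measurable.comp_aemeasurable h.measurable
  have h3 : ∀ r, ∫ ω, F (fun i => (Ψ' ω).at (t i + r)) ∂μ = ∫ ω, F (fun i => (Ψ' ω).at (t i)) ∂μ := by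
    intro r
    have h4 := h2 0
    simp only [add_zero] at h4
    rw [← integral_map (h2 r) hF.aestronglyMeasurable, h.stationary,
      integral_map h4 hF.aestronglyMeasurable]
  have h5 := h1 0
  simp only [shift_zero, id, add_zero] at h5
  rw [h1, h5, h3]

/-- Stationarity of each solution separately makes the difference of the characteristic functions
independent of the shift by `j`, and it tends to zero by dominated convergence. Joint stationarity
of the two solutions is not needed. -/
theorem IsStationaryMildSolution.map_eq (h : IsStationaryMildSolution μ H ν α lam β Ψ')
    (hΨ : IsFouField hβ ν α lam Ψ) (hH : 0 < H ∧ H < 1) (ha : ∀ k, 0 < ν * α k)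
    (hα : ∀ k, α (-k) = α k) : μ.map Ψ' = μ.map Ψ := by
  have := Measure.isProbabilityMeasure_map (μ := μ) h.measurable
  have := Measure.isProbabilityMeasure_map (μ := μ) hΨ.measurable.aemeasurable
  refine path_measure_ext fun I c => ?_
  rw [integral_map h.measurable measurable_cexp_modeFun.aestronglyMeasurable,
    integral_map hΨ.measurable.aemeasurable measurable_cexp_modeFun.aestronglyMeasurable]
  set E : PathSpace m → ℂ := fun ψ => Complex.exp ((modeFun I c ψ : ℂ) * Complex.I)
  have hE1 : ∀ ψ, ‖E ψ‖ = 1 := fun ψ => Complex.norm_exp_ofReal_mul_I _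
  have hEm : Measurable E := measurable_cexp_modeFun
  have hm' : ∀ j : ℕ, AEStronglyMeasurable (fun ω => E (shift j (Ψ' ω))) μ := fun j =>
    ((hEm.comp (measurable_shift_right _)).comp_aemeasurable h.measurable).aestronglyMeasurable
  have hm : ∀ j : ℕ, AEStronglyMeasurable (fun ω => E (shift j (Ψ ω))) μ := fun j =>
    ((hEm.comp (measurable_shift_right _)).comp hΨ.measurable).aestronglyMeasurable
  have hlim : Tendsto (fun j : ℕ => ∫ ω, E (shift j (Ψ' ω)) - E (shift j (Ψ ω)) ∂μ) atTop
      (𝓝 (∫ _ω, (0 : ℂ) ∂μ)) := by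
    refine tendsto_integral_of_dominated_convergence (fun _ => 2) (fun j => (hm' j).sub (hm j))
      (integrable_const _) (fun j => Eventually.of_forall fun ω => ?_) ?_
    · refine (norm_sub_le _ _).trans ?_
      rw [hE1, hE1]
      norm_num
    · have h1 : ∀ᵐ ω ∂μ, ∀ p ∈ I, Tendsto (fun j : ℕ =>
          coeff p.2 ((Ψ' ω).at (j + p.1)) - coeff p.2 ((Ψ ω).at (j + p.1))) atTop (𝓝 0) :=
        (Finset.eventually_all _).2 fun p _ => h.coeff_sub_ae_eq hΨ ha _ _
      filter_upwards [h1] with ω h2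
      have h3 : Tendsto (fun j : ℕ => |modeFun I c (shift j (Ψ' ω)) - modeFun I c (shift j (Ψ ω))|)
          atTop (𝓝 0) := by
        have h4 : Tendsto (fun j : ℕ => ∑ p ∈ I, (c p *
            (coeff p.2 ((Ψ' ω).at (j + p.1)) - coeff p.2 ((Ψ ω).at (j + p.1)))).re) atTop
            (𝓝 (∑ _p ∈ I, 0)) := by
          refine tendsto_finsetSum _ fun p hp => ?_
          have h5 := (h2 p hp).const_mul (c p)
          rw [mul_zero] at h5
          exact (Complex.continuous_re.tendsto 0).comp h5
        rw [Finset.sum_const_zero] at h4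
        rw [← abs_zero]
        refine h4.abs.congr fun j => ?_
        simp only [modeFun, shift_at, mul_sub, Complex.sub_re, Finset.sum_sub_distrib]
      refine squeeze_zero_norm (fun j => ?_) h3
      exact norm_cexp_sub_le _ _
  have hcongr : ∀ j : ℕ, ∫ ω, E (shift j (Ψ' ω)) - E (shift j (Ψ ω)) ∂μ =
      ∫ ω, E (Ψ' ω) ∂μ - ∫ ω, E (Ψ ω) ∂μ := by
    intro j
    have hb : ∀ Φ : W → PathSpace m, AEStronglyMeasurable (fun ω => E (shift j (Φ ω))) μ →
        Integrable (fun ω => E (shift j (Φ ω))) μ := fun Φ hΦ =>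
      Integrable.of_bound hΦ 1 (Eventually.of_forall fun ω => (hE1 _).le)
    rw [integral_sub (hb _ (hm' j)) (hb _ (hm j)), h.integral_cexp_shift]
    congr 1
    have h0 := hΨ.integral_cexp (I := I) (c := c) hH ha hα 0
    rw [shift_zero] at h0
    exact (hΨ.integral_cexp hH ha hα j).trans h0.symm
  simp only [hcongr, integral_zero] at hlim
  exact sub_eq_zero.1 (tendsto_nhds_unique tendsto_const_nhds hlim)

end Solution

/-- Every stationary law is compared with that of the one explicit field, so existence, uniqueness,
ergodicity and growth all refer to the same measure. The growth set is the explicit one, and the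
bound of the path over the window `[0, 1)` supplies the integrability it requires. -/
theorem exists_stationary_law {W : Type*} [MeasurableSpace W] {μ : Measure W} [IsProbabilityMeasure μ]
    {H ν γ : ℝ} {m : ℕ} {α lam : Mode → ℝ} {β : Mode → ℝ → W → ℂ}
    (hH : 0 < H ∧ H < 1) (hν : 0 < ν) (hγ : 0 < γ ∧ γ < 1)
    (hspec : IsSpectralData α lam) (hβ : IsNoise μ H β)
    (hsum₁ : Summable fun k : Mode =>
      lam k * α k ^ (2 * γ - 2 * H) * waveNorm k ^ (2 * (m : ℝ)))
    (hsum₂ : Summable fun k : Mode =>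
      lam k * α k ^ (-(2 * H)) * waveNorm k ^ (2 * (m : ℝ) + 2 * γ)) :
    ∃ P : Measure (PathSpace m), (∀ P' : Measure (PathSpace m),
      IsStationaryLaw μ H ν α lam β P' ↔ P' = P) ∧ IsErgodicMDS P shift ∧
      IsGrowthSet P (growthSet m) := by
  obtain ⟨γ', hγ0, hγ1, hγH, hs₁, hs₂⟩ := summable_weights hspec hH hγ hsum₁ hsum₂
  have hsum := summable_modeWeight hspec hν hs₁ hs₂
  obtain ⟨Ψ, C, hΨ, hG⟩ := hβ.exists_fouField hH hν hspec ⟨hγ0, hγ1⟩ hγH hsum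
  obtain ⟨c, hc, hcα⟩ := hspec.alpha_lower
  have ha : ∀ k, 0 < ν * α k := fun k => mul_pos hν (hc.trans_le (hcα k))
  have hP := hΨ.isErgodicMDS hH ha hspec.alpha_neg
  refine ⟨μ.map Ψ, fun P' => ⟨?_, ?_⟩, hP, isGrowthSet_growthSet hP ?_⟩
  · rintro ⟨Ψ', h, rfl⟩
    exact h.map_eq hΨ hH ha hspec.alpha_neg
  · rintro rfl
    exact ⟨Ψ, hΨ.isStationaryMildSolution hH hγ0.le ha hspec.alpha_neg hsum, rfl⟩
  · rw [lintegral_map measurable_windowSup hΨ.measurable]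
    obtain ⟨G, -, hGC, hG⟩ := hG 0
    refine ne_top_of_le_ne_top ENNReal.ofReal_ne_top ((lintegral_mono fun ω => ?_).trans hGC)
    exact iSup₂_le fun t ht => hG ω t (by simpa using ht)

end

end InertialParticle

theorem mainTheorem6 {W : Type*} [MeasurableSpace W] (μ : Measure W) [IsProbabilityMeasure μ]
    (H ν τ γ : ℝ) (m : ℕ) (α lam : Mode → ℝ) (β : Mode → ℝ → W → ℂ)
    (hH : 0 < H ∧ H < 1) (hν : 0 < ν) (hτ : 0 < τ) (hγ : 0 < γ ∧ γ < 1) (hm : 2 ≤ m)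
    (hspec : IsSpectralData α lam) (hβ : IsNoise μ H β)
    (hsum₁ : Summable fun k : Mode =>
      lam k * α k ^ (2 * γ - 2 * H) * waveNorm k ^ (2 * (m : ℝ)))
    (hsum₂ : Summable fun k : Mode =>
      lam k * α k ^ (-(2 * H)) * waveNorm k ^ (2 * (m : ℝ) + 2 * γ)) :
    ∃ P : Measure (PathSpace m),
      (∀ P' : Measure (PathSpace m), IsStationaryLaw μ H ν α lam β P' ↔ P' = P) ∧
      IsErgodicMDS P shift ∧
      (∃ Ω₀, IsGrowthSet P Ω₀) ∧
      ∀ (Ω₀ : Set (PathSpace m)) (hΩ₀ : IsGrowthSet P Ω₀),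
        ∃ φ : ℝ → Ω₀ → Phase → Phase,
          (∀ (ψ : Ω₀) (z : Phase) (c : ℝ → Phase),
            IsTrajectory τ ψ.1 z c ↔ c = fun t => φ t ψ z) ∧
          (∀ ψ : Ω₀, IsC1Ck (m - 1) (fun t => φ t ψ)) ∧
          IsCkRDS (m - 1) (P.comap Subtype.val) (shiftOn Ω₀ hΩ₀.invariant) φ := by
  obtain ⟨P, h1, h2, h3⟩ := exists_stationary_law hH hν hγ hspec hβ hsum₁ hsum₂
  exact ⟨P, h1, h2, ⟨_, h3⟩, fun Ω₀ hΩ₀ => exists_particle_rds hm h2 hΩ₀⟩
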